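/- Let $R_1,R_2$ be commutative rings with $1$, let $M$ be a (unital) $(R_1,R_2)$-bimodule, and let $R=\begin{pmatrix} R_1 & M\\ 0 & R_2\end{pmatrix}$ be the ring of upper triangular matrices with diagonal entries in $R_1$ and $R_2$ and upper right entry in $M$. Let $\ell$ be the least positive integer $k$ with $ka=0$ for all $a\in R_1\cup R_2$, and let $m$ be the least positive integer $k$ with $ka=0$ for all $a\in M$; if no such $k$ exists, put $\ell=0$ or $m=0$, respectively. Let $\mathbb Z\langle X\rangle$ be the free associative ring without $1$ on $X=\{x_1,x_2,\dots\}$, let $\mathrm{Id}(R,\mathbb Z)$ be the ideal of all $f\in\mathbb Z\langle X\rangle$ that vanish under every substitution of elements of $R$ for the variables, and for $n\ge 1$ let $P_n(\mathbb Z)$ be the additive subgroup of $\mathbb Z\langle X\rangle$ generated by the monomials $x_{\sigma(1)}x_{\sigma(2)}\cdots x_{\sigma(n)}$, $\sigma\in S_n$. The group $S_n$ acts on $P_n(\mathbb Z)$ by permuting the variables, $\sigma\cdot f(x_1,\dots,x_n)=f(x_{\sigma(1)},\dots,x_{\sigma(n)})$, so that $P_n(\mathbb Z)/(P_n(\mathbb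 Z)\cap \mathrm{Id}(R,\mathbb Z))$ is a $\mathbb ZS_n$-module. For a partition $\lambda\vdash n$ and a Young tableau $T_\lambda$ of shape $\lambda$ filled with $1,\dots,n$, let $a_{T_\lambda}=\sum_{\pi}\pi$ over the permutations $\pi$ that preserve the rows of $T_\lambda$, let $b_{T_\lambda}=\sum_{\sigma}(\operatorname{sign}\sigma)\sigma$ over the permutations $\sigma$ that preserve the columns of $T_\lambda$, and let $S(\lambda)=(\mathbb ZS_n)b_{T_\lambda}a_{T_\lambda}$ be the Specht module (up to isomorphism it does not depend on the choice of $T_\lambda$). Then for every $n\ge 1$ there is a finite chain of $\mathbb ZS_n$-submodules $$\frac{P_n(\mathbb Z)}{P_n(\mathbb Z)\cap \mathrm{Id}(R,\mathbb Z)}=C_0\supseteq C_1\supseteq\dots\supseteq C_N=0$$ whose factors $C_i/C_{i+1}$, $0\le i<N$, are, up to isomorphism of $\mathbb ZS_n$-modules, order, and counted with multiplicity, exactly the following: one copy of $\mathbb Z_\ell=\mathbb Z/\ell\mathbb Z$ with the trivial action of $S_n$ (where $\mathbb Z_0=\mathbb Z$), and, for each partition $\lambda=(\lambda_1,\lambda_2,\lambda_3)\vdash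 n$ (that is, integers $\lambda_1\ge\lambda_2\ge\lambda_3\ge 0$ with $\lambda_1+\lambda_2+\lambda_3=n$) with $\lambda_2\ge 1$ and $\lambda_3\in\{0,1\}$, $\lambda_1-\lambda_2+1$ copies of $S(\lambda)/mS(\lambda)$. (If $m=1$ or $\ell=1$, the corresponding factors are zero.) -/

import Mathlib

open Equiv

noncomputable section

namespace IntPI

/-- The free associative ring without unit on the countable set of variables `x₀, x₁, x₂, …`:
integer combinations of nonempty words. (The variable usually called `x_{i+1}` has index `i`.) -/
abbrev FreeRing : Type := MonoidAlgebra ℤ (FreeSemigroup ℕ)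

/-- `f` is a polynomial identity of `R` with integer coefficients if it vanishes under every
homomorphism (of rings without unit) from the free ring to `R`, i.e. under every substitution of
elements of `R` for the variables. -/
def IsPolynomialIdentity (R : Type*) [NonUnitalRing R] (f : FreeRing) : Prop :=
  ∀ ψ : FreeRing →ₙ+* R, ψ f = 0

/-- The group ring `ℤ Sₙ`, where `Sₙ` is the group of permutations of `{0, …, n - 1}`. -/
abbrev ZS (n : ℕ) : Type := MonoidAlgebra ℤ (Perm (Fin n))

/-- A permutation of `{0, …, n - 1}` as a permutation of `ℕ` that fixes all `i ≥ n`. -/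
def extendPerm (n : ℕ) : Perm (Fin n) →* Perm ℕ :=
  Equiv.Perm.viaEmbeddingHom Fin.valEmbedding

/-- The ring endomorphism of the free ring with `x_i ↦ x_{s i}`. -/
def renameHom (s : ℕ → ℕ) : FreeRing →ₙ+* FreeRing :=
  MonoidAlgebra.mapDomainNonUnitalRingHom ℤ (FreeSemigroup.map s)

lemma renameHom_id : renameHom id = NonUnitalRingHom.id FreeRing := by
  have h : FreeSemigroup.map (id : ℕ → ℕ) = MulHom.id _ := by
    apply FreeSemigroup.hom_ext; funext x; simp
  rw [renameHom, h, MonoidAlgebra.mapDomainNonUnitalRingHom_id]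

lemma renameHom_comp (s t : ℕ → ℕ) :
    renameHom (s ∘ t) = (renameHom s).comp (renameHom t) := by
  have h : FreeSemigroup.map (s ∘ t) = (FreeSemigroup.map s).comp (FreeSemigroup.map t) := by
    apply FreeSemigroup.hom_ext; funext x; simp
  rw [renameHom, h, MonoidAlgebra.mapDomainNonUnitalRingHom_comp]; rfl

/-- The action of `Sₙ` on the free ring by permutations of the variables
`x₀, …, x_{n-1}`. -/
def permRep (n : ℕ) : Representation ℤ (Perm (Fin n)) FreeRing where
  toFun σ := (renameHom (extendPerm n σ)).toAddMonoidHom.toIntLinearMap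
  map_one' := by
    refine LinearMap.ext fun f => ?_
    have h : (extendPerm n 1 : ℕ → ℕ) = id := by rw [map_one]; rfl
    have h2 := DFunLike.congr_fun renameHom_id f
    rw [← h] at h2
    exact h2
  map_mul' σ τ := by
    refine LinearMap.ext fun f => ?_
    have h : (extendPerm n (σ * τ) : ℕ → ℕ) = extendPerm n σ ∘ extendPerm n τ := by
      rw [map_mul]; rfl
    have h2 := DFunLike.congr_fun (renameHom_comp (extendPerm n σ) (extendPerm n τ)) f
    rw [← h] at h2
    exact h2

/-- The words `x_{σ(0)} x_{σ(1)} ⋯ x_{σ(n-1)}`, `σ ∈ Sₙ` (there are none if `n = 0`). -/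
def multilinearWords (n : ℕ) : Set (FreeSemigroup ℕ) :=
  {w | ∃ σ : Perm (Fin n), w.head :: w.tail = List.ofFn (fun i => (σ i : ℕ))}

/-- The multilinear monomials `x_{σ(0)} x_{σ(1)} ⋯ x_{σ(n-1)}`, `σ ∈ Sₙ`, in the free ring. -/
def multilinearMonomials (n : ℕ) : Set FreeRing :=
  (fun w => MonoidAlgebra.single w (1 : ℤ)) '' multilinearWords n

lemma map_head_tail (s : ℕ → ℕ) (w : FreeSemigroup ℕ) :
    (FreeSemigroup.map s w).head :: (FreeSemigroup.map s w).tail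
      = (w.head :: w.tail).map s := by
  induction w using FreeSemigroup.recOnMul with
  | ih1 x => rfl
  | ih2 x y hx hy =>
    rw [map_mul]
    simp only [FreeSemigroup.head_mul, FreeSemigroup.tail_mul]
    rw [← List.cons_append, hx, hy]
    simp

lemma map_mem_multilinearWords {n : ℕ} (σ : Perm (Fin n)) {w : FreeSemigroup ℕ}
    (hw : w ∈ multilinearWords n) :
    FreeSemigroup.map (extendPerm n σ) w ∈ multilinearWords n := by
  obtain ⟨τ, hτ⟩ := hw
  refine ⟨σ * τ, ?_⟩
  rw [map_head_tail, hτ, List.map_ofFn]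
  congr 1
  funext i
  exact Equiv.Perm.viaEmbedding_apply σ Fin.valEmbedding (τ i)

/-- `Pₙ`, the additive subgroup of the free ring generated by the multilinear monomials in
`x₀, …, x_{n-1}`, with the action of `Sₙ` by permutations of variables. -/
def multilinear (n : ℕ) : Subrepresentation (permRep n) where
  toSubmodule := Submodule.span ℤ (multilinearMonomials n)
  apply_mem_toSubmodule σ v hv := by
    induction hv using Submodule.span_induction with
    | mem x hx =>
      obtain ⟨w, hw, rfl⟩ := hx
      apply Submodule.subset_span
      refine ⟨_, map_mem_multilinearWords σ hw, ?_⟩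
      exact (MonoidAlgebra.mapDomain_single).symm
    | zero => rw [map_zero]; exact Submodule.zero_mem _
    | add x y _ _ hx hy => rw [map_add]; exact Submodule.add_mem _ hx hy
    | smul a x _ hx => rw [map_smul]; exact Submodule.smul_mem _ a hx

/-- `Id(R, ℤ)`, the set of polynomial identities of `R` with integer coefficients, with the action
of `Sₙ` by permutations of variables. -/
def identities (n : ℕ) (R : Type*) [NonUnitalRing R] : Subrepresentation (permRep n) where
  toSubmodule :=
    { carrier := {f | IsPolynomialIdentity R f}
      add_mem' := fun hf hg ψ => by rw [map_add, hf ψ, hg ψ, add_zero]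
      zero_mem' := fun ψ => map_zero ψ
      smul_mem' := fun a f hf ψ => by rw [map_zsmul, hf ψ, smul_zero] }
  apply_mem_toSubmodule σ _ hf := fun ψ => hf (ψ.comp (renameHom (extendPerm n σ)))

/-- The `ℤ Sₙ`-module `Pₙ / (Pₙ ∩ Id(R, ℤ))`. -/
abbrev PolyFunctions (n : ℕ) (R : Type*) [NonUnitalRing R] : Type :=
  (multilinear n).asSubmodule ⧸
    (identities n R).asSubmodule.submoduleOf (multilinear n).asSubmodule

/-! ### Specht modules over the integers -/

/-- A Young tableau of shape `μ` filled with the numbers `0, …, n - 1`, each occurring once: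
`T i` is the box that contains `i`. -/
abbrev Tableau (n : ℕ) (μ : YoungDiagram) : Type := Fin n ≃ μ.cells

lemma nonempty_tableau {n : ℕ} {μ : YoungDiagram} (h : μ.card = n) : Nonempty (Tableau n μ) :=
  ⟨(Fintype.equivFinOfCardEq (by simpa using h)).symm⟩

namespace Tableau

variable {n : ℕ} {μ : YoungDiagram}

/-- The row (counted from `0`) of the box that contains `i`. -/
def row (T : Tableau n μ) (i : Fin n) : ℕ := (T i : ℕ × ℕ).1

/-- The column (counted from `0`) of the box that contains `i`. -/
def col (T : Tableau n μ) (i : Fin n) : ℕ := (T i : ℕ × ℕ).2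

/-- `a_T`, the sum of all permutations that preserve the rows of `T`. -/
def rowSymmetrizer (T : Tableau n μ) : ZS n :=
  ∑ σ : Perm (Fin n) with ∀ i, row T (σ i) = row T i, MonoidAlgebra.single σ 1

/-- `b_T`, the signed sum of all permutations that preserve the columns of `T`. -/
def colSymmetrizer (T : Tableau n μ) : ZS n :=
  ∑ σ : Perm (Fin n) with ∀ i, col T (σ i) = col T i,
    MonoidAlgebra.single σ ((Perm.sign σ : ℤˣ) : ℤ)

/-- The Specht module `(ℤ Sₙ) b_T a_T`. -/
def specht (T : Tableau n μ) : Submodule (ZS n) (ZS n) :=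
  Submodule.span (ZS n) {colSymmetrizer T * rowSymmetrizer T}

/-- `S / m S`, where `S = (ℤ Sₙ) b_T a_T`. -/
abbrev SpechtMod (T : Tableau n μ) (m : ℕ) : Type :=
  specht T ⧸ LinearMap.range (m • (LinearMap.id : specht T →ₗ[ZS n] specht T))

end Tableau

/-- The `ℤ Sₙ`-module `ℤ_ℓ = ℤ / ℓ ℤ` with the trivial action of `Sₙ`. -/
abbrev TrivialMod (n ℓ : ℕ) : Type :=
  (Representation.trivial ℤ (Perm (Fin n)) (ZMod ℓ)).asModule

/-- The partitions `λ = (λ₁, λ₂, λ₃)` of `n` with `λ₂ ≥ 1` and `λ₃ ∈ {0, 1}`, as Young diagrams.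
(`rowLen i` is `λ_{i+1}`.) -/
def Shape (n : ℕ) : Type :=
  {μ : YoungDiagram // μ.card = n ∧ 1 ≤ μ.rowLen 1 ∧ μ.rowLen 2 ≤ 1 ∧ μ.rowLen 3 = 0}

/-- The labels of the factors: one label `none`, and `λ₁ - λ₂ + 1` labels for each `λ`. -/
abbrev FactorLabel (n : ℕ) : Type :=
  Option (Σ μ : Shape n, Fin (μ.1.rowLen 0 - μ.1.rowLen 1 + 1))

/-! ### Upper triangular matrix rings -/

/-- The matrices with rows `(a, u)` and `(0, b)` where `a ∈ R₁`, `u ∈ M`, `b ∈ R₂`. -/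
@[ext]
structure UpperTriangular (R₁ M R₂ : Type*) where
  a : R₁
  u : M
  b : R₂

namespace UpperTriangular

variable {R₁ M R₂ : Type*} [CommRing R₁] [CommRing R₂] [AddCommGroup M]

instance : Zero (UpperTriangular R₁ M R₂) := ⟨⟨0, 0, 0⟩⟩
instance : One (UpperTriangular R₁ M R₂) := ⟨⟨1, 0, 1⟩⟩
instance : Add (UpperTriangular R₁ M R₂) := ⟨fun x y => ⟨x.a + y.a, x.u + y.u, x.b + y.b⟩⟩
instance : Neg (UpperTriangular R₁ M R₂) := ⟨fun x => ⟨-x.a, -x.u, -x.b⟩⟩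

@[simp] lemma zero_a : (0 : UpperTriangular R₁ M R₂).a = 0 := rfl
@[simp] lemma zero_u : (0 : UpperTriangular R₁ M R₂).u = 0 := rfl
@[simp] lemma zero_b : (0 : UpperTriangular R₁ M R₂).b = 0 := rfl
@[simp] lemma one_a : (1 : UpperTriangular R₁ M R₂).a = 1 := rfl
@[simp] lemma one_u : (1 : UpperTriangular R₁ M R₂).u = 0 := rfl
@[simp] lemma one_b : (1 : UpperTriangular R₁ M R₂).b = 1 := rfl
@[simp] lemma add_a (x y : UpperTriangular R₁ M R₂) : (x + y).a = x.a + y.a := rfl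
@[simp] lemma add_u (x y : UpperTriangular R₁ M R₂) : (x + y).u = x.u + y.u := rfl
@[simp] lemma add_b (x y : UpperTriangular R₁ M R₂) : (x + y).b = x.b + y.b := rfl
@[simp] lemma neg_a (x : UpperTriangular R₁ M R₂) : (-x).a = -x.a := rfl
@[simp] lemma neg_u (x : UpperTriangular R₁ M R₂) : (-x).u = -x.u := rfl
@[simp] lemma neg_b (x : UpperTriangular R₁ M R₂) : (-x).b = -x.b := rfl
variable [Module R₁ M] [Module R₂ᵐᵒᵖ M]

/-- Matrix multiplication; `MulOpposite.op b • u` is the right action `u b`. -/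
instance : Mul (UpperTriangular R₁ M R₂) :=
  ⟨fun x y => ⟨x.a * y.a, x.a • y.u + MulOpposite.op y.b • x.u, x.b * y.b⟩⟩

@[simp] lemma mul_a (x y : UpperTriangular R₁ M R₂) : (x * y).a = x.a * y.a := rfl
@[simp] lemma mul_u (x y : UpperTriangular R₁ M R₂) :
    (x * y).u = x.a • y.u + MulOpposite.op y.b • x.u := rfl
@[simp] lemma mul_b (x y : UpperTriangular R₁ M R₂) : (x * y).b = x.b * y.b := rfl

instance [SMulCommClass R₁ R₂ᵐᵒᵖ M] : Ring (UpperTriangular R₁ M R₂) where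
  add_assoc x y z := by ext <;> simp [add_assoc]
  zero_add x := by ext <;> simp
  add_zero x := by ext <;> simp
  add_comm x y := by ext <;> simp [add_comm]
  neg_add_cancel x := by ext <;> simp
  left_distrib x y z := by
    ext <;> simp [mul_add, add_smul]
    abel
  right_distrib x y z := by
    ext <;> simp [add_mul, add_smul]
    abel
  zero_mul x := by ext <;> simp
  mul_zero x := by ext <;> simp
  mul_assoc x y z := by
    ext
    · simp [mul_assoc]
    · simp only [mul_a, mul_u, mul_b, smul_add, mul_smul, MulOpposite.op_mul]
      rw [smul_comm x.a (MulOpposite.op z.b) y.u]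
      abel
    · simp [mul_assoc]
  one_mul x := by ext <;> simp
  mul_one x := by ext <;> simp
  nsmul := nsmulRec
  zsmul := zsmulRec

end UpperTriangular

/-- The least positive integer `k` with `k a = 0` for all `a ∈ R₁ ∪ R₂`, or `0` if there is none. -/
def ringExponent (R₁ R₂ : Type*) [CommRing R₁] [CommRing R₂] : ℕ :=
  sInf {k : ℕ | 0 < k ∧ (∀ a : R₁, k • a = 0) ∧ ∀ a : R₂, k • a = 0}

/-- The least positive integer `k` with `k a = 0` for all `a ∈ M`, or `0` if there is none. -/
def moduleExponent (M : Type*) [AddCommGroup M] : ℕ :=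
  sInf {k : ℕ | 0 < k ∧ ∀ a : M, k • a = 0}

end IntPI

end

noncomputable section

namespace IntPI

open MvPolynomial

/-! Let f be multilinear. Its diagonal values are the coefficient sum of f times a product of
diagonal entries. Its upper right entry is a sum over pairs (B, k): an integer coefficient times
(∏_{i ∈ B} a_i) · u_k · (the product of the remaining b_i), where the coefficient adds up those of
the words in which B is exactly the set of letters in front of k. Substituting identity matrices
shows that ℓ divides the coefficient sum of an identity (`dvd_augmentation`); substituting
idempotents and one matrix from the corner isolates a single pair, so m divides every pair
coefficient (`dvd_prefixCoeff`). The coefficient sum yields the factor ℤ_ℓ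
(`nonempty_trivialMod_equiv`). On its kernel K, f is an identity exactly when its pair coefficients
are m times those of some element of K (`isPolynomialIdentity_iff`).

The pair coefficients are encoded in one polynomial `toPoly f`, the upper right entry at the
matrices with rows (1 + c_i, u_i), (0, 1). A Koszul-type argument shows that the image of K consists
of the multilinear polynomials of degree 1 in the u_i that are killed by the derivation `Eu`: u_i ↦
c_i (`map_augmentationKer`).

This space is filtered with the derivations `Dc`: c_i ↦ 1 and `Du`: u_i ↦ 1. On the component of
degree j + 1 one uses the maps Dc^(j-i) Du (e = 0) and Dc^(j-i) (e = 1) for 1 ≤ i ≤ j, i + j + e ≤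
n, ordered lexicographically by (j, e, i); the chain consists of the common kernels of the initial
segments. Other values of i give nothing new: i = 0 because of `Eu`, and large i because powers of
`Dc` are injective in high degree (`eq_zero_of_iterate_Dc_V`, `eq_zero_of_iterate_Dc_W`). On the
common kernel of the earlier maps, the image of the next one is exactly (j-i)! times the span of
certain products of minors of the matrix with rows 1, c, u (`exists_factorMap_eq`,
`exists_preimage_gen`); this rests on explicit generators for kernels of derivations over ℤ
(`mem_SV_of_Dc_eq_zero`, `mem_SW_of_eq_zero`).

Such a product is b_T applied to a monomial whose stabilizer is the row group of T, for T of shape λ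
= (n-i-e, i, e), so the image is S(λ) (`nonempty_equiv_specht`). For fixed λ, j runs from λ₂ to λ₁,
whence the multiplicity. Since polynomials are torsion-free, passing to the quotient by the
identities turns each S(λ) into S(λ)/mS(λ) (`nonempty_factor_equiv`). -/

/-- Integer polynomials in two families of variables `c i`, `u i`. -/
abbrev Poly (ι : Type*) : Type _ := MvPolynomial (ι ⊕ ι) ℤ

/-! ### Three derivations and their commutation relations -/

namespace Poly

variable {ι : Type*}

/-- The variable `c i`. -/
def cv (i : ι) : Poly ι := X (Sum.inl i)

/-- The variable `u i`. -/
def uv (i : ι) : Poly ι := X (Sum.inr i)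

/-- The derivation with `c i ↦ 1` and `u i ↦ 0`. -/
def Dc : Derivation ℤ (Poly ι) (Poly ι) := mkDerivation ℤ (Sum.elim (fun _ => 1) (fun _ => 0))

/-- The derivation with `c i ↦ 0` and `u i ↦ 1`. -/
def Du : Derivation ℤ (Poly ι) (Poly ι) := mkDerivation ℤ (Sum.elim (fun _ => 0) (fun _ => 1))

/-- The derivation with `c i ↦ 0` and `u i ↦ c i`. -/
def Eu : Derivation ℤ (Poly ι) (Poly ι) := mkDerivation ℤ (Sum.elim (fun _ => 0) cv)

@[simp] lemma Dc_cv (i : ι) : Dc (cv i) = 1 := by simp [Dc, cv, mkDerivation_X]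
@[simp] lemma Dc_uv (i : ι) : Dc (uv i) = 0 := by simp [Dc, uv, mkDerivation_X]
@[simp] lemma Du_cv (i : ι) : Du (cv i) = 0 := by simp [Du, cv, mkDerivation_X]
@[simp] lemma Du_uv (i : ι) : Du (uv i) = 1 := by simp [Du, uv, mkDerivation_X]
@[simp] lemma Eu_cv (i : ι) : Eu (cv i) = 0 := by simp [Eu, cv, mkDerivation_X]
@[simp] lemma Eu_uv (i : ι) : Eu (uv i) = cv i := by simp [Eu, uv, mkDerivation_X]

lemma derivation_eq {D D' : Derivation ℤ (Poly ι) (Poly ι)} (hc : ∀ i, D (cv i) = D' (cv i))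
    (hu : ∀ i, D (uv i) = D' (uv i)) : D = D' := by
  refine MvPolynomial.derivation_ext fun i => ?_
  rcases i with i | i
  · exact hc i
  · exact hu i

/-- A commutator of derivations is a derivation, so `[Dc, Eu] = Du` need only be checked on the
variables. -/
lemma Dc_Eu (F : Poly ι) : Dc (Eu F) = Eu (Dc F) + Du F := by
  have h : ⁅(Dc : Derivation ℤ (Poly ι) (Poly ι)), (Eu : Derivation ℤ (Poly ι) (Poly ι))⁆ = Du := by
    apply derivation_eq <;> intro i <;> simp [Derivation.commutator_apply]
  rw [← h, Derivation.commutator_apply]; ring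

lemma Dc_Du (F : Poly ι) : Dc (Du F) = Du (Dc F) := by
  have h : ⁅(Dc : Derivation ℤ (Poly ι) (Poly ι)), (Du : Derivation ℤ (Poly ι) (Poly ι))⁆ = 0 := by
    apply derivation_eq <;> intro i <;> simp [Derivation.commutator_apply]
  have := DFunLike.congr_fun h F
  rw [Derivation.commutator_apply] at this
  exact sub_eq_zero.1 this

lemma iterate_Dc_Du (r : ℕ) (F : Poly ι) : Dc^[r] (Du F) = Du (Dc^[r] F) := by
  induction r generalizing F with
  | zero => rfl
  | succ r ih => rw [Function.iterate_succ_apply, Function.iterate_succ_apply, Dc_Du, ih]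

lemma iterate_Dc_zero (r : ℕ) : Dc^[r] (0 : Poly ι) = 0 := iterate_map_zero _ _

lemma iterate_Dc_add (r : ℕ) (F G : Poly ι) : Dc^[r] (F + G) = Dc^[r] F + Dc^[r] G :=
  iterate_map_add _ _ _ _

lemma iterate_Dc_mul_of_Dc_eq_zero {a : Poly ι} (ha : Dc a = 0) (r : ℕ) (F : Poly ι) :
    Dc^[r] (a * F) = a * Dc^[r] F := by
  induction r with
  | zero => rfl
  | succ r ih =>
    rw [Function.iterate_succ_apply', Function.iterate_succ_apply', ih, Derivation.leibniz, ha]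
    simp

lemma iterate_Dc_cv_mul (k : ι) (r : ℕ) (F : Poly ι) :
    Dc^[r + 1] (cv k * F) = cv k * Dc^[r + 1] F + (r + 1) * Dc^[r] F := by
  induction r with
  | zero => simp
  | succ r ih =>
    rw [Function.iterate_succ_apply', ih, map_add, Derivation.leibniz, Derivation.leibniz]
    have h : Dc ((r : Poly ι) + 1) = 0 := by simp
    rw [h, ← Function.iterate_succ_apply' Dc, ← Function.iterate_succ_apply' Dc]
    simp; ring

/-- Iterates `[Dc, Eu] = Du`, using that `Du` commutes with `Dc`. It converts `Eu F = 0` into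
information on the powers of `Dc`. -/
lemma iterate_Dc_Eu (r : ℕ) (F : Poly ι) :
    Dc^[r + 1] (Eu F) = Eu (Dc^[r + 1] F) + (r + 1) * Dc^[r] (Du F) := by
  induction r generalizing F with
  | zero =>
    rw [Function.iterate_succ_apply, Function.iterate_succ_apply, Dc_Eu]
    simp
  | succ r ih =>
    have h1 := ih (Dc F)
    rw [← Dc_Du, ← Function.iterate_succ_apply Dc r (Du F),
      ← Function.iterate_succ_apply Dc (r + 1) F] at h1
    rw [Function.iterate_succ_apply, Dc_Eu, iterate_Dc_add, h1]
    push_cast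
    ring

/-- `r!` divides `Dc ^ r`. -/
lemma exists_iterate_Dc_eq_factorial_mul (F : Poly ι) (r : ℕ) :
    ∃ G, Dc^[r] F = (r.factorial : ℤ) • G := by
  induction F using MvPolynomial.induction_on generalizing r with
  | C a =>
    cases r with
    | zero => exact ⟨C a, by simp⟩
    | succ r =>
      refine ⟨0, ?_⟩
      rw [Function.iterate_succ_apply]
      have : Dc (C a : Poly ι) = 0 := Derivation.map_algebraMap Dc a
      rw [this, iterate_Dc_zero, smul_zero]
  | add p q hp hq =>
    obtain ⟨G, hG⟩ := hp r
    obtain ⟨H, hH⟩ := hq r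
    exact ⟨G + H, by rw [iterate_Dc_add, hG, hH, smul_add]⟩
  | mul_X p i hp =>
    rw [mul_comm]
    rcases i with i | i
    · cases r with
      | zero => exact ⟨_, by simp; rfl⟩
      | succ r =>
        obtain ⟨G, hG⟩ := hp (r + 1)
        obtain ⟨H, hH⟩ := hp r
        -- In Dc^(r+1) (c_i p) the second term is (r+1) Dc^r p, and (r+1) · r! supplies the missing
        -- factorial.
        refine ⟨cv i * G + H, ?_⟩
        have := iterate_Dc_cv_mul i r p
        rw [cv] at this
        rw [this, hG, hH, Nat.factorial_succ, cv]
        simp only [zsmul_eq_mul]; push_cast; ring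
    · obtain ⟨G, hG⟩ := hp r
      refine ⟨uv i * G, ?_⟩
      have := iterate_Dc_mul_of_Dc_eq_zero (Dc_uv i) r p
      rw [uv] at this
      rw [this, hG, mul_smul_comm, uv]

/-! ### Polynomials that do not involve the variables with index `k` -/

/-- `F` involves neither `c k` nor `u k`. -/
def Free (k : ι) (F : Poly ι) : Prop := pderiv (Sum.inl k) F = 0 ∧ pderiv (Sum.inr k) F = 0


lemma Free.mul {k : ι} {F G : Poly ι} (hF : Free k F) (hG : Free k G) : Free k (F * G) := by
  simp [Free, Derivation.leibniz, hF.1, hF.2, hG.1, hG.2]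

lemma Free.add {k : ι} {F G : Poly ι} (hF : Free k F) (hG : Free k G) : Free k (F + G) := by
  simp [Free, hF.1, hF.2, hG.1, hG.2]

lemma Free.zsmul {k : ι} {F : Poly ι} (hF : Free k F) (z : ℤ) : Free k (z • F) := by
  simp only [Free, Derivation.map_smul, hF.1, hF.2, smul_zero, and_self]

lemma Free.natCast_mul {k : ι} {F : Poly ι} (hF : Free k F) (z : ℕ) : Free k (z * F) := by
  have := hF.zsmul z
  rwa [zsmul_eq_mul, Int.cast_natCast] at this

lemma Free.zero (k : ι) : Free k (0 : Poly ι) := by simp [Free]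

lemma Free.one (k : ι) : Free k (1 : Poly ι) := by simp [Free]

lemma pderiv_cv [DecidableEq ι] (k i : ι) : pderiv (Sum.inl k) (cv i) = if i = k then 1 else 0 := by
  simp [cv, pderiv_X, Pi.single_apply]
lemma pderiv_uv [DecidableEq ι] (k i : ι) : pderiv (Sum.inr k) (uv i) = if i = k then 1 else 0 := by
  simp [uv, pderiv_X, Pi.single_apply]
lemma pderiv_inr_cv (k i : ι) : pderiv (Sum.inr k) (cv i) = 0 := by
  classical simp [cv, pderiv_X]
lemma pderiv_inl_uv (k i : ι) : pderiv (Sum.inl k) (uv i) = 0 := by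
  classical simp [uv, pderiv_X]

lemma Free.cv {k i : ι} (h : i ≠ k) : Free k (cv i) := by
  classical simp [Free, pderiv_cv, pderiv_inr_cv, h]

lemma Free.uv {k i : ι} (h : i ≠ k) : Free k (uv i) := by
  classical simp [Free, pderiv_uv, pderiv_inl_uv, h]

lemma Free.apply_Dc {k : ι} {F : Poly ι} (hF : Free k F) : Free k (Dc F) := by
  classical
  have h (x) (hx : x = Sum.inl k ∨ x = Sum.inr k) :
      ⁅(pderiv x : Derivation ℤ (Poly ι) (Poly ι)), (Dc : Derivation ℤ (Poly ι) (Poly ι))⁆ = 0 := by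
    apply derivation_eq <;> intro i <;> rcases hx with rfl | rfl <;>
      simp [Derivation.commutator_apply, pderiv_cv, pderiv_uv, pderiv_inr_cv, pderiv_inl_uv] <;>
      split_ifs <;> simp
  constructor
  · have := DFunLike.congr_fun (h _ (.inl rfl)) F
    rwa [Derivation.commutator_apply, hF.1, map_zero, sub_zero] at this
  · have := DFunLike.congr_fun (h _ (.inr rfl)) F
    rwa [Derivation.commutator_apply, hF.2, map_zero, sub_zero] at this

lemma Free.apply_Du {k : ι} {F : Poly ι} (hF : Free k F) : Free k (Du F) := by
  classical
  have h (x) (hx : x = Sum.inl k ∨ x = Sum.inr k) :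
      ⁅(pderiv x : Derivation ℤ (Poly ι) (Poly ι)), (Du : Derivation ℤ (Poly ι) (Poly ι))⁆ = 0 := by
    apply derivation_eq <;> intro i <;> rcases hx with rfl | rfl <;>
      simp [Derivation.commutator_apply, pderiv_cv, pderiv_uv, pderiv_inr_cv, pderiv_inl_uv] <;>
      split_ifs <;> simp
  constructor
  · have := DFunLike.congr_fun (h _ (.inl rfl)) F
    rwa [Derivation.commutator_apply, hF.1, map_zero, sub_zero] at this
  · have := DFunLike.congr_fun (h _ (.inr rfl)) F
    rwa [Derivation.commutator_apply, hF.2, map_zero, sub_zero] at this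

/-- The commutator of ∂/∂c_k with `Eu` is ∂/∂u_k, not 0, which is why `Free` asks for both
derivatives to vanish. -/
lemma Free.apply_Eu {k : ι} {F : Poly ι} (hF : Free k F) : Free k (Eu F) := by
  classical
  have h1 : ⁅(pderiv (Sum.inl k) : Derivation ℤ (Poly ι) (Poly ι)),
      (Eu : Derivation ℤ (Poly ι) (Poly ι))⁆ = pderiv (Sum.inr k) := by
    apply derivation_eq <;> intro i <;>
      simp [Derivation.commutator_apply, pderiv_cv, pderiv_uv, pderiv_inr_cv, pderiv_inl_uv]
    split_ifs <;> simp
  have h2 : ⁅(pderiv (Sum.inr k) : Derivation ℤ (Poly ι) (Poly ι)),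
      (Eu : Derivation ℤ (Poly ι) (Poly ι))⁆ = 0 := by
    apply derivation_eq <;> intro i <;>
      simp [Derivation.commutator_apply, pderiv_uv, pderiv_inr_cv]
    split_ifs <;> simp
  constructor
  · have := DFunLike.congr_fun h1 F
    rwa [Derivation.commutator_apply, hF.1, hF.2, map_zero, sub_zero] at this
  · have := DFunLike.congr_fun h2 F
    rwa [Derivation.commutator_apply, hF.2, map_zero, sub_zero] at this

lemma Free.apply_iterate_Dc {k : ι} {F : Poly ι} (hF : Free k F) (r : ℕ) : Free k (Dc^[r] F) := by
  induction r generalizing F with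
  | zero => exact hF
  | succ r ih => exact ih hF.apply_Dc

/-- The derivatives ∂/∂c_k and ∂/∂u_k single out Q and R. All inductions on the index set compare
coefficients in this way. -/
lemma eq_zero_of_free {k : ι} {P Q R : Poly ι} (hP : Free k P) (hQ : Free k Q) (hR : Free k R)
    (h : P + cv k * Q + uv k * R = 0) : P = 0 ∧ Q = 0 ∧ R = 0 := by
  classical
  have h1 := congrArg (pderiv (Sum.inl k)) h
  have h2 := congrArg (pderiv (Sum.inr k)) h
  simp [Derivation.leibniz, pderiv_cv, pderiv_uv, pderiv_inr_cv, pderiv_inl_uv, hP.1, hP.2, hQ.1,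
    hQ.2, hR.1, hR.2] at h1 h2
  subst h1 h2
  simpa using h

lemma eq_zero_of_free' {k : ι} {P Q : Poly ι} (hP : Free k P) (hQ : Free k Q)
    (h : P + cv k * Q = 0) : P = 0 ∧ Q = 0 := by
  have := eq_zero_of_free hP hQ (Free.zero k) (by rw [h, mul_zero, add_zero])
  exact ⟨this.1, this.2.1⟩

end Poly
end IntPI

/-! ### Multilinear polynomials over a finite index set -/

namespace IntPI.Poly
open MvPolynomial

variable {ι : Type*}

/-- The product of the `c i`, `i ∈ B`. -/
def cmon (B : Finset ι) : Poly ι := ∏ i ∈ B, cv i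

@[simp] lemma cmon_empty : cmon (∅ : Finset ι) = 1 := by simp [cmon]

lemma cmon_insert [DecidableEq ι] {k : ι} {B : Finset ι} (h : k ∉ B) :
    cmon (insert k B) = cv k * cmon B := by simp [cmon, Finset.prod_insert h]

lemma Free.cmon {k : ι} {B : Finset ι} (h : k ∉ B) : Free k (cmon B) := by
  classical
  induction B using Finset.induction with
  | empty => simpa using Free.one k
  | insert i B hi ih =>
    rw [Finset.mem_insert, not_or] at h
    rw [cmon_insert hi]
    exact (Free.cv (Ne.symm h.1)).mul (ih h.2)

lemma Free.of_mem_span {k : ι} {S : Set (Poly ι)} (hS : ∀ F ∈ S, Free k F) {F : Poly ι}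
    (hF : F ∈ Submodule.span ℤ S) : Free k F := by
  induction hF using Submodule.span_induction with
  | mem x hx => exact hS x hx
  | zero => exact Free.zero k
  | add x y _ _ hx hy => exact hx.add hy
  | smul a x _ hx => exact hx.zsmul a

lemma map_mem_of_span {S : Set (Poly ι)} {N : Submodule ℤ (Poly ι)}
    (D : Poly ι →ₗ[ℤ] Poly ι) (h : ∀ F ∈ S, D F ∈ N) {F : Poly ι}
    (hF : F ∈ Submodule.span ℤ S) : D F ∈ N :=
  (Submodule.span_le (p := N.comap D)).2 h hF

/-- Squarefree polynomials of degree `j` in the variables `c i`, `i ∈ s`. -/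
def V (s : Finset ι) (j : ℕ) : Submodule ℤ (Poly ι) :=
  Submodule.span ℤ {f | ∃ B ⊆ s, B.card = j ∧ f = cmon B}

variable {s : Finset ι} {j : ℕ} {k : ι}

lemma cmon_mem_V {B : Finset ι} (h : B ⊆ s) : cmon B ∈ V s B.card :=
  Submodule.subset_span ⟨B, h, rfl, rfl⟩

lemma free_of_mem_V (hk : k ∉ s) {f : Poly ι} (hf : f ∈ V s j) : Free k f := by
  refine Free.of_mem_span ?_ hf
  rintro _ ⟨B, hB, -, rfl⟩
  exact Free.cmon fun h => hk (hB h)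

lemma V_empty_succ : V (∅ : Finset ι) (j + 1) = ⊥ := by
  rw [V, Submodule.span_eq_bot]
  rintro _ ⟨B, hB, hj, rfl⟩
  rw [Finset.subset_empty.1 hB] at hj
  simp at hj

lemma V_zero : V s 0 = Submodule.span ℤ {1} := by
  rw [V]
  congr 1
  ext f
  constructor
  · rintro ⟨B, -, hB, rfl⟩
    rw [Finset.card_eq_zero.1 hB]; simp
  · rintro rfl
    exact ⟨∅, by simp, by simp, by simp⟩

lemma eq_zero_of_natCast_mul {F : Poly ι} (r : ℕ) (h : ((r : Poly ι) + 1) * F = 0) : F = 0 := by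
  rcases mul_eq_zero.1 h with h | h
  · exact absurd h (by exact_mod_cast Nat.succ_ne_zero r)
  · exact h

variable [DecidableEq ι]

/-- Multilinear polynomials of degree `j` in the `c i` and `1` in the `u i`, `i ∈ s`. -/
def W (s : Finset ι) (j : ℕ) : Submodule ℤ (Poly ι) :=
  Submodule.span ℤ {F | ∃ k ∈ s, ∃ B ⊆ s.erase k, B.card = j ∧ F = uv k * cmon B}

lemma uv_mul_cmon_mem_W {B : Finset ι} (hk : k ∈ s) (h : B ⊆ s) (hkB : k ∉ B) :
    uv k * cmon B ∈ W s B.card :=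
  Submodule.subset_span ⟨k, hk, B, fun _ hi => Finset.mem_erase.2 ⟨fun e => hkB (e ▸ hi), h hi⟩,
    rfl, rfl⟩

lemma W_mono {t : Finset ι} (h : s ⊆ t) : W s j ≤ W t j :=
  Submodule.span_mono fun _ ⟨k, hk, B, hB, hj, e⟩ =>
    ⟨k, h hk, B, hB.trans (Finset.erase_subset_erase _ h), hj, e⟩

lemma free_of_mem_W (hk : k ∉ s) {f : Poly ι} (hf : f ∈ W s j) : Free k f := by
  refine Free.of_mem_span ?_ hf
  rintro _ ⟨i, hi, B, hB, -, rfl⟩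
  exact (Free.uv fun e => hk (by rwa [← e])).mul
    (Free.cmon fun h => hk (Finset.mem_of_mem_erase (hB h)))

/-- Sort the monomials by whether k occurs; the same sorting, with u_k as a third case, gives
`W_insert`. -/
lemma V_insert {f : Poly ι} (hf : f ∈ V (insert k s) (j + 1)) :
    ∃ h ∈ V s (j + 1), ∃ g ∈ V s j, f = h + cv k * g := by
  induction hf using Submodule.span_induction with
  | mem x hx =>
    obtain ⟨B, hB, hj, rfl⟩ := hx
    by_cases hkB : k ∈ B
    · refine ⟨0, zero_mem _, cmon (B.erase k), ?_, ?_⟩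
      · have := cmon_mem_V (Finset.subset_insert_iff.1 hB)
        rwa [Finset.card_erase_of_mem hkB, hj] at this
      · rw [← cmon_insert (Finset.notMem_erase k B), Finset.insert_erase hkB, zero_add]
    · refine ⟨cmon B, ?_, 0, zero_mem _, by simp⟩
      have := cmon_mem_V ((Finset.subset_insert_iff_of_notMem hkB).1 hB)
      rwa [hj] at this
  | zero => exact ⟨0, zero_mem _, 0, zero_mem _, by simp⟩
  | add x y _ _ hx hy =>
    obtain ⟨h, hh, g, hg, rfl⟩ := hx
    obtain ⟨h', hh', g', hg', rfl⟩ := hy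
    exact ⟨h + h', add_mem hh hh', g + g', add_mem hg hg', by ring⟩
  | smul a x _ hx =>
    obtain ⟨h, hh, g, hg, rfl⟩ := hx
    exact ⟨a • h, Submodule.smul_mem _ _ hh, a • g, Submodule.smul_mem _ _ hg,
      by rw [smul_add, mul_smul_comm]⟩

lemma W_insert {f : Poly ι} (hf : f ∈ W (insert k s) (j + 1)) :
    ∃ P ∈ W s (j + 1), ∃ Q ∈ W s j, ∃ R ∈ V s (j + 1), f = P + cv k * Q + uv k * R := by
  by_cases hks : k ∈ s
  · rw [Finset.insert_eq_of_mem hks] at hf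
    exact ⟨f, hf, 0, zero_mem _, 0, zero_mem _, by simp⟩
  induction hf using Submodule.span_induction with
  | mem x hx =>
    obtain ⟨i, hi, B, hB, hj, rfl⟩ := hx
    have hB' : B ⊆ insert k s := hB.trans (Finset.erase_subset _ _)
    have hiB : i ∉ B := fun h => by simpa using hB h
    rcases eq_or_ne i k with rfl | hik
    · refine ⟨0, zero_mem _, 0, zero_mem _, cmon B, ?_, by simp⟩
      have := cmon_mem_V ((Finset.subset_insert_iff_of_notMem hiB).1 hB')
      rwa [hj] at this
    · replace hi : i ∈ s := by simpa [hik] using hi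
      by_cases hkB : k ∈ B
      · refine ⟨0, zero_mem _, uv i * cmon (B.erase k), ?_, 0, zero_mem _, ?_⟩
        · have := uv_mul_cmon_mem_W hi (Finset.subset_insert_iff.1 hB')
            (fun h => hiB (Finset.mem_of_mem_erase h))
          rwa [Finset.card_erase_of_mem hkB, hj] at this
        · rw [mul_left_comm, ← cmon_insert (Finset.notMem_erase k B), Finset.insert_erase hkB]
          simp
      · refine ⟨uv i * cmon B, ?_, 0, zero_mem _, 0, zero_mem _, by simp⟩
        have := uv_mul_cmon_mem_W hi ((Finset.subset_insert_iff_of_notMem hkB).1 hB') hiB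
        rwa [hj] at this
  | zero => exact ⟨0, zero_mem _, 0, zero_mem _, 0, zero_mem _, by simp⟩
  | add x y _ _ hx hy =>
    obtain ⟨P, hP, Q, hQ, R, hR, rfl⟩ := hx
    obtain ⟨P', hP', Q', hQ', R', hR', rfl⟩ := hy
    exact ⟨_, add_mem hP hP', _, add_mem hQ hQ', _, add_mem hR hR', by ring⟩
  | smul a x _ hx =>
    obtain ⟨P, hP, Q, hQ, R, hR, rfl⟩ := hx
    exact ⟨_, Submodule.smul_mem _ a hP, _, Submodule.smul_mem _ a hQ,
      _, Submodule.smul_mem _ a hR, by rw [smul_add, smul_add, mul_smul_comm, mul_smul_comm]⟩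

lemma W_insert_zero {f : Poly ι} (hf : f ∈ W (insert k s) 0) :
    ∃ P ∈ W s 0, ∃ R ∈ V s 0, f = P + uv k * R := by
  induction hf using Submodule.span_induction with
  | mem x hx =>
    obtain ⟨i, hi, B, hB, hj, rfl⟩ := hx
    obtain rfl := Finset.card_eq_zero.1 hj
    have h0 := cmon_mem_V (Finset.empty_subset s)
    rw [Finset.card_empty] at h0
    rw [Finset.mem_insert] at hi
    rcases hi with rfl | hi
    · exact ⟨0, zero_mem _, _, h0, by simp⟩
    · have h1 := uv_mul_cmon_mem_W hi (Finset.empty_subset s) (Finset.notMem_empty _)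
      rw [Finset.card_empty] at h1
      exact ⟨_, h1, 0, zero_mem _, by simp⟩
  | zero => exact ⟨0, zero_mem _, 0, zero_mem _, by simp⟩
  | add x y _ _ hx hy =>
    obtain ⟨P, hP, R, hR, rfl⟩ := hx
    obtain ⟨P', hP', R', hR', rfl⟩ := hy
    exact ⟨_, add_mem hP hP', _, add_mem hR hR', by ring⟩
  | smul a x _ hx =>
    obtain ⟨P, hP, R, hR, rfl⟩ := hx
    exact ⟨_, Submodule.smul_mem _ a hP, _, Submodule.smul_mem _ a hR,
      by rw [smul_add, mul_smul_comm]⟩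

lemma W_empty : W (∅ : Finset ι) j = ⊥ := by
  rw [W, Submodule.span_eq_bot]
  rintro _ ⟨k, hk, -⟩
  simp at hk

/-! ### The derivations on the multilinear polynomials -/

lemma Dc_cmon (B : Finset ι) : Dc (cmon B) = ∑ i ∈ B, cmon (B.erase i) := by
  induction B using Finset.induction with
  | empty => simp
  | insert i B hi ih =>
    rw [cmon_insert hi, Derivation.leibniz, ih, Dc_cv, Finset.sum_insert hi,
      Finset.erase_insert hi, smul_eq_mul, smul_eq_mul, mul_one, add_comm, Finset.mul_sum]
    congr 1
    refine Finset.sum_congr rfl fun l hl => ?_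
    have hil : l ≠ i := fun e => hi (e ▸ hl)
    rw [Finset.erase_insert_of_ne hil.symm, cmon_insert fun h => hi (Finset.mem_of_mem_erase h)]

lemma Dc_cmon_mem {B : Finset ι} (hB : B ⊆ s) (hj : B.card = j + 1) : Dc (cmon B) ∈ V s j := by
  rw [Dc_cmon]
  refine sum_mem fun i hi => ?_
  have := cmon_mem_V ((Finset.erase_subset i B).trans hB)
  rwa [Finset.card_erase_of_mem hi, hj] at this

lemma Dc_mem_V {f : Poly ι} (hf : f ∈ V s (j + 1)) : Dc f ∈ V s j :=
  map_mem_of_span (Dc : Derivation ℤ (Poly ι) (Poly ι)).toLinearMap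
    (by rintro _ ⟨B, hB, hj, rfl⟩; exact Dc_cmon_mem hB hj) hf

lemma uv_mul_mem_W {f : Poly ι} (hk : k ∈ s) (hf : f ∈ V (s.erase k) j) : uv k * f ∈ W s j :=
  map_mem_of_span (LinearMap.mulLeft ℤ (uv k))
    (by rintro _ ⟨B, hB, hj, rfl⟩; exact Submodule.subset_span ⟨k, hk, B, hB, hj, rfl⟩) hf

lemma Dc_mem_W {F : Poly ι} (hF : F ∈ W s (j + 1)) : Dc F ∈ W s j :=
  map_mem_of_span (Dc : Derivation ℤ (Poly ι) (Poly ι)).toLinearMap (by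
    rintro _ ⟨k, hk, B, hB, hj, rfl⟩
    change Dc (uv k * cmon B) ∈ _
    rw [Derivation.leibniz, Dc_uv, smul_zero,
      add_zero]
    exact uv_mul_mem_W hk (Dc_cmon_mem hB hj)) hF

lemma Dc_eq_zero_of_mem_W {F : Poly ι} (hF : F ∈ W s 0) : Dc F = 0 := by
  have : F ∈ LinearMap.ker (Dc : Derivation ℤ (Poly ι) (Poly ι)).toLinearMap := by
    refine (Submodule.span_le.2 ?_) hF
    rintro _ ⟨k, hk, B, hB, hj, rfl⟩
    rw [Finset.card_eq_zero.1 hj]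
    simp
  exact this

lemma Du_cmon (B : Finset ι) : Du (cmon B) = 0 := by
  induction B using Finset.induction with
  | empty => simp
  | insert i B hi ih => rw [cmon_insert hi, Derivation.leibniz, ih]; simp

lemma Eu_cmon (B : Finset ι) : Eu (cmon B) = 0 := by
  induction B using Finset.induction with
  | empty => simp
  | insert i B hi ih => rw [cmon_insert hi, Derivation.leibniz, ih]; simp

lemma Eu_eq_zero_of_mem_V {f : Poly ι} (hf : f ∈ V s j) : Eu f = 0 := by
  have : f ∈ LinearMap.ker (Eu : Derivation ℤ (Poly ι) (Poly ι)).toLinearMap := by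
    refine (Submodule.span_le.2 ?_) hf
    rintro _ ⟨B, hB, hj, rfl⟩
    exact Eu_cmon B
  exact this

lemma Du_mem_V {F : Poly ι} (hF : F ∈ W s j) : Du F ∈ V s j :=
  map_mem_of_span (Du : Derivation ℤ (Poly ι) (Poly ι)).toLinearMap (by
    rintro _ ⟨k, hk, B, hB, hj, rfl⟩
    change Du (uv k * cmon B) ∈ _
    rw [Derivation.leibniz, Du_uv, Du_cmon,
      smul_zero, zero_add, smul_eq_mul, mul_one, ← hj]
    exact cmon_mem_V (hB.trans (Finset.erase_subset _ _))) hF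

lemma Dc_iterate_mem_V {r : ℕ} {f : Poly ι} (hf : f ∈ V s (j + r)) : Dc^[r] f ∈ V s j := by
  induction r generalizing f with
  | zero => exact hf
  | succ r ih => exact ih (Dc_mem_V hf)

lemma Dc_iterate_mem_W {r : ℕ} {f : Poly ι} (hf : f ∈ W s (j + r)) : Dc^[r] f ∈ W s j := by
  induction r generalizing f with
  | zero => exact hf
  | succ r ih => exact ih (Dc_mem_W hf)

lemma Dc_iterate_eq_zero_of_mem_W {F : Poly ι} (hF : F ∈ W s j) : Dc^[j + 1] F = 0 := by
  rw [Function.iterate_succ_apply']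
  exact Dc_eq_zero_of_mem_W (Dc_iterate_mem_W (r := j) (by rwa [zero_add]))

/-! ### Injectivity of powers of `Dc` -/

/-- An analogue of the Lefschetz property of the Boolean lattice. Write f = a + c_k g. The parts of
Dc^(r+1) f with and without c_k give Dc^(r+1) g = 0 and Dc^(r+1) a = -(r+1) Dc^r g. The induction
applies to a with exponent r + 2, then to g with exponent r. -/
lemma eq_zero_of_iterate_Dc_V {r : ℕ} {f : Poly ι} (hf : f ∈ V s j) (h : Dc^[r] f = 0)
    (hr : r + s.card ≤ 2 * j) : f = 0 := by
  induction s using Finset.induction generalizing j r f with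
  | empty =>
    cases j with
    | zero =>
      obtain rfl : r = 0 := by omega
      exact h
    | succ j => simpa [V_empty_succ] using hf
  | insert k s hk ih =>
    rw [Finset.card_insert_of_notMem hk] at hr
    cases r with
    | zero => exact h
    | succ r =>
      cases j with
      | zero => omega
      | succ j =>
        obtain ⟨a, ha, g, hg, rfl⟩ := V_insert hf
        rw [iterate_Dc_add, iterate_Dc_cv_mul] at h
        have fa := free_of_mem_V hk ha
        have fg := free_of_mem_V hk hg
        obtain ⟨h1, h2⟩ := eq_zero_of_free' (k := k) (P := Dc^[r + 1] a + (r + 1) * Dc^[r] g)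
          (Q := Dc^[r + 1] g) ((fa.apply_iterate_Dc _).add
            (by exact_mod_cast (fg.apply_iterate_Dc r).natCast_mul (r + 1)))
          (fg.apply_iterate_Dc _) (by rw [← h]; ring)
        -- One more `Dc` removes the g-term, so a is killed by Dc^(r+2).
        have ha0 : a = 0 := by
          refine ih (r := r + 2) ha ?_ (by omega)
          have h3 := congrArg Dc h1
          rw [map_add, map_zero, Derivation.leibniz, ← Function.iterate_succ_apply' Dc,
            ← Function.iterate_succ_apply' Dc, h2] at h3
          simpa using h3
        rw [ha0, iterate_Dc_zero, zero_add] at h1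
        rw [ha0, ih hg (eq_zero_of_natCast_mul r h1) (by omega)]
        simp

/-- The argument of `eq_zero_of_iterate_Dc_V`, with the coefficient of u_k handled by that lemma.
The bound is weaker by one because one index is occupied by the u-variable. -/
lemma eq_zero_of_iterate_Dc_W {r : ℕ} {F : Poly ι} (hF : F ∈ W s j) (h : Dc^[r] F = 0)
    (hr : r + s.card ≤ 2 * j + 1) : F = 0 := by
  induction s using Finset.induction generalizing j r F with
  | empty => simpa [W_empty] using hF
  | insert k s hk ih =>
    rw [Finset.card_insert_of_notMem hk] at hr
    cases r with
    | zero => exact h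
    | succ r =>
      cases j with
      | zero => omega
      | succ j =>
        obtain ⟨P, hP, Q, hQ, R, hR, rfl⟩ := W_insert hF
        rw [iterate_Dc_add, iterate_Dc_add, iterate_Dc_cv_mul,
          iterate_Dc_mul_of_Dc_eq_zero (Dc_uv k)] at h
        have fP := free_of_mem_W hk hP
        have fQ := free_of_mem_W hk hQ
        have fR := free_of_mem_V hk hR
        obtain ⟨h1, h2, h4⟩ := eq_zero_of_free (k := k) (P := Dc^[r + 1] P + (r + 1) * Dc^[r] Q)
          (Q := Dc^[r + 1] Q) (R := Dc^[r + 1] R) ((fP.apply_iterate_Dc _).add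
            (by exact_mod_cast (fQ.apply_iterate_Dc r).natCast_mul (r + 1)))
          (fQ.apply_iterate_Dc _) (fR.apply_iterate_Dc _) (by rw [← h]; ring)
        have hR0 : R = 0 := eq_zero_of_iterate_Dc_V hR h4 (by omega)
        have hP0 : P = 0 := by
          refine ih (r := r + 2) hP ?_ (by omega)
          have h3 := congrArg Dc h1
          rw [map_add, map_zero, Derivation.leibniz, ← Function.iterate_succ_apply' Dc,
            ← Function.iterate_succ_apply' Dc, h2] at h3
          simpa using h3
        rw [hP0, iterate_Dc_zero, zero_add] at h1
        rw [hP0, hR0, ih hQ (eq_zero_of_natCast_mul r h1) (by omega)]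
        simp

end IntPI.Poly

namespace IntPI.Poly
open MvPolynomial

variable {ι : Type*}

/-! ### Products of minors -/

/-- The product of the differences `c q - c p` over consecutive pairs `p, q` of a list. -/
def genV : List ι → Poly ι
  | p :: q :: L => (cv q - cv p) * genV L
  | _ => 1

/-- The determinant with rows `1`, `c`, `u` and columns `p`, `q`, `r`. -/
def det3 (p q r : ι) : Poly ι := (cv q - cv p) * (uv r - uv p) - (cv r - cv p) * (uv q - uv p)

/-- A `3 × 3` minor times differences `c q - c p` over consecutive pairs. -/
def genW : List ι → Poly ι
  | p :: q :: r :: L => det3 p q r * genV L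
  | _ => 0

lemma derivation_genV {D : Derivation ℤ (Poly ι) (Poly ι)} (hD : ∀ p q, D (cv q - cv p) = 0)
    (L : List ι) : D (genV L) = 0 := by
  induction L using genV.induct with
  | case1 p q L ih => rw [genV, Derivation.leibniz, ih, hD]; simp
  | case2 L hL => rw [genV]; simp; exact hL

lemma derivation_genW {D : Derivation ℤ (Poly ι) (Poly ι)} (hD : ∀ p q, D (cv q - cv p) = 0)
    (hD' : ∀ p q r, D (det3 p q r) = 0) (L : List ι) : D (genW L) = 0 := by
  unfold genW
  split
  · rw [Derivation.leibniz, derivation_genV hD, hD']; simp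
  · simp

@[simp] lemma Dc_genV (L : List ι) : Dc (genV L) = 0 := derivation_genV (by simp) L
@[simp] lemma Du_genV (L : List ι) : Du (genV L) = 0 := derivation_genV (by simp) L
@[simp] lemma Eu_genV (L : List ι) : Eu (genV L) = 0 := derivation_genV (by simp) L
-- The minor `det3` has rows 1, c, u. `Dc` turns the row c into 1; below, `Du` turns u into 1 and
-- `Eu` turns u into c. Each time two rows coincide.
@[simp] lemma Dc_genW (L : List ι) : Dc (genW L) = 0 :=
  derivation_genW (by simp) (by simp [det3, Derivation.leibniz]) L
@[simp] lemma Du_genW (L : List ι) : Du (genW L) = 0 :=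
  derivation_genW (by simp) (by simp [det3, Derivation.leibniz]) L
@[simp] lemma Eu_genW (L : List ι) : Eu (genW L) = 0 :=
  derivation_genW (by simp)
    (fun p q r => by simp only [det3, Derivation.leibniz, map_sub, Eu_cv, Eu_uv]; simp; ring) L

variable {s : Finset ι} {j : ℕ} {k : ι}

/-- The span of the `genV L` for lists `L` of `2 i` distinct elements of `s`. -/
def SV (s : Finset ι) (i : ℕ) : Submodule ℤ (Poly ι) :=
  Submodule.span ℤ {G | ∃ L : List ι, L.Nodup ∧ L.length = 2 * i ∧ (∀ x ∈ L, x ∈ s) ∧ G = genV L}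

/-- The span of the `genW L` for lists `L` of `2 i + 3` distinct elements of `s`. -/
def SW (s : Finset ι) (i : ℕ) : Submodule ℤ (Poly ι) :=
  Submodule.span ℤ
    {G | ∃ L : List ι, L.Nodup ∧ L.length = 2 * i + 3 ∧ (∀ x ∈ L, x ∈ s) ∧ G = genW L}

lemma SV_mono {t : Finset ι} (h : s ⊆ t) : SV s j ≤ SV t j :=
  Submodule.span_mono fun _ ⟨L, h1, h2, h3, h4⟩ => ⟨L, h1, h2, fun x hx => h (h3 x hx), h4⟩

lemma SW_mono {t : Finset ι} (h : s ⊆ t) : SW s j ≤ SW t j :=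
  Submodule.span_mono fun _ ⟨L, h1, h2, h3, h4⟩ => ⟨L, h1, h2, fun x hx => h (h3 x hx), h4⟩

lemma derivation_SV {D : Derivation ℤ (Poly ι) (Poly ι)} (hD : ∀ L, D (genV L) = 0)
    {F : Poly ι} (hF : F ∈ SV s j) : D F = 0 := by
  have : F ∈ LinearMap.ker D.toLinearMap :=
    (Submodule.span_le.2 (by rintro _ ⟨L, -, -, -, rfl⟩; exact hD L)) hF
  exact this

lemma derivation_SW {D : Derivation ℤ (Poly ι) (Poly ι)} (hD : ∀ L, D (genW L) = 0)
    {F : Poly ι} (hF : F ∈ SW s j) : D F = 0 := by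
  have : F ∈ LinearMap.ker D.toLinearMap :=
    (Submodule.span_le.2 (by rintro _ ⟨L, -, -, -, rfl⟩; exact hD L)) hF
  exact this

variable [DecidableEq ι]

lemma cv_mul_mem_V {f : Poly ι} (hk : k ∈ s) (hf : f ∈ V (s.erase k) j) :
    cv k * f ∈ V s (j + 1) :=
  map_mem_of_span (LinearMap.mulLeft ℤ (cv k)) (by
    rintro _ ⟨B, hB, hj, rfl⟩
    have hkB : k ∉ B := fun h => by simpa using hB h
    rw [LinearMap.mulLeft_apply, ← cmon_insert hkB, ← hj, ← Finset.card_insert_of_notMem hkB]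
    exact cmon_mem_V (Finset.insert_subset hk (hB.trans (Finset.erase_subset _ _)))) hf

lemma cv_mul_mem_W {F : Poly ι} (hk : k ∈ s) (hF : F ∈ W (s.erase k) j) :
    cv k * F ∈ W s (j + 1) :=
  map_mem_of_span (LinearMap.mulLeft ℤ (cv k)) (by
    rintro _ ⟨i, hi, B, hB, hj, rfl⟩
    have hkB : k ∉ B := fun h => by simpa using Finset.mem_of_mem_erase (hB h)
    rw [LinearMap.mulLeft_apply, mul_left_comm]
    rw [Finset.mem_erase] at hi
    refine uv_mul_mem_W hi.2 (cv_mul_mem_V (Finset.mem_erase.2 ⟨hi.1.symm, hk⟩) ?_)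
    rw [← hj]
    refine cmon_mem_V (hB.trans ?_)
    rw [Finset.erase_right_comm]) hF

lemma genV_mem (L : List ι) (i : ℕ) (hL : L.Nodup) (hi : L.length = 2 * i) (hs : ∀ x ∈ L, x ∈ s) :
    genV L ∈ V s i := by
  induction L using genV.induct generalizing s i with
  | case1 p q L ih =>
    obtain ⟨i, rfl⟩ : ∃ i', i = i' + 1 := ⟨i - 1, by simp at hi; omega⟩
    simp only [List.nodup_cons, List.mem_cons, not_or, List.length_cons] at hL hi hs
    have h (x) (hx : x ∉ L) : genV L ∈ V (s.erase x) i :=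
      ih i hL.2.2 (by omega) fun y hy =>
        Finset.mem_erase.2 ⟨fun e => hx (e ▸ hy), hs y (.inr (.inr hy))⟩
    rw [genV, sub_mul]
    exact sub_mem (cv_mul_mem_V (hs q (by simp)) (h q hL.2.1))
      (cv_mul_mem_V (hs p (by simp)) (h p hL.1.2))
  | case2 L hL' =>
    have : L = [] := by
      rcases L with _ | ⟨a, _ | ⟨b, L⟩⟩
      · rfl
      · simp at hi; omega
      · exact absurd rfl (hL' a b L)
    subst this
    obtain rfl : i = 0 := by simpa using hi
    rw [V_zero, genV]
    · exact Submodule.mem_span_singleton_self _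
    · simp

lemma genW_mem (L : List ι) (i : ℕ) (hL : L.Nodup) (hi : L.length = 2 * i + 3)
    (hs : ∀ x ∈ L, x ∈ s) : genW L ∈ W s (i + 1) := by
  rcases L with _ | ⟨p, _ | ⟨q, _ | ⟨r, L⟩⟩⟩ <;> simp at hi
  simp only [List.nodup_cons, List.mem_cons, not_or] at hL hs
  have h (x y) (hx : x ∉ L) (hy : y ∉ L) (hxy : x ≠ y) (hxs : x ∈ s) (hys : y ∈ s) :
      cv x * (uv y * genV L) ∈ W s (i + 1) := by
    refine cv_mul_mem_W hxs (uv_mul_mem_W (Finset.mem_erase.2 ⟨hxy.symm, hys⟩)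
      (genV_mem L i hL.2.2.2 (by omega) fun z hz => ?_))
    rw [Finset.mem_erase, Finset.mem_erase]
    exact ⟨fun e => hy (e ▸ hz), fun e => hx (e ▸ hz), hs z (by simp [hz])⟩
  have e : genW (p :: q :: r :: L) = cv q * (uv r * genV L) - cv p * (uv r * genV L)
      - cv q * (uv p * genV L) - (cv r * (uv q * genV L) - cv p * (uv q * genV L)
        - cv r * (uv p * genV L)) := by
    rw [genW, det3]; ring
  obtain ⟨⟨h1, h2, h3⟩, ⟨h4, h5⟩, h6, -⟩ := hL
  have hp := hs p (by simp)
  have hq := hs q (by simp)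
  have hr := hs r (by simp)
  rw [e]
  exact sub_mem (sub_mem (sub_mem (h q r h5 h6 h4 hq hr) (h p r h3 h6 h2 hp hr))
    (h q p h5 h3 (Ne.symm h1) hq hp)) (sub_mem (sub_mem (h r q h6 h5 (Ne.symm h4) hr hq)
    (h p q h3 h5 h1 hp hq)) (h r p h6 h3 (Ne.symm h2) hr hp))

/-! ### Kernels of the derivations are spanned by products of minors -/

lemma exists_mem_notMem_list {L : List ι} (hL : L.length < s.card) : ∃ l ∈ s, l ∉ L := by
  obtain ⟨l, hl, h⟩ := Finset.exists_mem_notMem_of_card_lt_card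
    ((List.toFinset_card_le L).trans_lt hL)
  exact ⟨l, hl, by simpa using h⟩

/-- Multiply `genV L` by c_k - c_l with some l ∈ s outside L; the strict inequality provides l. This
realizes a prescribed coefficient of c_k inside the span. -/
lemma exists_SV_insert {g : Poly ι} (hk : k ∉ s) (hj : 2 * j < s.card) (hg : g ∈ SV s j) :
    ∃ F ∈ SV (insert k s) (j + 1), ∃ h ∈ V s (j + 1), F = h + cv k * g := by
  induction hg using Submodule.span_induction with
  | mem x hx =>
    obtain ⟨L, h1, h2, h3, rfl⟩ := hx
    obtain ⟨l, hl, hlL⟩ := exists_mem_notMem_list (L := L) (s := s) (by omega)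
    have hkL : k ∉ L := fun h => hk (h3 k h)
    refine ⟨genV (l :: k :: L), Submodule.subset_span ⟨_, ?_, by simp; omega, ?_, rfl⟩,
      -(cv l * genV L), neg_mem (cv_mul_mem_V hl (genV_mem L j h1 h2 fun x hx => ?_)), ?_⟩
    · simp [h1, hlL, hkL]; rintro rfl; exact hk hl
    · simp [hl]; exact fun x hx => .inr (h3 x hx)
    · exact Finset.mem_erase.2 ⟨fun e => hlL (e ▸ hx), h3 x hx⟩
    · rw [genV]; ring
  | zero => exact ⟨0, zero_mem _, 0, zero_mem _, by simp⟩
  | add x y _ _ hx hy =>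
    obtain ⟨P, hP, R, hR, e⟩ := hx
    obtain ⟨P', hP', R', hR', e'⟩ := hy
    exact ⟨_, add_mem hP hP', _, add_mem hR hR', by rw [e, e']; ring⟩
  | smul a x _ hx =>
    obtain ⟨P, hP, R, hR, e⟩ := hx
    exact ⟨_, Submodule.smul_mem _ a hP, _, Submodule.smul_mem _ a hR,
      by rw [e, smul_add, mul_smul_comm]⟩

/-- The kernel of `Dc` on squarefree polynomials is spanned by products of differences. -/
lemma mem_SV_of_Dc_eq_zero {f : Poly ι} (hf : f ∈ V s j) (h : Dc f = 0) (hj : 2 * j ≤ s.card) :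
    f ∈ SV s j := by
  induction s using Finset.induction generalizing j f with
  | empty =>
    obtain rfl : j = 0 := by simpa using hj
    rw [V_zero] at hf
    exact Submodule.span_mono (by rintro _ rfl; exact ⟨[], by simp [genV]⟩) hf
  | insert k s hk ih =>
    rw [Finset.card_insert_of_notMem hk] at hj
    cases j with
    | zero =>
      rw [V_zero] at hf
      exact Submodule.span_mono (by rintro _ rfl; exact ⟨[], by simp [genV]⟩) hf
    | succ j =>
      obtain ⟨a, ha, g, hg, rfl⟩ := V_insert hf
      have fa := free_of_mem_V hk ha
      have fg := free_of_mem_V hk hg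
      have hg0 : Dc g = 0 := by
        refine (eq_zero_of_free' (k := k) (P := Dc a + g) (fa.apply_Dc.add fg) fg.apply_Dc ?_).2
        rw [← h, map_add, Derivation.leibniz]; simp; ring
      obtain ⟨F, hF, b, hb, rfl⟩ := exists_SV_insert hk (by omega) (ih hg hg0 (by omega))
      -- Subtracting F removes the c_k-term, so the induction hypothesis can be applied to a - b.
      have hab : Dc (a - b) = 0 := by
        have := derivation_SV Dc_genV hF
        rw [← sub_eq_zero.2 (h.trans this.symm), ← map_sub]; congr 1; ring
      have hab' : a - b ∈ SV s (j + 1) := by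
        by_cases hjs : 2 * (j + 1) ≤ s.card
        · exact ih (sub_mem ha hb) hab hjs
        -- Here 2(j+1) > |s|, where `Dc` is already injective.
        · rw [eq_zero_of_iterate_Dc_V (r := 1) (sub_mem ha hb) hab (by omega)]
          exact zero_mem _
      have := add_mem (SV_mono (Finset.subset_insert k s) hab') hF
      convert this using 1; ring

/-- Elements of `W s 0` are linear forms in the u_i, and `Eu` only renames u_i to c_i. -/
lemma eq_zero_of_Eu_W_zero {F : Poly ι} (hF : F ∈ W s 0) (h : Eu F = 0) : F = 0 := by
  induction s using Finset.induction generalizing F with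
  | empty => simpa [W_empty] using hF
  | insert k s hk ih =>
    obtain ⟨P, hP, R, hR, rfl⟩ := W_insert_zero hF
    have fP := free_of_mem_W hk hP
    have fR := free_of_mem_V hk hR
    obtain ⟨h1, h2⟩ := eq_zero_of_free' (k := k) (P := Eu P) fP.apply_Eu fR (by
      rw [← h, map_add, Derivation.leibniz, Eu_eq_zero_of_mem_V hR]; simp; ring)
    rw [h2, ih hP h1]; simp

/-- In the minor with columns p, q, k the coefficient of u_k is c_q - c_p, so `genW (p :: q :: k ::
L)` has u_k-coefficient `genV (p :: q :: L)`. -/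
lemma exists_SW_insert_of_SV {R : Poly ι} (hk : k ∉ s) (hR : R ∈ SV s (j + 1)) :
    ∃ F ∈ SW (insert k s) j, ∃ P ∈ W s (j + 1), ∃ Q ∈ W s j, F = P + cv k * Q + uv k * R := by
  induction hR using Submodule.span_induction with
  | mem x hx =>
    obtain ⟨L, h1, h2, h3, rfl⟩ := hx
    rcases L with _ | ⟨p, _ | ⟨q, L⟩⟩
    · simp at h2
    · simp at h2; omega
    have hkL : k ∉ p :: q :: L := fun h => hk (h3 k h)
    simp only [List.nodup_cons, List.mem_cons, not_or, List.length_cons] at h1 h2 h3 hkL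
    obtain ⟨⟨h4, h5⟩, h6, h7⟩ := h1
    have hp := h3 p (by simp)
    have hq := h3 q (by simp)
    have hL {t : Finset ι} (ht : ∀ x ∈ L, x ∈ t) : genV L ∈ V t j := genV_mem L j h7 (by omega) ht
    have hcu (x y) (hx : x ∉ L) (hy : y ∉ L) (hxy : x ≠ y) (hxs : x ∈ s) (hys : y ∈ s) :
        cv x * (uv y * genV L) ∈ W s (j + 1) := by
      refine cv_mul_mem_W hxs (uv_mul_mem_W (Finset.mem_erase.2 ⟨hxy.symm, hys⟩)
        (hL fun z hz => ?_))
      rw [Finset.mem_erase, Finset.mem_erase]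
      exact ⟨fun e => hy (e ▸ hz), fun e => hx (e ▸ hz), h3 z (by simp [hz])⟩
    have hu (y) (hy : y ∉ L) (hys : y ∈ s) : uv y * genV L ∈ W s j :=
      uv_mul_mem_W hys (hL fun z hz =>
        Finset.mem_erase.2 ⟨fun e => hy (e ▸ hz), h3 z (by simp [hz])⟩)
    refine ⟨genW (p :: q :: k :: L), Submodule.subset_span ⟨_, ?_, by simp; omega, ?_, rfl⟩,
      cv p * (uv q * genV L) - cv q * (uv p * genV L),
      sub_mem (hcu p q h5 h6 h4 hp hq) (hcu q p h6 h5 (Ne.symm h4) hq hp),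
      uv p * genV L - uv q * genV L, sub_mem (hu p h5 hp) (hu q h6 hq), ?_⟩
    · simp [h4, h5, h6, h7, hkL, Ne.symm hkL.1, Ne.symm hkL.2.1]
    · simp [hp, hq]; exact fun x hx => .inr (h3 x (by simp [hx]))
    · rw [genV, genW, det3]; ring
  | zero => exact ⟨0, zero_mem _, 0, zero_mem _, 0, zero_mem _, by simp⟩
  | add x y _ _ hx hy =>
    obtain ⟨F, hF, P, hP, R, hR, e⟩ := hx
    obtain ⟨F', hF', P', hP', R', hR', e'⟩ := hy
    exact ⟨_, add_mem hF hF', _, add_mem hP hP', _, add_mem hR hR', by rw [e, e']; ring⟩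
  | smul a x _ hx =>
    obtain ⟨F, hF, P, hP, R, hR, e⟩ := hx
    exact ⟨_, Submodule.smul_mem _ a hF, _, Submodule.smul_mem _ a hP,
      _, Submodule.smul_mem _ a hR, by rw [e, smul_add, smul_add, mul_smul_comm, mul_smul_comm]⟩

/-- Inserting the pair l, k behind the first three entries multiplies `genW` by c_k - c_l; an l
outside the list exists by the strict inequality. -/
lemma exists_SW_insert {Q : Poly ι} (hk : k ∉ s) (hj : 2 * j + 3 < s.card) (hQ : Q ∈ SW s j) :
    ∃ F ∈ SW (insert k s) (j + 1), ∃ P ∈ W s (j + 2), F = P + cv k * Q := by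
  induction hQ using Submodule.span_induction with
  | mem x hx =>
    obtain ⟨L, h1, h2, h3, rfl⟩ := hx
    obtain ⟨l, hl, hlL⟩ := exists_mem_notMem_list (L := L) (s := s) (by omega)
    have hkL : k ∉ L := fun h => hk (h3 k h)
    have hW : cv l * genW L ∈ W s (j + 2) :=
      cv_mul_mem_W hl (genW_mem L j h1 h2 fun x hx =>
        Finset.mem_erase.2 ⟨fun e => hlL (e ▸ hx), h3 x hx⟩)
    have hkl : l ≠ k := by rintro rfl; exact hk hl
    rcases L with _ | ⟨p, _ | ⟨q, _ | ⟨r, L⟩⟩⟩ <;> simp at h2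
    refine ⟨genW (p :: q :: r :: l :: k :: L), Submodule.subset_span ⟨_, ?_, by simp; omega, ?_,
      rfl⟩, -(cv l * genW (p :: q :: r :: L)), neg_mem hW, ?_⟩
    · simp only [List.nodup_cons, List.mem_cons, not_or] at *
      tauto
    · simp [hl] at *; tauto
    · rw [genW, genV, genW]; ring
  | zero => exact ⟨0, zero_mem _, 0, zero_mem _, by simp⟩
  | add x y _ _ hx hy =>
    obtain ⟨P, hP, R, hR, e⟩ := hx
    obtain ⟨P', hP', R', hR', e'⟩ := hy
    exact ⟨_, add_mem hP hP', _, add_mem hR hR', by rw [e, e']; ring⟩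
  | smul a x _ hx =>
    obtain ⟨P, hP, R, hR, e⟩ := hx
    exact ⟨_, Submodule.smul_mem _ a hP, _, Submodule.smul_mem _ a hR,
      by rw [e, smul_add, mul_smul_comm]⟩

/-- The common kernel of `Dc`, `Du`, `Eu` is spanned by products of minors. -/
lemma mem_SW_of_eq_zero {F : Poly ι} (hF : F ∈ W s (j + 1)) (hDc : Dc F = 0) (hDu : Du F = 0)
    (hEu : Eu F = 0) (hj : 2 * j + 3 ≤ s.card) : F ∈ SW s j := by
  induction s using Finset.induction generalizing j F with
  | empty => simp at hj
  | insert k s hk ih =>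
    rw [Finset.card_insert_of_notMem hk] at hj
    obtain ⟨P, hP, Q, hQ, R, hR, rfl⟩ := W_insert hF
    have fP := free_of_mem_W hk hP
    have fQ := free_of_mem_W hk hQ
    have fR := free_of_mem_V hk hR
    have hR0 : Dc R = 0 := by
      refine (eq_zero_of_free (k := k) (P := Dc P + Q) (Q := Dc Q) (fP.apply_Dc.add fQ)
        fQ.apply_Dc fR.apply_Dc ?_).2.2
      rw [← hDc, map_add, map_add, Derivation.leibniz, Derivation.leibniz]; simp; ring
    obtain ⟨F', hF', P', hP', Q', hQ', rfl⟩ :=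
      exists_SW_insert_of_SV hk (mem_SV_of_Dc_eq_zero hR hR0 (by omega))
    have hsub {D : Derivation ℤ (Poly ι) (Poly ι)} (hD : ∀ L, D (genW L) = 0)
        (h : D (P + cv k * Q + uv k * R) = 0) : D (P - P' + cv k * (Q - Q')) = 0 := by
      rw [← sub_eq_zero.2 (h.trans (derivation_SW hD hF').symm), ← map_sub]; congr 1; ring
    -- With the u_k-term removed, the coefficient of c_k is again killed by all three derivations,
    -- so it falls under the induction hypothesis and can be removed in the same manner.
    have key : P - P' + cv k * (Q - Q') ∈ SW (insert k s) j := by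
      have h1 := hsub Dc_genW hDc
      have h2 := hsub Du_genW hDu
      have h3 := hsub Eu_genW hEu
      replace hP := sub_mem hP hP'
      replace hQ := sub_mem hQ hQ'
      revert h1 h2 h3 hP hQ
      generalize P - P' = P
      generalize Q - Q' = Q
      intro h1 h2 h3 hP hQ
      have fP := free_of_mem_W hk hP
      have fQ := free_of_mem_W hk hQ
      have hQ1 : Dc Q = 0 := by
        refine (eq_zero_of_free' (k := k) (P := Dc P + Q) (fP.apply_Dc.add fQ) fQ.apply_Dc ?_).2
        rw [← h1, map_add, Derivation.leibniz]; simp; ring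
      have hQ2 : Du Q = 0 := by
        refine (eq_zero_of_free' (k := k) (P := Du P) fP.apply_Du fQ.apply_Du ?_).2
        rw [← h2, map_add, Derivation.leibniz]; simp
      have hQ3 : Eu Q = 0 := by
        refine (eq_zero_of_free' (k := k) (P := Eu P) fP.apply_Eu fQ.apply_Eu ?_).2
        rw [← h3, map_add, Derivation.leibniz]; simp
      obtain ⟨F', hF', P', hP', hFP⟩ : ∃ F ∈ SW (insert k s) j, ∃ P ∈ W s (j + 1),
          F = P + cv k * Q := by
        cases j with
        | zero =>
          -- For j = 0 the coefficient Q is linear in the u_i, so `Eu Q = 0` leaves only Q = 0.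
          rw [eq_zero_of_Eu_W_zero hQ hQ3]
          exact ⟨0, zero_mem _, 0, zero_mem _, by simp⟩
        | succ j => exact exists_SW_insert hk (by omega) (ih hQ hQ1 hQ2 hQ3 (by omega))
      have hsub {D : Derivation ℤ (Poly ι) (Poly ι)} (hD : ∀ L, D (genW L) = 0)
          (h : D (P + cv k * Q) = 0) : D (P - P') = 0 := by
        rw [← sub_eq_zero.2 (h.trans (derivation_SW hD hF').symm), ← map_sub, hFP]; congr 1; ring
      have hPP : P - P' ∈ SW s j := by
        by_cases hjs : 2 * j + 3 ≤ s.card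
        · exact ih (sub_mem hP hP') (hsub Dc_genW h1) (hsub Du_genW h2) (hsub Eu_genW h3) hjs
        · rw [eq_zero_of_iterate_Dc_W (r := 1) (sub_mem hP hP') (hsub Dc_genW h1) (by omega)]
          exact zero_mem _
      have := add_mem (SW_mono (Finset.subset_insert k s) hPP) hF'
      rw [hFP] at this
      convert this using 1; ring
    convert add_mem key hF' using 1; ring

/-! ### Koszul cycles: the kernel of `Eu` -/

/-- The span of the `(c k u l - c l u k) c ^ B`. -/
def cycles (s : Finset ι) : Submodule ℤ (Poly ι) :=
  Submodule.span ℤ {F | ∃ k ∈ s, ∃ l ∈ s, k ≠ l ∧ ∃ B ⊆ (s.erase k).erase l,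
    F = (cv k * uv l - cv l * uv k) * cmon B}

lemma cycles_mono {t : Finset ι} (h : s ⊆ t) : cycles s ≤ cycles t :=
  Submodule.span_mono fun _ ⟨k, hk, l, hl, hkl, B, hB, e⟩ =>
    ⟨k, h hk, l, h hl, hkl, B,
      hB.trans (Finset.erase_subset_erase _ (Finset.erase_subset_erase _ h)), e⟩

/-- For F = P + c_k Q + u_k R the equation Eu F = 0 splits into Eu P = 0 and R = -Eu Q. Then c_k Q -
u_k Eu Q is a combination of cycles, as one sees on each monomial u_l c^B of Q. -/
lemma mem_cycles_of_Eu_eq_zero {F : Poly ι} (hF : F ∈ W s j) (h : Eu F = 0) : F ∈ cycles s := by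
  induction s using Finset.induction generalizing j F with
  | empty =>
    rw [W_empty] at hF
    rw [(Submodule.mem_bot ℤ).1 hF]; exact zero_mem _
  | insert k s hk ih =>
    cases j with
    | zero => rw [eq_zero_of_Eu_W_zero hF h]; exact zero_mem _
    | succ j =>
      obtain ⟨P, hP, Q, hQ, R, hR, rfl⟩ := W_insert hF
      have fP := free_of_mem_W hk hP
      have fQ := free_of_mem_W hk hQ
      have fR := free_of_mem_V hk hR
      obtain ⟨h1, h2⟩ := eq_zero_of_free' (k := k) (P := Eu P) (Q := Eu Q + R) fP.apply_Eu
        (fQ.apply_Eu.add fR) (by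
          rw [← h, map_add, map_add, Derivation.leibniz, Derivation.leibniz,
            Eu_eq_zero_of_mem_V hR]
          simp; ring)
      rw [add_assoc]
      refine add_mem (cycles_mono (Finset.subset_insert k s) (ih hP h1)) ?_
      rw [eq_neg_of_add_eq_zero_right h2]
      have : (LinearMap.mulLeft ℤ (cv k) - LinearMap.mulLeft ℤ (uv k) ∘ₗ
          (Eu : Derivation ℤ (Poly ι) (Poly ι)).toLinearMap) Q ∈ cycles (insert k s) := by
        refine (Submodule.span_le (p := (cycles (insert k s)).comap _)).2 ?_ hQ
        rintro _ ⟨l, hl, B, hB, hj, rfl⟩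
        have hkl : k ≠ l := by rintro rfl; exact hk hl
        refine Submodule.subset_span ⟨k, by simp, l, by simp [hl], hkl, B, ?_, ?_⟩
        · rw [Finset.erase_insert hk]; exact hB
        · change cv k * (uv l * cmon B) - uv k * Eu (uv l * cmon B) = _
          rw [Derivation.leibniz, Eu_cmon, Eu_uv]; simp; ring
      convert this using 1
      change _ = cv k * Q - uv k * Eu Q
      ring

end IntPI.Poly

namespace IntPI.Poly
open MvPolynomial

variable {ι : Type*}

/-! ### Monomials -/

/-- The exponent of `cmon B`. -/
def cexp (B : Finset ι) : ι ⊕ ι →₀ ℕ := ∑ i ∈ B, Finsupp.single (Sum.inl i) 1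

lemma cmon_eq_monomial (B : Finset ι) : cmon B = monomial (cexp B) 1 := by
  rw [cmon, cexp, monomial_sum_one]; rfl

lemma uv_mul_cmon_eq_monomial (k : ι) (B : Finset ι) :
    uv k * cmon B = monomial (Finsupp.single (Sum.inr k) 1 + cexp B) 1 := by
  rw [cmon_eq_monomial, uv, X, monomial_mul, one_mul]

lemma cexp_apply_inr (k : ι) (B : Finset ι) : cexp B (Sum.inr k) = 0 := by
  simp [cexp, Finsupp.finsetSum_apply]

lemma cexp_apply_inl [DecidableEq ι] (k : ι) (B : Finset ι) :
    cexp B (Sum.inl k) = if k ∈ B then 1 else 0 := by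
  simp [cexp, Finsupp.finsetSum_apply, Finsupp.single_apply]

lemma uv_mul_cmon_exp_injective {k l : ι} {B C : Finset ι}
    (h : Finsupp.single (Sum.inr k) 1 + cexp B = Finsupp.single (Sum.inr l) 1 + cexp C) :
    k = l ∧ B = C := by
  classical
  constructor
  · have := DFunLike.congr_fun h (Sum.inr k)
    simp only [Finsupp.add_apply, cexp_apply_inr, Finsupp.single_apply] at this
    by_contra hkl
    simp [Ne.symm hkl] at this
  · ext i
    have := DFunLike.congr_fun h (Sum.inl i)
    simp only [Finsupp.add_apply, cexp_apply_inl, Finsupp.single_apply] at this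
    by_cases h1 : i ∈ B <;> by_cases h2 : i ∈ C <;> simp_all

/-- A span of monomials is cut out by a condition on the support, and multiplying by z ≠ 0 leaves
the support unchanged. Hence `V` and `W` are saturated, which permits division by factorials. -/
lemma mem_span_monomial_of_zsmul {S : Set (ι ⊕ ι →₀ ℕ)} {F : Poly ι} {z : ℤ} (hz : z ≠ 0)
    (h : z • F ∈ Submodule.span ℤ ((fun d => (monomial d (1 : ℤ) : Poly ι)) '' S)) :
    F ∈ Submodule.span ℤ ((fun d => (monomial d (1 : ℤ) : Poly ι)) '' S) := by
  rw [← restrictSupport_eq_span, mem_restrictSupport_iff] at h ⊢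
  intro d hd
  apply h
  rw [Finset.mem_coe, mem_support_iff] at hd ⊢
  rw [coeff_smul]
  exact mul_ne_zero hz hd

lemma mem_V_of_zsmul {s : Finset ι} {j : ℕ} {F : Poly ι} {z : ℤ} (hz : z ≠ 0)
    (h : z • F ∈ V s j) : F ∈ V s j := by
  have e : {f | ∃ B ⊆ s, B.card = j ∧ f = cmon B}
      = (fun d => (monomial d (1 : ℤ) : Poly ι)) '' {d | ∃ B ⊆ s, B.card = j ∧ d = cexp B} := by
    ext f
    constructor
    · rintro ⟨B, h1, h2, rfl⟩
      exact ⟨_, ⟨B, h1, h2, rfl⟩, (cmon_eq_monomial B).symm⟩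
    · rintro ⟨_, ⟨B, h1, h2, rfl⟩, rfl⟩
      exact ⟨B, h1, h2, (cmon_eq_monomial B).symm⟩
  rw [V, e] at h ⊢
  exact mem_span_monomial_of_zsmul hz h

lemma isHomogeneous_cv (k : ι) : (cv k).IsHomogeneous 1 := isHomogeneous_X _ _
lemma isHomogeneous_uv (k : ι) : (uv k).IsHomogeneous 1 := isHomogeneous_X _ _

lemma isHomogeneous_cmon (B : Finset ι) : (cmon B).IsHomogeneous B.card := by
  have := IsHomogeneous.prod B cv (fun _ => 1) fun i _ => isHomogeneous_cv i
  rwa [Finset.sum_const, smul_eq_mul, mul_one] at this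

lemma isHomogeneous_uv_mul_cmon (k : ι) (B : Finset ι) :
    (uv k * cmon B).IsHomogeneous (B.card + 1) := by
  rw [add_comm]; exact (isHomogeneous_uv k).mul (isHomogeneous_cmon B)

lemma Eu_iterate_Dc {F : Poly ι} (hDu : Du F = 0) (hEu : Eu F = 0) (r : ℕ) :
    Eu (Dc^[r] F) = 0 := by
  cases r with
  | zero => exact hEu
  | succ r =>
    have := iterate_Dc_Eu r F
    rw [hDu, hEu, iterate_Dc_zero, iterate_Dc_zero, mul_zero, add_zero] at this
    exact this.symm

lemma zsmul_eq_zero_iff {z : ℤ} (hz : z ≠ 0) {F : Poly ι} : z • F = 0 ↔ F = 0 := by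
  simp [hz]

/-! ### The maps that detect the factors -/

/-- `Dc ^ (j - i)` on the component of degree `j + 1`, after `Du` if `e = 0`. -/
def factorMap (e i j : ℕ) : Poly ι →ₗ[ℤ] Poly ι :=
  ((Dc : Derivation ℤ (Poly ι) (Poly ι)).toLinearMap ^ (j - i)) ∘ₗ
    (if e = 0 then (Du : Derivation ℤ (Poly ι) (Poly ι)).toLinearMap else LinearMap.id) ∘ₗ
      homogeneousComponent (j + 1)

lemma factorMap_zero (i j : ℕ) (F : Poly ι) :
    factorMap 0 i j F = Dc^[j - i] (Du (homogeneousComponent (j + 1) F)) := by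
  rw [factorMap, if_pos rfl, LinearMap.comp_apply, Module.End.pow_apply]; rfl

lemma factorMap_one (i j : ℕ) (F : Poly ι) :
    factorMap 1 i j F = Dc^[j - i] (homogeneousComponent (j + 1) F) := by
  rw [factorMap, if_neg one_ne_zero, LinearMap.comp_apply, Module.End.pow_apply]; rfl

/-- The polynomials that generate the images of `factorMap e i j`. -/
def gen (e : ℕ) (L : List ι) : Poly ι := if e = 0 then genV L else genW L

/-- The span of the `gen e L` for lists `L` of `2 i + e` distinct elements of `s`. -/
def genSpan (s : Finset ι) (e i : ℕ) : Submodule ℤ (Poly ι) :=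
  Submodule.span ℤ {G | ∃ L : List ι, L.Nodup ∧ L.length = 2 * i + e ∧ (∀ x ∈ L, x ∈ s) ∧
    G = gen e L}

lemma genSpan_zero {s : Finset ι} (i : ℕ) : genSpan s 0 i = SV s i := by simp [genSpan, SV, gen]

lemma genSpan_one {s : Finset ι} (i : ℕ) : genSpan s 1 (i + 1) = SW s i := by
  simp [genSpan, SW, gen, mul_add, add_assoc]

variable [DecidableEq ι]

lemma mem_W_of_zsmul {s : Finset ι} {j : ℕ} {F : Poly ι} {z : ℤ} (hz : z ≠ 0)
    (h : z • F ∈ W s j) : F ∈ W s j := by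
  have e : {F | ∃ k ∈ s, ∃ B ⊆ s.erase k, B.card = j ∧ F = uv k * cmon B}
      = (fun d => (monomial d (1 : ℤ) : Poly ι)) '' {d | ∃ k ∈ s, ∃ B ⊆ s.erase k, B.card = j ∧
        d = Finsupp.single (Sum.inr k) 1 + cexp B} := by
    ext f
    constructor
    · rintro ⟨k, hk, B, h1, h2, rfl⟩
      exact ⟨_, ⟨k, hk, B, h1, h2, rfl⟩, (uv_mul_cmon_eq_monomial k B).symm⟩
    · rintro ⟨_, ⟨k, hk, B, h1, h2, rfl⟩, rfl⟩
      exact ⟨k, hk, B, h1, h2, (uv_mul_cmon_eq_monomial k B).symm⟩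
  rw [W, e] at h ⊢
  exact mem_span_monomial_of_zsmul hz h

/-! ### Homogeneous components -/

/-- Multilinear polynomials of degree `1` in the `u i`, `i ∈ s`. -/
def Wt (s : Finset ι) : Submodule ℤ (Poly ι) :=
  Submodule.span ℤ {F | ∃ k ∈ s, ∃ B ⊆ s.erase k, F = uv k * cmon B}

variable {s : Finset ι} {j : ℕ} {k : ι}

lemma W_le_Wt : W s j ≤ Wt s :=
  Submodule.span_mono fun _ ⟨k, hk, B, hB, _, e⟩ => ⟨k, hk, B, hB, e⟩

lemma isHomogeneous_of_mem_W {F : Poly ι} (hF : F ∈ W s j) : F.IsHomogeneous (j + 1) := by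
  rw [← mem_homogeneousSubmodule]
  refine (Submodule.span_le.2 ?_) hF
  rintro _ ⟨k, hk, B, hB, rfl, rfl⟩
  exact isHomogeneous_uv_mul_cmon k B

lemma homogeneousComponent_mem_W {F : Poly ι} (hF : F ∈ Wt s) :
    homogeneousComponent (j + 1) F ∈ W s j := by
  refine (Submodule.span_le (p := (W s j).comap (homogeneousComponent (j + 1)))).2 ?_ hF
  rintro _ ⟨k, hk, B, hB, rfl⟩
  change homogeneousComponent (j + 1) (uv k * cmon B) ∈ W s j
  rw [homogeneousComponent_of_mem (isHomogeneous_uv_mul_cmon k B)]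
  split_ifs with h
  · exact Submodule.subset_span ⟨k, hk, B, hB, by omega, rfl⟩
  · exact zero_mem _

lemma homogeneousComponent_zero_of_mem_Wt {F : Poly ι} (hF : F ∈ Wt s) :
    homogeneousComponent 0 F = 0 := by
  have : F ∈ LinearMap.ker (homogeneousComponent 0 : Poly ι →ₗ[ℤ] Poly ι) := by
    refine (Submodule.span_le.2 ?_) hF
    rintro _ ⟨k, hk, B, hB, rfl⟩
    change homogeneousComponent 0 (uv k * cmon B) = 0
    rw [homogeneousComponent_of_mem (isHomogeneous_uv_mul_cmon k B), if_neg (by omega)]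
  exact this

lemma Eu_homogeneousComponent {F : Poly ι} (hF : F ∈ Wt s) (i : ℕ) :
    Eu (homogeneousComponent i F) = homogeneousComponent i (Eu F) := by
  have : F ∈ LinearMap.eqLocus ((Eu : Derivation ℤ (Poly ι) (Poly ι)).toLinearMap ∘ₗ
      homogeneousComponent i) (homogeneousComponent i ∘ₗ
        (Eu : Derivation ℤ (Poly ι) (Poly ι)).toLinearMap) := by
    refine (Submodule.span_le.2 ?_) hF
    rintro _ ⟨k, hk, B, hB, rfl⟩
    change Eu (homogeneousComponent i (uv k * cmon B)) =
      homogeneousComponent i (Eu (uv k * cmon B))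
    have h : (Eu (uv k * cmon B)).IsHomogeneous (B.card + 1) := by
      have : Eu (uv k * cmon B) = cv k * cmon B := by
        rw [Derivation.leibniz, Eu_cmon, Eu_uv]; simp; ring
      rw [this, add_comm]
      exact (isHomogeneous_cv k).mul (isHomogeneous_cmon B)
    rw [homogeneousComponent_of_mem (isHomogeneous_uv_mul_cmon k B),
      homogeneousComponent_of_mem h]
    split_ifs
    · rfl
    · simp
  exact this

lemma eq_zero_of_homogeneousComponent {F : Poly ι} (hF : F ∈ Wt s)
    (h : ∀ j, homogeneousComponent (j + 1) F = 0) : F = 0 := by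
  rw [← sum_homogeneousComponent F]
  refine Finset.sum_eq_zero fun i _ => ?_
  cases i with
  | zero => exact homogeneousComponent_zero_of_mem_Wt hF
  | succ j => exact h j

lemma mem_cycles_of_mem_Wt {F : Poly ι} (hF : F ∈ Wt s) (h : Eu F = 0) : F ∈ cycles s := by
  rw [← sum_homogeneousComponent F]
  refine sum_mem fun i _ => ?_
  cases i with
  | zero => rw [homogeneousComponent_zero_of_mem_Wt hF]; exact zero_mem _
  | succ j =>
    refine mem_cycles_of_Eu_eq_zero (homogeneousComponent_mem_W (j := j) hF) ?_
    rw [Eu_homogeneousComponent hF, h, map_zero]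

/-! ### The kernels of the powers of `Dc` -/

/-- Apply Dc^(j+1) to Eu F = 0: since Dc^(j+1) F = 0, only (j+1) Dc^j Du F remains. Thus i = 0
contributes no factor with e = 0. -/
lemma iterate_Dc_Du_eq_zero {F : Poly ι} (hF : F ∈ W s j) (hEu : Eu F = 0) :
    Dc^[j] (Du F) = 0 := by
  have := iterate_Dc_Eu j F
  rw [hEu, Dc_iterate_eq_zero_of_mem_W hF, iterate_Dc_zero, map_zero, zero_add] at this
  exact eq_zero_of_natCast_mul j this.symm

/-- Dc^j F is a linear form in the u_i that `Eu` kills. Thus i = 0 contributes no factor with e = 1.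
-/
lemma iterate_Dc_eq_zero {F : Poly ι} (hF : F ∈ W s j) (hDu : Du F = 0) (hEu : Eu F = 0) :
    Dc^[j] F = 0 :=
  eq_zero_of_Eu_W_zero (s := s) (Dc_iterate_mem_W (by rwa [zero_add])) (Eu_iterate_Dc hDu hEu j)

/-- Induction on i from the automatic case i = 0. When the next value violates i + j ≤ |s|, the
power of `Dc` that is already known to kill `Du F` is injective, so `Du F` itself vanishes. -/
lemma iterate_Dc_Du_eq_zero_of_forall {F : Poly ι} (hF : F ∈ W s j) (hEu : Eu F = 0) {i : ℕ}
    (hi : i ≤ j) (h : ∀ i', 1 ≤ i' → i' ≤ i → i' + j ≤ s.card → Dc^[j - i'] (Du F) = 0) :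
    Dc^[j - i] (Du F) = 0 := by
  induction i with
  | zero => exact iterate_Dc_Du_eq_zero hF hEu
  | succ i ih =>
    by_cases hij : i + 1 + j ≤ s.card
    · exact h _ (by omega) le_rfl hij
    · have := ih (by omega) fun i' h1 h2 h3 => h i' h1 (by omega) h3
      rw [eq_zero_of_iterate_Dc_V (Du_mem_V hF) this (by omega), iterate_Dc_zero]

lemma iterate_Dc_eq_zero_of_forall {F : Poly ι} (hF : F ∈ W s j) (hDu : Du F = 0)
    (hEu : Eu F = 0) {i : ℕ} (hi : i ≤ j)
    (h : ∀ i', 1 ≤ i' → i' ≤ i → i' + j + 1 ≤ s.card → Dc^[j - i'] F = 0) :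
    Dc^[j - i] F = 0 := by
  induction i with
  | zero => exact iterate_Dc_eq_zero hF hDu hEu
  | succ i ih =>
    by_cases hij : i + 1 + j + 1 ≤ s.card
    · exact h _ (by omega) le_rfl hij
    · have := ih (by omega) fun i' h1 h2 h3 => h i' h1 (by omega) h3
      rw [eq_zero_of_iterate_Dc_W hF this (by omega), iterate_Dc_zero]

/-- Taking i = j leaves no power of `Dc`: the maps with e = 0 give Du F = 0 in each degree, and then
those with e = 1 give F = 0. -/
lemma eq_zero_of_factorMap_eq_zero {F : Poly ι} (hF : F ∈ Wt s) (hEu : Eu F = 0)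
    (h : ∀ e i j, e ≤ 1 → 1 ≤ i → i ≤ j → i + j + e ≤ s.card → factorMap e i j F = 0) :
    F = 0 := by
  refine eq_zero_of_homogeneousComponent hF fun j => ?_
  have hW := homogeneousComponent_mem_W (j := j) hF
  have hE : Eu (homogeneousComponent (j + 1) F) = 0 := by
    rw [Eu_homogeneousComponent hF, hEu, map_zero]
  have hD : Du (homogeneousComponent (j + 1) F) = 0 := by
    have := iterate_Dc_Du_eq_zero_of_forall hW hE le_rfl fun i h1 h2 h3 => by
      rw [← factorMap_zero]; exact h 0 i j (by omega) h1 h2 h3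
    rwa [Nat.sub_self] at this
  have := iterate_Dc_eq_zero_of_forall hW hD hE le_rfl fun i h1 h2 h3 => by
    rw [← factorMap_one]; exact h 1 i j (by omega) h1 h2 h3
  rwa [Nat.sub_self] at this

/-- Divide by (j-i)!; the quotient G stays multilinear by saturation. Vanishing of the preceding
maps means that the relevant derivations kill G, and the kernel theorems put G in the span of
products of minors. -/
lemma exists_factorMap_eq {F : Poly ι} (hF : F ∈ Wt s) (hEu : Eu F = 0) {e i j : ℕ} (he : e ≤ 1)
    (hi : 1 ≤ i) (hij : i ≤ j) (hs : i + j + e ≤ s.card)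
    (h : ∀ e' i', e' ≤ 1 → 1 ≤ i' → i' ≤ j → i' + j + e' ≤ s.card →
      (e' < e ∨ e' = e ∧ i' < i) → factorMap e' i' j F = 0) :
    ∃ G ∈ genSpan s e i, factorMap e i j F = ((j - i).factorial : ℤ) • G := by
  have hW := homogeneousComponent_mem_W (j := j) hF
  have hE : Eu (homogeneousComponent (j + 1) F) = 0 := by
    rw [Eu_homogeneousComponent hF, hEu, map_zero]
  have hfac : ((j - i).factorial : ℤ) ≠ 0 := by exact_mod_cast Nat.factorial_ne_zero _
  have hsub : j - (i - 1) = j - i + 1 := by omega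
  obtain rfl | rfl : e = 0 ∨ e = 1 := by omega
  · rw [factorMap_zero]
    obtain ⟨G, hG⟩ := exists_iterate_Dc_eq_factorial_mul
      (Du (homogeneousComponent (j + 1) F)) (j - i)
    refine ⟨G, ?_, hG⟩
    rw [genSpan_zero]
    -- One more power of `Dc` belongs to i - 1, which comes earlier (or is the automatic case 0);
    -- hence Dc G = 0.
    have h1 := iterate_Dc_Du_eq_zero_of_forall hW hE (i := i - 1) (by omega)
      fun i' h1 h2 h3 => by
        rw [← factorMap_zero]
        exact h 0 i' (by omega) h1 (by omega) h3 (.inr ⟨rfl, by omega⟩)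
    rw [hsub, Function.iterate_succ_apply', hG, Derivation.map_smul, zsmul_eq_zero_iff hfac] at h1
    have h2 : Dc^[j - i] (Du (homogeneousComponent (j + 1) F)) ∈ V s i :=
      Dc_iterate_mem_V (by rw [Nat.add_sub_cancel' hij]; exact Du_mem_V hW)
    rw [hG] at h2
    exact mem_SV_of_Dc_eq_zero (mem_V_of_zsmul hfac h2) h1 (by omega)
  · rw [factorMap_one]
    -- All maps with e = 0 in this degree precede those with e = 1, so `Du` kills the whole
    -- component.
    have hD : Du (homogeneousComponent (j + 1) F) = 0 := by
      have := iterate_Dc_Du_eq_zero_of_forall hW hE le_rfl fun i h1 h2 h3 => by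
        rw [← factorMap_zero]; exact h 0 i (by omega) h1 h2 h3 (.inl (by omega))
      rwa [Nat.sub_self] at this
    obtain ⟨G, hG⟩ := exists_iterate_Dc_eq_factorial_mul
      (homogeneousComponent (j + 1) F) (j - i)
    refine ⟨G, ?_, hG⟩
    obtain ⟨i, rfl⟩ : ∃ i', i = i' + 1 := ⟨i - 1, by omega⟩
    rw [genSpan_one]
    have h1 := iterate_Dc_eq_zero_of_forall hW hD hE (i := i) (by omega)
      fun i' h1 h2 h3 => by
        rw [← factorMap_one]
        exact h 1 i' (by omega) h1 (by omega) h3 (.inr ⟨rfl, by omega⟩)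
    rw [Nat.add_sub_cancel] at hsub
    rw [hsub, Function.iterate_succ_apply', hG, Derivation.map_smul, zsmul_eq_zero_iff hfac] at h1
    have h2 : Dc^[j - (i + 1)] (homogeneousComponent (j + 1) F) ∈ W s (i + 1) :=
      Dc_iterate_mem_W (by rwa [Nat.add_sub_cancel' hij])
    rw [hG] at h2
    have h3 := iterate_Dc_Du (j - (i + 1)) (homogeneousComponent (j + 1) F)
    rw [hD, iterate_Dc_zero, hG, Derivation.map_smul, eq_comm, zsmul_eq_zero_iff hfac] at h3
    have h4 := Eu_iterate_Dc hD hE (j - (i + 1))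
    rw [hG, Derivation.map_smul, zsmul_eq_zero_iff hfac] at h4
    exact mem_SW_of_eq_zero (mem_W_of_zsmul hfac h2) h1 h3 h4 (by omega)

/-! ### Preimages of the generators -/

lemma iterate_Dc_cmon_eq_zero (K : Finset ι) {r : ℕ} (hr : K.card < r) : Dc^[r] (cmon K) = 0 := by
  induction K using Finset.induction generalizing r with
  | empty =>
    obtain ⟨r, rfl⟩ : ∃ r', r = r' + 1 := ⟨r - 1, by simp at hr; omega⟩
    rw [Function.iterate_succ_apply, cmon_empty, Derivation.map_one_eq_zero, iterate_Dc_zero]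
  | insert k K hk ih =>
    rw [Finset.card_insert_of_notMem hk] at hr
    obtain ⟨r, rfl⟩ : ∃ r', r = r' + 1 := ⟨r - 1, by omega⟩
    rw [cmon_insert hk, iterate_Dc_cv_mul, ih (by omega), ih (by omega), mul_zero, mul_zero,
      add_zero]

lemma iterate_Dc_cmon (K : Finset ι) : Dc^[K.card] (cmon K) = (K.card.factorial : ℤ) • 1 := by
  induction K using Finset.induction with
  | empty => simp
  | insert k K hk ih =>
    rw [Finset.card_insert_of_notMem hk, cmon_insert hk, iterate_Dc_cv_mul, ih,
      iterate_Dc_cmon_eq_zero K (Nat.lt_succ_self _), Nat.factorial_succ]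
    simp

lemma cmon_mul_mem_W {K : Finset ι} {F : Poly ι} (hK : Disjoint K s) (hF : F ∈ W s j) :
    cmon K * F ∈ W (K ∪ s) (j + K.card) := by
  induction K using Finset.induction with
  | empty => simpa using hF
  | insert k K hk ih =>
    rw [Finset.disjoint_insert_left] at hK
    rw [cmon_insert hk, mul_assoc, Finset.card_insert_of_notMem hk, ← add_assoc]
    refine cv_mul_mem_W (by simp) ?_
    rw [Finset.insert_union, Finset.erase_insert (by simp [hk, hK.1])]
    exact ih hK.2

lemma exists_disjoint_card (L : List ι) {r : ℕ} (h : L.length + r ≤ s.card) :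
    ∃ K ⊆ s, Disjoint K L.toFinset ∧ K.card = r := by
  have h1 : r ≤ (s \ L.toFinset).card := by
    have := Finset.le_card_sdiff L.toFinset s
    have := List.toFinset_card_le L
    omega
  obtain ⟨K, hK, hr⟩ := Finset.exists_subset_card_eq h1
  exact ⟨K, hK.trans Finset.sdiff_subset,
    Finset.disjoint_of_subset_left hK Finset.sdiff_disjoint, hr⟩

/-- Multiply G by c^K with |K| = j - i and K disjoint from L. As `Dc` kills H, Dc^(j-i) acts on c^K
alone and gives (j-i)!; a smaller i' means a higher power, which kills c^K. -/
lemma exists_preimage_of_mem_W {e i j : ℕ} (he : e ≤ 1) (hij : i ≤ j)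
    (hs : i + j + e ≤ s.card) {L : List ι} (hL : L.length = 2 * i + e) (hLs : ∀ x ∈ L, x ∈ s)
    {G H : Poly ι} (hG : G ∈ W L.toFinset i) (hEu : Eu G = 0)
    (hDu : Du G = if e = 0 then H else 0) (hH : Dc H = 0) (hGH : e = 1 → G = H) :
    ∃ F ∈ Wt s, Eu F = 0 ∧ factorMap e i j F = ((j - i).factorial : ℤ) • H ∧
      ∀ e' i' j', e' ≤ 1 → i' ≤ j' → (j' < j ∨ j' = j ∧ (e' < e ∨ e' = e ∧ i' < i)) →
        factorMap e' i' j' F = 0 := by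
  -- There is room for K because |L| + (j - i) = i + j + e ≤ |s|.
  obtain ⟨K, hKs, hK, hKr⟩ := exists_disjoint_card (s := s) L (r := j - i) (by omega)
  have hF : cmon K * G ∈ W s j := by
    have := cmon_mul_mem_W hK hG
    rw [hKr, Nat.add_sub_cancel' hij] at this
    refine W_mono (Finset.union_subset hKs fun x hx => hLs x (by simpa using hx)) this
  have hhom := homogeneousComponent_eq_self (isHomogeneous_of_mem_W hF)
  have hDuF : Du (cmon K * G) = cmon K * Du G := by
    rw [Derivation.leibniz, Du_cmon]; simp
  have hit (r : ℕ) : Dc^[r] (cmon K * H) = H * Dc^[r] (cmon K) := by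
    rw [mul_comm, iterate_Dc_mul_of_Dc_eq_zero hH]
  refine ⟨cmon K * G, W_le_Wt hF, ?_, ?_, ?_⟩
  · rw [Derivation.leibniz, Eu_cmon, hEu]; simp
  · obtain rfl | rfl : e = 0 ∨ e = 1 := by omega
    · rw [factorMap_zero, hhom, hDuF, hDu, if_pos rfl, hit, ← hKr, iterate_Dc_cmon, mul_smul_comm,
        mul_one]
    · rw [factorMap_one, hhom, hGH rfl, hit, ← hKr, iterate_Dc_cmon, mul_smul_comm, mul_one]
  · intro e' i' j' he' hij' h
    rcases h with h | ⟨rfl, h⟩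
    · have h0 : homogeneousComponent (j' + 1) (cmon K * G) = 0 := by
        rw [homogeneousComponent_of_mem (isHomogeneous_of_mem_W hF), if_neg (by omega)]
      simp [factorMap, h0]
    · rcases h with h | ⟨rfl, h⟩
      · obtain ⟨rfl, rfl⟩ : e' = 0 ∧ e = 1 := by omega
        rw [factorMap_zero, hhom, hDuF, hDu, if_neg one_ne_zero, mul_zero, iterate_Dc_zero]
      · obtain rfl | rfl : e' = 0 ∨ e' = 1 := by omega
        · rw [factorMap_zero, hhom, hDuF, hDu, if_pos rfl, hit,
            iterate_Dc_cmon_eq_zero K (by omega), mul_zero]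
        · rw [factorMap_one, hhom, hGH rfl, hit, iterate_Dc_cmon_eq_zero K (by omega), mul_zero]

lemma exists_preimage_gen {e i j : ℕ} (he : e ≤ 1) (hi : 1 ≤ i) (hij : i ≤ j)
    (hs : i + j + e ≤ s.card) {L : List ι} (hLn : L.Nodup) (hL : L.length = 2 * i + e)
    (hLs : ∀ x ∈ L, x ∈ s) :
    ∃ F ∈ Wt s, Eu F = 0 ∧ factorMap e i j F = ((j - i).factorial : ℤ) • gen e L ∧
      ∀ e' i' j', e' ≤ 1 → i' ≤ j' → (j' < j ∨ j' = j ∧ (e' < e ∨ e' = e ∧ i' < i)) →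
        factorMap e' i' j' F = 0 := by
  obtain ⟨i, rfl⟩ : ∃ i', i = i' + 1 := ⟨i - 1, by omega⟩
  obtain rfl | rfl : e = 0 ∨ e = 1 := by omega
  · rcases L with _ | ⟨p, _ | ⟨q, L⟩⟩
    · simp at hL
    · simp at hL; omega
    -- The cycle c_q u_p - c_p u_q is killed by `Eu`, and `Du` maps it to the difference c_q - c_p.
    refine exists_preimage_of_mem_W (L := p :: q :: L) (G := (cv q * uv p - cv p * uv q) * genV L)
      he hij hs hL hLs ?_ ?_ ?_ (by simp [gen]) (by simp)
    · simp only [List.nodup_cons, List.mem_cons, not_or, List.length_cons] at hLn hL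
      obtain ⟨⟨h1, h2⟩, h3, h4⟩ := hLn
      have h (x y) (hx : x ∉ L) (hy : y ∉ L) (hxy : x ≠ y) (hxs : x ∈ (p :: q :: L).toFinset)
          (hys : y ∈ (p :: q :: L).toFinset) :
          cv x * (uv y * genV L) ∈ W (p :: q :: L).toFinset (i + 1) := by
        refine cv_mul_mem_W hxs (uv_mul_mem_W (Finset.mem_erase.2 ⟨hxy.symm, hys⟩)
          (genV_mem L i h4 (by omega) fun z hz => ?_))
        rw [Finset.mem_erase, Finset.mem_erase]
        exact ⟨fun e => hy (e ▸ hz), fun e => hx (e ▸ hz), by simp [hz]⟩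
      rw [sub_mul, mul_assoc, mul_assoc]
      exact sub_mem (h q p h3 h2 (Ne.symm h1) (by simp) (by simp))
        (h p q h2 h3 h1 (by simp) (by simp))
    · simp [Derivation.leibniz]; right; ring
    · simp [Derivation.leibniz, gen, genV]; ring
  · refine exists_preimage_of_mem_W (L := L) (G := genW L) he hij hs hL hLs
      (genW_mem L i hLn (by omega) (by simp)) (by simp) (by simp) (by simp [gen]) (by simp [gen])

end IntPI.Poly

/-! ### Specht modules inside the module of polynomials -/

namespace IntPI
open MvPolynomial IntPI.Poly

/-- The action of `Sₙ` on polynomials by permutations of the indices below `n`. -/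
def polyRep (n : ℕ) : Representation ℤ (Perm (Fin n)) (Poly ℕ) where
  toFun σ := (rename (Sum.map (extendPerm n σ) (extendPerm n σ))).toLinearMap
  map_one' := by
    refine LinearMap.ext fun F => ?_
    have h : Sum.map (extendPerm n 1 : ℕ → ℕ) (extendPerm n 1) = id := by
      rw [map_one]; exact Sum.map_id_id
    rw [h]
    exact rename_id_apply F
  map_mul' σ τ := by
    refine LinearMap.ext fun F => ?_
    have h : Sum.map (extendPerm n (σ * τ) : ℕ → ℕ) (extendPerm n (σ * τ)) =
        Sum.map (extendPerm n σ : ℕ → ℕ) (extendPerm n σ) ∘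
          Sum.map (extendPerm n τ : ℕ → ℕ) (extendPerm n τ) := by
      rw [map_mul, Sum.map_comp_map]; rfl
    rw [h]
    exact (rename_rename _ _ F).symm

lemma extendPerm_apply {n : ℕ} (σ : Perm (Fin n)) (i : Fin n) :
    extendPerm n σ (i : ℕ) = (σ i : ℕ) :=
  Equiv.Perm.viaEmbedding_apply σ Fin.valEmbedding i

lemma polyRep_cv {n : ℕ} (σ : Perm (Fin n)) (i : ℕ) :
    polyRep n σ (cv i) = cv (extendPerm n σ i) := rename_X _ _

lemma polyRep_uv {n : ℕ} (σ : Perm (Fin n)) (i : ℕ) :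
    polyRep n σ (uv i) = uv (extendPerm n σ i) := rename_X _ _

lemma polyRep_mul {n : ℕ} (σ : Perm (Fin n)) (F G : Poly ℕ) :
    polyRep n σ (F * G) = polyRep n σ F * polyRep n σ G :=
  map_mul (rename (Sum.map (extendPerm n σ) (extendPerm n σ))) F G

lemma polyRep_one {n : ℕ} (σ : Perm (Fin n)) : polyRep n σ (1 : Poly ℕ) = 1 :=
  map_one (rename (Sum.map (extendPerm n σ) (extendPerm n σ)))

/-- The `ℤ Sₙ`-module of polynomials. -/
abbrev PolyMod (n : ℕ) : Type := (polyRep n).asModule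

namespace Tableau

variable {n : ℕ} {μ : YoungDiagram}

/-- The exponent of `1`, `c k` or `u k` for `r = 0`, `r = 1` and `r ≥ 2`. -/
def varExp : ℕ → ℕ → (ℕ ⊕ ℕ →₀ ℕ)
  | 0, _ => 0
  | 1, k => Finsupp.single (Sum.inl k) 1
  | _ + 2, k => Finsupp.single (Sum.inr k) 1

/-- The variable `1`, `c k` or `u k` for `r = 0`, `r = 1` and `r ≥ 2`. -/
def rowVar (r k : ℕ) : Poly ℕ := monomial (varExp r k) 1

lemma rowVar_zero (k : ℕ) : rowVar 0 k = 1 := rfl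
lemma rowVar_one (k : ℕ) : rowVar 1 k = cv k := rfl
lemma rowVar_two (k : ℕ) : rowVar 2 k = uv k := rfl

lemma polyRep_rowVar (σ : Perm (Fin n)) (r k : ℕ) :
    polyRep n σ (rowVar r k) = rowVar r (extendPerm n σ k) := by
  rcases r with _ | _ | r
  · exact polyRep_one σ
  · exact polyRep_cv σ k
  · exact polyRep_uv σ k

/-- The monomial in which the factor with index `i` is given by the row of `i`. -/
def tabMonomial (T : Tableau n μ) : Poly ℕ := ∏ i : Fin n, rowVar (row T i) i

/-- The exponent of `σ · tabMonomial T`. -/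
def tabExp (T : Tableau n μ) (σ : Perm (Fin n)) : ℕ ⊕ ℕ →₀ ℕ :=
  ∑ i : Fin n, varExp (row T i) (σ i)

lemma polyRep_tabMonomial' (T : Tableau n μ) (σ : Perm (Fin n)) :
    polyRep n σ (tabMonomial T) = ∏ i : Fin n, rowVar (row T i) (σ i) := by
  have := map_prod (rename (Sum.map (extendPerm n σ) (extendPerm n σ)) : Poly ℕ →ₐ[ℤ] Poly ℕ)
    (fun i : Fin n => rowVar (row T i) i) Finset.univ
  refine Eq.trans this (Finset.prod_congr rfl fun i _ => ?_)
  rw [← extendPerm_apply]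
  exact polyRep_rowVar σ _ _

lemma polyRep_tabMonomial (T : Tableau n μ) (σ : Perm (Fin n)) :
    polyRep n σ (tabMonomial T) = monomial (tabExp T σ) 1 := by
  rw [polyRep_tabMonomial', tabExp, monomial_sum_one]; rfl

lemma varExp_inl (r k : ℕ) (l : ℕ) :
    varExp r k (Sum.inl l) = if r = 1 ∧ k = l then 1 else 0 := by
  rcases r with _ | _ | r <;> simp [varExp, Finsupp.single_apply]

lemma varExp_inr (r k : ℕ) (l : ℕ) :
    varExp r k (Sum.inr l) = if 2 ≤ r ∧ k = l then 1 else 0 := by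
  rcases r with _ | _ | r <;> simp [varExp, Finsupp.single_apply]

lemma tabExp_inl (T : Tableau n μ) (σ : Perm (Fin n)) (i : Fin n) :
    tabExp T σ (Sum.inl (i : ℕ)) = if row T (σ⁻¹ i) = 1 then 1 else 0 := by
  rw [tabExp, Finsupp.finsetSum_apply, Finset.sum_eq_single (σ⁻¹ i)]
  · simp [varExp_inl]
  · intro j _ hj
    rw [varExp_inl, if_neg]
    rintro ⟨-, h⟩
    exact hj (by rw [← Fin.ext h]; simp)
  · simp

lemma tabExp_inr (T : Tableau n μ) (σ : Perm (Fin n)) (i : Fin n) :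
    tabExp T σ (Sum.inr (i : ℕ)) = if 2 ≤ row T (σ⁻¹ i) then 1 else 0 := by
  rw [tabExp, Finsupp.finsetSum_apply, Finset.sum_eq_single (σ⁻¹ i)]
  · simp [varExp_inr]
  · intro j _ hj
    rw [varExp_inr, if_neg]
    rintro ⟨-, h⟩
    exact hj (by rw [← Fin.ext h]; simp)
  · simp

lemma row_le_two (T : Tableau n μ) (hμ : μ.rowLen 3 = 0) (i : Fin n) : row T i ≤ 2 := by
  by_contra h
  have h1 : ((T i : ℕ × ℕ).1, (T i : ℕ × ℕ).2) ∈ μ := (YoungDiagram.mem_cells _).1 (T i).2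
  have h2 : (3, 0) ∈ μ := μ.up_left_mem (by unfold row at h; omega) (Nat.zero_le _) h1
  rw [YoungDiagram.mem_iff_lt_rowLen] at h2
  omega

/-- The exponent records which indices come from row 1 and which from rows ≥ 2 (rows counted from
0). With at most three rows this determines all rows, so the stabilizer of `tabMonomial T` is the
row group. -/
lemma tabExp_eq_iff (T : Tableau n μ) (hμ : μ.rowLen 3 = 0) (σ τ : Perm (Fin n)) :
    tabExp T σ = tabExp T τ ↔ ∀ i, row T ((σ⁻¹ * τ) i) = row T i := by
  constructor
  · intro h i
    have h1 := DFunLike.congr_fun h (Sum.inl (τ i : ℕ))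
    have h2 := DFunLike.congr_fun h (Sum.inr (τ i : ℕ))
    have h0 : τ⁻¹ (τ i) = i := τ.symm_apply_apply i
    rw [tabExp_inl, tabExp_inl, h0] at h1
    rw [tabExp_inr, tabExp_inr, h0] at h2
    have h3 := row_le_two T hμ (σ⁻¹ (τ i))
    have h4 := row_le_two T hμ i
    rw [Perm.mul_apply]
    split_ifs at h1 h2 <;> omega
  · intro h
    rw [tabExp, tabExp]
    refine (Equiv.sum_comp (σ⁻¹ * τ) _).symm.trans (Finset.sum_congr rfl fun i _ => ?_)
    rw [h i]; simp

/-- `tabMonomial T` as an element of the `ℤ Sₙ`-module of polynomials. -/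
def tabVec (T : Tableau n μ) : PolyMod n := (polyRep n).asModuleEquiv.symm (tabMonomial T)

/-- By linearity let y = σ. Then σ a_T has coefficient 1 at τ exactly if σ⁻¹τ preserves the rows,
that is, if σ and τ send `tabMonomial T` to the same monomial. -/
lemma coeff_mul_rowSymmetrizer (T : Tableau n μ) (hμ : μ.rowLen 3 = 0) (y : ZS n)
    (τ : Perm (Fin n)) : (y * rowSymmetrizer T).coeff τ =
      MvPolynomial.coeff (tabExp T τ) ((polyRep n).asModuleEquiv (y • tabVec T)) := by
  classical
  induction y using MonoidAlgebra.induction_linear with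
  | zero => simp
  | add f g hf hg =>
    rw [add_mul, MonoidAlgebra.coeff_add, Finsupp.add_apply, hf, hg, add_smul, map_add,
      MvPolynomial.coeff_add]
  | single σ r =>
    have h1 : (polyRep n).asModuleEquiv (MonoidAlgebra.single σ r • tabVec T) =
        r • monomial (tabExp T σ) 1 := by
      rw [Representation.single_smul, ← polyRep_tabMonomial]; rfl
    rw [h1, MvPolynomial.coeff_smul, MvPolynomial.coeff_monomial, rowSymmetrizer, Finset.mul_sum,
      MonoidAlgebra.coeff_sum, Finsupp.finsetSum_apply]
    simp_rw [MonoidAlgebra.single_mul_single, mul_one, MonoidAlgebra.coeff_single,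
      Finsupp.single_apply, ← eq_inv_mul_iff_mul_eq]
    rw [Finset.sum_ite_eq']
    simp only [Finset.mem_filter, Finset.mem_univ, true_and, tabExp_eq_iff T hμ]
    split_ifs <;> simp

lemma rowSymmetrizer_smul_tabVec (T : Tableau n μ) (hμ : μ.rowLen 3 = 0) :
    ∃ k : ℤ, k ≠ 0 ∧ rowSymmetrizer T • tabVec T = k • tabVec T := by
  classical
  refine ⟨((Finset.univ.filter fun σ : Perm (Fin n) => ∀ i, row T (σ i) = row T i).card : ℤ),
    ?_, ?_⟩
  · have : (1 : Perm (Fin n)) ∈ Finset.univ.filter fun σ : Perm (Fin n) =>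
        ∀ i, row T (σ i) = row T i := by simp
    exact_mod_cast Finset.card_ne_zero_of_mem this
  · rw [rowSymmetrizer, Finset.sum_smul, Nat.cast_smul_eq_nsmul, ← Finset.sum_const]
    refine Finset.sum_congr rfl fun σ hσ => ?_
    rw [Finset.mem_filter] at hσ
    rw [Representation.single_smul, one_smul]
    have h1 := polyRep_tabMonomial T σ
    have h2 := polyRep_tabMonomial T 1
    rw [(tabExp_eq_iff T hμ 1 σ).2 (by simpa using hσ.2), ← h1, map_one] at h2
    exact h2.symm

instance (n : ℕ) : Module.IsTorsionFree ℤ (PolyMod n) :=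
  inferInstanceAs (Module.IsTorsionFree ℤ (Poly ℕ))

/-- Coefficients of y a_T are coefficients of y • `tabVec T`. Conversely a_T multiplies `tabVec T`
by a nonzero integer, which can be cancelled. -/
lemma mul_rowSymmetrizer_eq_zero_iff (T : Tableau n μ) (hμ : μ.rowLen 3 = 0) (y : ZS n) :
    y * rowSymmetrizer T = 0 ↔ y • tabVec T = 0 := by
  constructor
  · intro h
    obtain ⟨k, hk, hT⟩ := rowSymmetrizer_smul_tabVec T hμ
    have h1 : k • (y • tabVec T) = 0 := by
      rw [smul_comm, ← hT, ← mul_smul, h, zero_smul]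
    exact (smul_eq_zero.1 h1).resolve_left hk
  · intro h
    ext τ
    rw [coeff_mul_rowSymmetrizer T hμ, h]
    simp

/-- The Specht module of `T` is isomorphic to the cyclic module generated by a multiple of
`b_T • tabVec T`. -/
lemma nonempty_equiv_specht (T : Tableau n μ) (hμ : μ.rowLen 3 = 0) {N : ℤ} (hN : N ≠ 0) :
    Nonempty (Submodule.span (ZS n) {N • (colSymmetrizer T • tabVec T)} ≃ₗ[ZS n] specht T) := by
  -- Both generators have the same annihilator in ℤSₙ, so the cyclic modules agree.
  have hker : LinearMap.ker (LinearMap.toSpanSingleton (ZS n) (PolyMod n)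
      (N • (colSymmetrizer T • tabVec T))) =
      LinearMap.ker (LinearMap.toSpanSingleton (ZS n) (ZS n)
        (colSymmetrizer T * rowSymmetrizer T)) := by
    ext y
    rw [LinearMap.mem_ker, LinearMap.mem_ker, LinearMap.toSpanSingleton_apply,
      LinearMap.toSpanSingleton_apply, smul_eq_mul, ← mul_assoc,
      mul_rowSymmetrizer_eq_zero_iff T hμ, smul_comm, smul_eq_zero_iff_right hN, mul_smul]
  have e1 := LinearMap.quotKerEquivRange (LinearMap.toSpanSingleton (ZS n) (PolyMod n)
      (N • (colSymmetrizer T • tabVec T)))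
  have e2 := LinearMap.quotKerEquivRange (LinearMap.toSpanSingleton (ZS n) (ZS n)
        (colSymmetrizer T * rowSymmetrizer T))
  rw [LinearMap.range_toSpanSingleton] at e1 e2
  exact ⟨e1.symm.trans ((Submodule.quotEquivOfEq _ _ hker).trans e2)⟩

end Tableau
end IntPI

/-! ### Column antisymmetrization as a product of minors -/

namespace IntPI
open MvPolynomial IntPI.Poly

namespace Tableau

variable {n : ℕ} {μ : YoungDiagram}

/-- The number in the box in row `r` and column `a`. -/
def entry (T : Tableau n μ) (c : ℕ × ℕ) : ℕ :=
  if h : c ∈ μ.cells then (T.symm ⟨c, h⟩ : Fin n) else 0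

lemma entry_lt (T : Tableau n μ) {c : ℕ × ℕ} (h : c ∈ μ) : entry T c < n := by
  rw [entry, dif_pos ((YoungDiagram.mem_cells c).2 h)]
  exact Fin.is_lt _

lemma entry_injOn (T : Tableau n μ) {c d : ℕ × ℕ} (hc : c ∈ μ) (hd : d ∈ μ)
    (h : entry T c = entry T d) : c = d := by
  rw [entry, entry, dif_pos ((YoungDiagram.mem_cells c).2 hc),
    dif_pos ((YoungDiagram.mem_cells d).2 hd)] at h
  simpa using T.symm.injective (Fin.ext h)

/-- The matrix whose determinant is the column antisymmetrization of `tabMonomial T`. -/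
def colMatrix (T : Tableau n μ) : Matrix (Fin n) (Fin n) (Poly ℕ) :=
  Matrix.of fun j i => if col T j = col T i then rowVar (row T i) j else 0

/-- This is the Leibniz formula: permutations that move some index to another column meet a zero
entry of `colMatrix T`. -/
lemma colSymmetrizer_smul_tabVec (T : Tableau n μ) :
    (polyRep n).asModuleEquiv (colSymmetrizer T • tabVec T) = (colMatrix T).det := by
  classical
  rw [colSymmetrizer, Finset.sum_smul, map_sum, Matrix.det_apply, Finset.sum_filter]
  refine Finset.sum_congr rfl fun σ _ => ?_
  split_ifs with h
  · rw [Representation.single_smul]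
    change ((Perm.sign σ : ℤˣ) : ℤ) • polyRep n σ (tabMonomial T) = _
    rw [polyRep_tabMonomial', Units.smul_def]
    congr 1
    refine Finset.prod_congr rfl fun i _ => ?_
    rw [colMatrix, Matrix.of_apply, if_pos (h i)]
  · push Not at h
    obtain ⟨i, hi⟩ := h
    rw [Finset.prod_eq_zero (Finset.mem_univ i), smul_zero]
    rw [colMatrix, Matrix.of_apply, if_neg hi]

lemma colMatrix_blockTriangular (T : Tableau n μ) : (colMatrix T).BlockTriangular (col T) := by
  intro i j h
  rw [colMatrix, Matrix.of_apply, if_neg h.ne']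

/-- The determinant of the rows `1`, `c`, `u`, … in the columns `P 0`, …, `P (h - 1)`. -/
def colDet (h : ℕ) (P : ℕ → ℕ) : Poly ℕ :=
  (Matrix.of fun x y : Fin h => rowVar y (P x)).det

lemma colDet_one (P : ℕ → ℕ) : colDet 1 P = 1 := by simp [colDet, rowVar_zero]

lemma colDet_two (P : ℕ → ℕ) : colDet 2 P = cv (P 1) - cv (P 0) := by
  simp [colDet, Matrix.det_fin_two, rowVar_zero, rowVar_one]

lemma colDet_three (P : ℕ → ℕ) : colDet 3 P = det3 (P 0) (P 1) (P 2) := by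
  simp [colDet, Matrix.det_fin_three, rowVar_zero, rowVar_one, rowVar_two, det3]
  ring

/-- The entries of column `a`. -/
def colEquiv (T : Tableau n μ) (a : ℕ) : Fin (μ.colLen a) ≃ {i : Fin n // col T i = a} where
  toFun r := ⟨T.symm ⟨(r, a), (YoungDiagram.mem_cells _).2
    (YoungDiagram.mem_iff_lt_colLen.2 r.2)⟩, by simp [col]⟩
  invFun i := ⟨row T i, by
    have h : (row T i, col T i) ∈ μ := (YoungDiagram.mem_cells _).1 (T i).2
    rwa [YoungDiagram.mem_iff_lt_colLen, i.2] at h⟩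
  left_inv r := by ext; simp [row]
  right_inv i := by
    apply Subtype.ext
    rw [Equiv.symm_apply_eq]
    apply Subtype.ext
    exact Prod.ext rfl i.2.symm

lemma det_toSquareBlock (T : Tableau n μ) (a : ℕ) :
    ((colMatrix T).toSquareBlock (col T) a).det =
      colDet (μ.colLen a) fun r => entry T (r, a) := by
  rw [← Matrix.det_submatrix_equiv_self (colEquiv T a), colDet]
  congr 1
  ext1 x y
  have hx : ((x : ℕ), a) ∈ μ.cells :=
    (YoungDiagram.mem_cells _).2 (YoungDiagram.mem_iff_lt_colLen.2 x.2)
  rw [Matrix.submatrix_apply, Matrix.toSquareBlock_def, Matrix.of_apply, Matrix.of_apply,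
    colMatrix, Matrix.of_apply, if_pos ((colEquiv T a x).2.trans (colEquiv T a y).2.symm)]
  rw [entry, dif_pos hx]
  simp [colEquiv, row]

lemma image_col (T : Tableau n μ) : Finset.univ.image (col T) = Finset.range (μ.rowLen 0) := by
  ext a
  rw [Finset.mem_image, Finset.mem_range, ← YoungDiagram.mem_iff_lt_rowLen]
  constructor
  · rintro ⟨i, -, rfl⟩
    exact μ.up_left_mem (Nat.zero_le _) le_rfl ((YoungDiagram.mem_cells _).1 (T i).2)
  · intro h
    exact ⟨T.symm ⟨(0, a), (YoungDiagram.mem_cells _).2 h⟩, Finset.mem_univ _, by simp [col]⟩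

lemma det_colMatrix (T : Tableau n μ) :
    (colMatrix T).det =
      ∏ a ∈ Finset.range (μ.rowLen 0), colDet (μ.colLen a) fun r => entry T (r, a) := by
  rw [(colMatrix_blockTriangular T).det, image_col]
  exact Finset.prod_congr rfl fun a _ => det_toSquareBlock T a

/-- The boxes of the columns of length at least two of the shape with rows of length
`≥ k + 1`, `k + 1` and `e`. -/
def longCells (e k : ℕ) : List (ℕ × ℕ) :=
  (0, 0) :: (1, 0) :: ((if e = 0 then [] else [(2, 0)]) ++
    (List.range k).flatMap fun a => [(0, a + 1), (1, a + 1)])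

lemma longCells_nodup (e k : ℕ) : (longCells e k).Nodup := by
  have h : ((List.range k).flatMap fun a => [((0 : ℕ), a + 1), (1, a + 1)]).Nodup := by
    rw [List.nodup_flatMap]
    refine ⟨by simp, List.nodup_range.imp fun {a b} hab => ?_⟩
    intro x hx hy
    simp at hx hy
    grind
  rw [longCells]
  split_ifs <;> simp [h]

lemma longCells_length {e : ℕ} (he : e ≤ 1) (k : ℕ) :
    (longCells e k).length = 2 * (k + 1) + e := by
  obtain rfl | rfl : e = 0 ∨ e = 1 := by omega
  · simp [longCells]; ring
  · simp [longCells]; ring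

lemma mem_of_mem_longCells {k : ℕ} (h1 : μ.rowLen 1 = k + 1) {c : ℕ × ℕ}
    (hc : c ∈ longCells (μ.rowLen 2) k) : c ∈ μ := by
  have h0 := μ.rowLen_anti 0 1 (by omega)
  obtain ⟨r, a⟩ := c
  rw [YoungDiagram.mem_iff_lt_rowLen]
  unfold longCells at hc
  simp only [List.mem_cons, List.mem_append, List.mem_flatMap, List.mem_range, Prod.mk.injEq,
    List.not_mem_nil, or_false] at hc
  rcases hc with ⟨rfl, rfl⟩ | ⟨rfl, rfl⟩ | hc | ⟨b, hb, ⟨rfl, rfl⟩ | ⟨rfl, rfl⟩⟩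
  · omega
  · omega
  · split_ifs at hc with h
    · simp at hc
    · simp at hc
      obtain ⟨rfl, rfl⟩ := hc
      omega
  · omega
  · omega

lemma genV_flatMap (l : List ℕ) (p q : ℕ → ℕ) :
    genV (l.flatMap fun a => [p a, q a]) = (l.map fun a => cv (q a) - cv (p a)).prod := by
  induction l with
  | nil => simp [genV]
  | cons a l ih => simp [genV, ← ih]

lemma colLen_eq {a : ℕ} (r t : ℕ) (ht : r + 1 = t) (h1 : a < μ.rowLen r) (h2 : μ.rowLen t ≤ a) :
    μ.colLen a = t := by
  rw [← YoungDiagram.mem_iff_lt_rowLen, YoungDiagram.mem_iff_lt_colLen] at h1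
  rw [← not_lt, ← YoungDiagram.mem_iff_lt_rowLen, YoungDiagram.mem_iff_lt_colLen] at h2
  omega

/-- The determinant factors over the columns of T. Columns of length 1 contribute 1, those of length
2 a difference of c-variables, and only the first column can have length 3, giving `det3`. -/
lemma colSymmetrizer_smul_eq_gen (T : Tableau n μ) {k : ℕ} (h1 : μ.rowLen 1 = k + 1)
    (h2 : μ.rowLen 2 ≤ 1) (h3 : μ.rowLen 3 = 0) :
    (polyRep n).asModuleEquiv (colSymmetrizer T • tabVec T) =
      gen (μ.rowLen 2) ((longCells (μ.rowLen 2) k).map (entry T)) := by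
  have h0 := μ.rowLen_anti 0 1 (by omega)
  rw [colSymmetrizer_smul_tabVec, det_colMatrix]
  obtain ⟨d, hd⟩ := Nat.exists_eq_add_of_le h0
  have e1 : ∏ a ∈ Finset.range (μ.rowLen 0), colDet (μ.colLen a) (fun r => entry T (r, a)) =
      colDet (μ.colLen 0) (fun r => entry T (r, 0)) *
        ∏ a ∈ Finset.range k, (cv (entry T (1, a + 1)) - cv (entry T (0, a + 1))) := by
    rw [hd, Finset.prod_range_add, h1, Finset.prod_range_succ', mul_comm]
    have e2 : ∏ x ∈ Finset.range d,
        colDet (μ.colLen (k + 1 + x)) (fun r => entry T (r, k + 1 + x)) = 1 := by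
      refine Finset.prod_eq_one fun a ha => ?_
      rw [Finset.mem_range] at ha
      rw [colLen_eq 0 1 rfl (by omega) (by omega), colDet_one]
    rw [e2, one_mul, mul_comm]
    congr 1
    refine Finset.prod_congr rfl fun a ha => ?_
    rw [Finset.mem_range] at ha
    rw [colLen_eq 1 2 rfl (by omega) (by omega), colDet_two]
  have e3 : ∏ a ∈ Finset.range k, (cv (entry T (1, a + 1)) - cv (entry T (0, a + 1))) =
      genV (((List.range k).flatMap fun a => [((0 : ℕ), a + 1), (1, a + 1)]).map (entry T)) := by
    rw [List.map_flatMap]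
    exact (genV_flatMap (List.range k) (fun a => entry T (0, a + 1))
      (fun a => entry T (1, a + 1))).symm
  rw [e1, e3]
  obtain he | he : μ.rowLen 2 = 0 ∨ μ.rowLen 2 = 1 := by omega
  · rw [he, colLen_eq 1 2 rfl (by omega) (by omega), colDet_two]
    simp [gen, longCells, genV]
  · rw [he, colLen_eq 2 3 rfl (by omega) (by omega), colDet_three]
    simp [gen, longCells, genW]

end Tableau

/-! ### The action of permutations on the generators -/

/-- The lists are two embeddings of the same finite set into {0, …, n-1}, and Sₙ is transitive on
such embeddings. -/
lemma exists_perm_map_eq {n : ℕ} {L L' : List ℕ} (hL : L.Nodup) (hL' : L'.Nodup)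
    (hlen : L.length = L'.length) (h : ∀ x ∈ L, x < n) (h' : ∀ x ∈ L', x < n) :
    ∃ σ : Perm (Fin n), L.map (extendPerm n σ) = L' := by
  let f : Fin L.length ↪ Fin n := ⟨fun x => ⟨L.get x, h _ (L.get_mem x)⟩, fun x y hxy =>
    List.nodup_iff_injective_get.1 hL (Fin.mk.inj hxy)⟩
  let f' : Fin L.length ↪ Fin n := ⟨fun x => ⟨L'.get (x.cast hlen), h' _ (L'.get_mem _)⟩,
    fun x y hxy => Fin.cast_injective hlen (List.nodup_iff_injective_get.1 hL' (Fin.mk.inj hxy))⟩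
  have := Equiv.Perm.isMultiplyPretransitive (Fin n) L.length
  obtain ⟨σ, hσ⟩ := MulAction.exists_smul_eq (Perm (Fin n)) f f'
  refine ⟨σ, List.ext_get (by simpa using hlen) fun i h1 h2 => ?_⟩
  have h3 : i < L.length := by simpa using h1
  have := congrArg Fin.val (DFunLike.congr_fun hσ ⟨i, h3⟩)
  rw [List.get_eq_getElem, List.get_eq_getElem, List.getElem_map]
  exact (extendPerm_apply σ (f ⟨i, h3⟩)).trans this

lemma polyRep_sub {n : ℕ} (σ : Perm (Fin n)) (F G : Poly ℕ) :
    polyRep n σ (F - G) = polyRep n σ F - polyRep n σ G := map_sub _ _ _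

lemma polyRep_genV {n : ℕ} (σ : Perm (Fin n)) (L : List ℕ) :
    polyRep n σ (genV L) = genV (L.map (extendPerm n σ)) := by
  induction L using genV.induct with
  | case1 p q L ih =>
    rw [genV, polyRep_mul, ih, polyRep_sub, polyRep_cv, polyRep_cv, List.map_cons, List.map_cons,
      genV]
  | case2 L hL =>
    rcases L with _ | ⟨a, _ | ⟨b, L⟩⟩
    · exact polyRep_one σ
    · exact polyRep_one σ
    · exact absurd rfl (hL a b L)

lemma polyRep_genW {n : ℕ} (σ : Perm (Fin n)) (L : List ℕ) :
    polyRep n σ (genW L) = genW (L.map (extendPerm n σ)) := by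
  rcases L with _ | ⟨p, _ | ⟨q, _ | ⟨r, L⟩⟩⟩
  · exact map_zero _
  · exact map_zero _
  · exact map_zero _
  · simp only [genW, List.map_cons, polyRep_mul, polyRep_genV, det3, polyRep_sub, polyRep_cv,
      polyRep_uv]

lemma polyRep_gen {n : ℕ} (σ : Perm (Fin n)) (e : ℕ) (L : List ℕ) :
    polyRep n σ (gen e L) = gen e (L.map (extendPerm n σ)) := by
  unfold gen
  split_ifs
  · exact polyRep_genV σ L
  · exact polyRep_genW σ L

/-- Sₙ permutes the generators `gen e L'` transitively, so any one of them generates their span as a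
ℤSₙ-module. -/
lemma zsmul_mem_span_gen {n e i : ℕ} {L : List ℕ} (hL : L.Nodup) (hlen : L.length = 2 * i + e)
    (h : ∀ x ∈ L, x < n) (N : ℤ) {G : Poly ℕ} (hG : G ∈ genSpan (Finset.range n) e i) :
    N • (polyRep n).asModuleEquiv.symm G ∈
      Submodule.span (ZS n) {N • (polyRep n).asModuleEquiv.symm (gen e L)} := by
  induction hG using Submodule.span_induction with
  | mem x hx =>
    obtain ⟨L', h1, h2, h3, rfl⟩ := hx
    obtain ⟨σ, rfl⟩ := exists_perm_map_eq hL h1 (hlen.trans h2.symm) h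
      (fun x hx => Finset.mem_range.1 (h3 x hx))
    rw [← polyRep_gen, Representation.asModuleEquiv_symm_map_rho, smul_comm]
    exact Submodule.smul_mem _ _ (Submodule.mem_span_singleton_self _)
  | zero => rw [map_zero, smul_zero]; exact zero_mem _
  | add x y _ _ hx hy => rw [map_add, smul_add]; exact add_mem hx hy
  | smul a x _ hx =>
    rw [map_smul, smul_comm]
    exact zsmul_mem hx a

end IntPI

namespace IntPI
open MvPolynomial IntPI.Poly

/-! ### Linear maps on the free ring -/

/-- The letters of a word. -/
def letters (w : FreeSemigroup ℕ) : List ℕ := w.head :: w.tail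

lemma letters_of (i : ℕ) : letters (FreeSemigroup.of i) = [i] := rfl

lemma letters_of_mul (i : ℕ) (w : FreeSemigroup ℕ) :
    letters (FreeSemigroup.of i * w) = i :: letters w := rfl

/-- The linear map on the free ring with given values on the words. -/
def wordLift {A : Type*} [AddCommGroup A] (g : FreeSemigroup ℕ → A) : FreeRing →ₗ[ℤ] A :=
  Finsupp.linearCombination ℤ g ∘ₗ (MonoidAlgebra.coeffLinearEquiv ℤ).toLinearMap

lemma wordLift_single {A : Type*} [AddCommGroup A] (g : FreeSemigroup ℕ → A)
    (w : FreeSemigroup ℕ) (z : ℤ) : wordLift g (MonoidAlgebra.single w z) = z • g w := by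
  change Finsupp.linearCombination ℤ g (MonoidAlgebra.single w z).coeff = _
  rw [MonoidAlgebra.coeff_single, Finsupp.linearCombination_single]

lemma permRep_single {n : ℕ} (σ : Perm (Fin n)) (w : FreeSemigroup ℕ) (z : ℤ) :
    permRep n σ (MonoidAlgebra.single w z) =
      MonoidAlgebra.single (FreeSemigroup.map (extendPerm n σ) w) z :=
  MonoidAlgebra.mapDomain_single

/-- The sum of the coefficients. -/
def augmentation : FreeRing →ₗ[ℤ] ℤ := wordLift fun _ => 1

lemma augmentation_permRep {n : ℕ} (σ : Perm (Fin n)) (f : FreeRing) :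
    augmentation (permRep n σ f) = augmentation f := by
  induction f using MonoidAlgebra.induction_linear with
  | zero => simp
  | add f g hf hg => rw [map_add, map_add, map_add, hf, hg]
  | single w z => rw [permRep_single, augmentation, wordLift_single, wordLift_single]

/-- The upper right entry of the product of the matrices with rows `(1 + c i, u i)`, `(0, 1)`. -/
def listPoly : List ℕ → Poly ℕ
  | [] => 0
  | i :: l => uv i + (1 + cv i) * listPoly l

/-- The upper right entry of the value at the matrices with rows `(1 + c i, u i)`, `(0, 1)`. -/
def toPoly : FreeRing →ₗ[ℤ] Poly ℕ := wordLift fun w => listPoly (letters w)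

lemma toPoly_single (w : FreeSemigroup ℕ) :
    toPoly (MonoidAlgebra.single w 1) = listPoly (letters w) := by
  rw [toPoly, wordLift_single, one_smul]

lemma polyRep_listPoly {n : ℕ} (σ : Perm (Fin n)) (l : List ℕ) :
    polyRep n σ (listPoly l) = listPoly (l.map (extendPerm n σ)) := by
  induction l with
  | nil => exact map_zero _
  | cons i l ih =>
    rw [List.map_cons, listPoly, listPoly, map_add, polyRep_mul, ih, map_add, polyRep_one,
      polyRep_cv, polyRep_uv]

lemma toPoly_permRep {n : ℕ} (σ : Perm (Fin n)) (f : FreeRing) :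
    toPoly (permRep n σ f) = polyRep n σ (toPoly f) := by
  induction f using MonoidAlgebra.induction_linear with
  | zero => simp
  | add f g hf hg => rw [map_add, map_add, map_add, map_add, hf, hg]
  | single w z =>
    rw [permRep_single, toPoly, wordLift_single, wordLift_single, map_zsmul, polyRep_listPoly,
      letters, map_head_tail]
    rfl

/-! ### Multilinear words -/

lemma mem_multilinearWords_iff {n : ℕ} {w : FreeSemigroup ℕ} :
    w ∈ multilinearWords n ↔ (letters w).Nodup ∧ (letters w).toFinset = Finset.range n := by
  constructor
  · rintro ⟨σ, hσ⟩
    rw [letters, hσ]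
    constructor
    · rw [List.nodup_ofFn]
      exact Fin.val_injective.comp σ.injective
    · ext i
      rw [List.mem_toFinset, List.mem_ofFn, Finset.mem_range]
      constructor
      · rintro ⟨j, rfl⟩
        exact (σ j).2
      · intro hi
        exact ⟨σ⁻¹ ⟨i, hi⟩, by simp⟩
  · rintro ⟨h1, h2⟩
    have h3 : (List.ofFn fun i : Fin n => (i : ℕ)).Nodup := List.nodup_ofFn.2 Fin.val_injective
    have h4 : (letters w).length = n := by
      rw [← List.toFinset_card_of_nodup h1, h2, Finset.card_range]
    obtain ⟨σ, hσ⟩ := exists_perm_map_eq h3 h1 (by rw [h4, List.length_ofFn])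
      (n := n) (by simp) (fun x hx => by
        rw [← Finset.mem_range, ← h2]; simpa using hx)
    refine ⟨σ, hσ.symm.trans ?_⟩
    rw [List.map_ofFn]
    congr 1
    funext i
    exact extendPerm_apply σ i

lemma multilinear_induction {n : ℕ} {p : FreeRing → Prop}
    (single : ∀ w, (letters w).Nodup → (letters w).toFinset = Finset.range n →
      p (MonoidAlgebra.single w 1)) (zero : p 0) (add : ∀ f g, p f → p g → p (f + g))
    (smul : ∀ (z : ℤ) f, p f → p (z • f)) {f : FreeRing}
    (hf : f ∈ (multilinear n).toSubmodule) : p f := by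
  change f ∈ Submodule.span ℤ (multilinearMonomials n) at hf
  induction hf using Submodule.span_induction with
  | mem x hx =>
    obtain ⟨w, hw, rfl⟩ := hx
    rw [mem_multilinearWords_iff] at hw
    exact single w hw.1 hw.2
  | zero => exact zero
  | add x y _ _ hx hy => exact add x y hx hy
  | smul a x _ hx => exact smul a x hx

/-! ### Pair coefficients and the generic upper right entry -/

/-- The pairs (set of the letters in front of `k`, `k`), for all letters `k` of a word. -/
def prefixPairs : List ℕ → List (Finset ℕ × ℕ)
  | [] => []
  | i :: l => (∅, i) :: (prefixPairs l).map fun x => (insert i x.1, x.2)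

lemma mem_prefixPairs {l : List ℕ} (hl : l.Nodup) {x : Finset ℕ × ℕ} (hx : x ∈ prefixPairs l) :
    x.1 ⊆ l.toFinset ∧ x.2 ∈ l ∧ x.2 ∉ x.1 := by
  induction l generalizing x with
  | nil => simp [prefixPairs] at hx
  | cons i l ih =>
    rw [List.nodup_cons] at hl
    rw [prefixPairs, List.mem_cons, List.mem_map] at hx
    rcases hx with rfl | ⟨y, hy, rfl⟩
    · simp
    · obtain ⟨h1, h2, h3⟩ := ih hl.2 hy
      refine ⟨?_, List.mem_cons_of_mem _ h2, ?_⟩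
      · rw [List.toFinset_cons]; exact Finset.insert_subset_insert _ h1
      · rw [Finset.mem_insert, not_or]
        exact ⟨fun h => hl.1 (h ▸ h2), h3⟩

/-- The coefficients of the upper right entry of the value at generic matrices. -/
def prefixCoeff : FreeRing →ₗ[ℤ] (Finset ℕ × ℕ →₀ ℤ) :=
  wordLift fun w => ((prefixPairs (letters w)).map fun x => Finsupp.single x 1).sum

lemma prefixCoeff_single (w : FreeSemigroup ℕ) : prefixCoeff (MonoidAlgebra.single w 1) =
    ((prefixPairs (letters w)).map fun x => Finsupp.single x 1).sum := by
  rw [prefixCoeff, wordLift_single, one_smul]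

/-- The pairs that occur for multilinear words. -/
def pairSet (n : ℕ) : Set (Finset ℕ × ℕ) :=
  {x | x.1 ⊆ Finset.range n ∧ x.2 ∈ Finset.range n ∧ x.2 ∉ x.1}

lemma prefixCoeff_mem {n : ℕ} {f : FreeRing} (hf : f ∈ (multilinear n).toSubmodule) :
    prefixCoeff f ∈ Finsupp.supported ℤ ℤ (pairSet n) := by
  refine multilinear_induction (p := fun f => prefixCoeff f ∈ Finsupp.supported ℤ ℤ (pairSet n))
    (fun w h1 h2 => ?_) ?_ (fun f g hf hg => ?_)
    (fun z f hf => ?_) hf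
  · rw [prefixCoeff_single]
    refine list_sum_mem fun x hx => ?_
    obtain ⟨y, hy, rfl⟩ := List.mem_map.1 hx
    obtain ⟨h3, h4, h5⟩ := mem_prefixPairs h1 hy
    refine Finsupp.single_mem_supported ℤ _ ⟨h2 ▸ h3, ?_, h5⟩
    rw [← h2]; simpa using h4
  · rw [map_zero]
    exact zero_mem _
  · rw [map_add]
    exact add_mem hf hg
  · rw [map_smul]
    exact Submodule.smul_mem _ _ hf

/-- The polynomial that belongs to a pair. -/
def pairPoly (x : Finset ℕ × ℕ) : Poly ℕ := uv x.2 * ∏ i ∈ x.1, (1 + cv i)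

lemma listPoly_eq_sum {l : List ℕ} (hl : l.Nodup) :
    listPoly l = ((prefixPairs l).map pairPoly).sum := by
  induction l with
  | nil => rfl
  | cons i l ih =>
    rw [List.nodup_cons] at hl
    rw [listPoly, prefixPairs, List.map_cons, List.sum_cons, ih hl.2, List.map_map,
      ← List.sum_map_mul_left]
    congr 1
    · simp [pairPoly]
    · congr 1
      refine List.map_congr_left fun x hx => ?_
      have h : i ∉ x.1 := fun h => hl.1 (by simpa using (mem_prefixPairs hl.2 hx).1 h)
      simp only [pairPoly, Function.comp_apply, Finset.prod_insert h]
      ring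

lemma linearCombination_list_sum {A : Type*} [AddCommGroup A] (g : Finset ℕ × ℕ → A)
    (l : List (Finset ℕ × ℕ)) :
    Finsupp.linearCombination ℤ g (l.map fun x => Finsupp.single x 1).sum = (l.map g).sum := by
  rw [map_list_sum, List.map_map]
  congr 1
  exact List.map_congr_left fun x _ => by simp

lemma toPoly_eq {n : ℕ} {f : FreeRing} (hf : f ∈ (multilinear n).toSubmodule) :
    toPoly f = Finsupp.linearCombination ℤ pairPoly (prefixCoeff f) := by
  refine multilinear_induction (p := fun f =>
      toPoly f = Finsupp.linearCombination ℤ pairPoly (prefixCoeff f))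
    (fun w h1 h2 => ?_) ?_ (fun f g hf hg => ?_)
    (fun z f hf => ?_) hf
  · rw [toPoly_single, prefixCoeff_single, linearCombination_list_sum, listPoly_eq_sum h1]
  · simp
  · rw [map_add, map_add, map_add, hf, hg]
  · rw [map_smul, map_smul, map_smul, hf]

/-- The substitution c_i ↦ c_i - 1 turns these polynomials into distinct monomials. -/
lemma linearIndependent_pairPoly : LinearIndependent ℤ pairPoly := by
  let φ : Poly ℕ →ₐ[ℤ] Poly ℕ := aeval (Sum.elim (fun i => cv i - 1) uv)
  refine LinearIndependent.of_comp φ.toLinearMap ?_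
  have h : φ.toLinearMap ∘ pairPoly = (basisMonomials (ℕ ⊕ ℕ) ℤ) ∘
      fun x : Finset ℕ × ℕ => Finsupp.single (Sum.inr x.2) 1 + cexp x.1 := by
    funext x
    have h1 (i : ℕ) : φ (cv i) = cv i - 1 := by simp [φ, cv]
    have h2 (i : ℕ) : φ (uv i) = uv i := by simp [φ, uv]
    rw [Function.comp_apply, Function.comp_apply, coe_basisMonomials]
    change φ (pairPoly x) = monomial (Finsupp.single (Sum.inr x.2) 1 + cexp x.1) 1
    rw [← uv_mul_cmon_eq_monomial, pairPoly, map_mul, map_prod, h2, cmon]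
    congr 1
    refine Finset.prod_congr rfl fun i _ => ?_
    rw [map_add, h1, map_one]; ring
  rw [h]
  refine (basisMonomials (ℕ ⊕ ℕ) ℤ).linearIndependent.comp _ fun x y hxy => ?_
  obtain ⟨h1, h2⟩ := uv_mul_cmon_exp_injective hxy
  exact Prod.ext h2 h1

lemma prefixCoeff_eq_zero {n : ℕ} {f : FreeRing} (hf : f ∈ (multilinear n).toSubmodule)
    (h : toPoly f = 0) : prefixCoeff f = 0 := by
  rw [toPoly_eq hf] at h
  exact (linearIndependent_iff.1 linearIndependent_pairPoly) _ h

lemma pairPoly_mem {n : ℕ} {x : Finset ℕ × ℕ} (hx : x ∈ pairSet n) :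
    pairPoly x ∈ Wt (Finset.range n) := by
  obtain ⟨h1, h2, h3⟩ := hx
  rw [pairPoly, Finset.prod_one_add, Finset.mul_sum]
  refine sum_mem fun B hB => ?_
  rw [Finset.mem_powerset] at hB
  exact W_le_Wt (uv_mul_cmon_mem_W h2 (hB.trans h1) fun h => h3 (hB h))

lemma linearCombination_pairPoly_mem {n : ℕ} {c : Finset ℕ × ℕ →₀ ℤ}
    (hc : c ∈ Finsupp.supported ℤ ℤ (pairSet n)) :
    Finsupp.linearCombination ℤ pairPoly c ∈ Wt (Finset.range n) := by
  rw [Finsupp.linearCombination_apply]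
  exact sum_mem fun x hx => Submodule.smul_mem _ _ (pairPoly_mem (hc hx))

lemma toPoly_mem {n : ℕ} {f : FreeRing} (hf : f ∈ (multilinear n).toSubmodule) :
    toPoly f ∈ Wt (Finset.range n) := by
  rw [toPoly_eq hf]
  exact linearCombination_pairPoly_mem (prefixCoeff_mem hf)

/-! ### The image of the multilinear polynomials with coefficient sum zero -/

lemma Eu_listPoly (l : List ℕ) :
    Eu (listPoly l) = (l.map fun i => 1 + cv i).prod - 1 := by
  induction l with
  | nil => simp [listPoly]
  | cons i l ih =>
    rw [listPoly, map_add, Derivation.leibniz, ih]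
    simp
    ring

/-- On words `Eu` replaces u_i by c_i, and the sum telescopes to ∏ (1 + c_i) - 1. This is the same
for all multilinear words, so only the coefficient sum survives. -/
lemma Eu_toPoly {n : ℕ} {f : FreeRing} (hf : f ∈ (multilinear n).toSubmodule) :
    Eu (toPoly f) = augmentation f • (∏ i ∈ Finset.range n, (1 + cv i) - 1) := by
  refine multilinear_induction (p := fun f =>
      Eu (toPoly f) = augmentation f • (∏ i ∈ Finset.range n, (1 + cv i) - 1))
    (fun w h1 h2 => ?_) ?_ (fun f g hf hg => ?_)
    (fun z f hf => ?_) hf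
  · rw [toPoly_single, Eu_listPoly, augmentation, wordLift_single, one_smul, one_smul, ← h2,
      List.prod_toFinset _ h1]
  · simp
  · rw [map_add, map_add, map_add, hf, hg, add_smul]
  · rw [map_smul, Derivation.map_smul, map_smul, hf, smul_assoc]

lemma listPoly_append (l l' : List ℕ) :
    listPoly (l ++ l') = listPoly l + (l.map fun i => 1 + cv i).prod * listPoly l' := by
  induction l with
  | nil => simp [listPoly]
  | cons i l ih => rw [List.cons_append, listPoly, listPoly, ih]; simp; ring

lemma exists_single_of_list {n : ℕ} {l : List ℕ} (h0 : l ≠ []) (h1 : l.Nodup)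
    (h2 : l.toFinset = Finset.range n) :
    ∃ f ∈ (multilinear n).toSubmodule, augmentation f = 1 ∧ toPoly f = listPoly l := by
  rcases l with _ | ⟨i, l⟩
  · exact absurd rfl h0
  refine ⟨MonoidAlgebra.single ⟨i, l⟩ 1, Submodule.subset_span ⟨⟨i, l⟩, ?_, rfl⟩, ?_, ?_⟩
  · exact mem_multilinearWords_iff.2 ⟨h1, h2⟩
  · rw [augmentation, wordLift_single, one_smul]
  · exact toPoly_single _

/-- The multilinear polynomials with coefficient sum `0`. -/
def augmentationKer (n : ℕ) : Submodule ℤ FreeRing :=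
  (multilinear n).toSubmodule ⊓ LinearMap.ker augmentation

/-- Take the difference of two words that agree except for the order of the adjacent letters k, l,
with B in front. The prefix contributes ∏ (1 + c_i) and the common tail cancels. -/
lemma mem_map_of_list {n k l : ℕ} (hkl : k ≠ l) (hk : k ∈ Finset.range n)
    (hl : l ∈ Finset.range n) {B : Finset ℕ} (hB : B ⊆ ((Finset.range n).erase k).erase l) :
    (cv k * uv l - cv l * uv k) * ∏ i ∈ B, (1 + cv i) ∈ (augmentationKer n).map toPoly := by
  have hkB : k ∉ B := fun h => by simpa using hB h
  have hlB : l ∉ B := fun h => by simpa using hB h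
  set r := (((Finset.range n).erase k).erase l \ B).toList with hr
  have hmem (x) : x ∈ r ↔ x < n ∧ x ≠ k ∧ x ≠ l ∧ x ∉ B := by
    simp [hr]; tauto
  have hB' : ∀ x ∈ B, x < n := fun x hx => by
    have := hB hx; simp at this; exact this.2.2
  have hnd (x y) (hx : x = k ∧ y = l ∨ x = l ∧ y = k) :
      (B.toList ++ x :: y :: r).Nodup ∧
        (B.toList ++ x :: y :: r).toFinset = Finset.range n := by
    rw [Finset.mem_range] at hk hl
    constructor
    · rw [List.nodup_append]
      refine ⟨B.nodup_toList, ?_, ?_⟩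
      · rw [List.nodup_cons, List.nodup_cons]
        refine ⟨?_, ?_, Finset.nodup_toList _⟩
        · rw [List.mem_cons, hmem]; grind
        · rw [hmem]; grind
      · intro a ha b hb
        rw [Finset.mem_toList] at ha
        rw [List.mem_cons, List.mem_cons, hmem] at hb
        grind
    · ext a
      rw [List.mem_toFinset, List.mem_append, List.mem_cons, List.mem_cons, hmem,
        Finset.mem_toList, Finset.mem_range]
      grind
  obtain ⟨h1, h2⟩ := hnd k l (.inl ⟨rfl, rfl⟩)
  obtain ⟨h3, h4⟩ := hnd l k (.inr ⟨rfl, rfl⟩)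
  obtain ⟨f, hf, hf1, hf2⟩ := exists_single_of_list (by simp) h1 h2
  obtain ⟨g, hg, hg1, hg2⟩ := exists_single_of_list (by simp) h3 h4
  refine ⟨f - g, ⟨sub_mem hf hg, ?_⟩, ?_⟩
  · rw [SetLike.mem_coe, LinearMap.mem_ker, map_sub, hf1, hg1, sub_self]
  · rw [map_sub, hf2, hg2, listPoly_append, listPoly_append, Finset.prod_map_toList]
    simp only [listPoly]
    ring

/-- One inclusion is `Eu_toPoly`. For the other, the kernel of `Eu` is spanned by cycles, which come
from differences of words. -/
lemma map_augmentationKer (n : ℕ) {F : Poly ℕ} :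
    F ∈ (augmentationKer n).map toPoly ↔ F ∈ Wt (Finset.range n) ∧ Eu F = 0 := by
  constructor
  · rintro ⟨f, ⟨hf, hf0⟩, rfl⟩
    refine ⟨toPoly_mem hf, ?_⟩
    rw [Eu_toPoly hf, LinearMap.mem_ker.1 hf0, zero_smul]
  · rintro ⟨hF, h⟩
    refine (Submodule.span_le.2 ?_) (mem_cycles_of_mem_Wt hF h)
    rintro _ ⟨k, hk, l, hl, hkl, B, hB, rfl⟩
    -- Words produce products of 1 + c_i; expanding c_i = (1 + c_i) - 1 reduces cycles to these.
    have e : cmon B = ∑ t ∈ B.powerset, ((-1 : ℤ) ^ (B \ t).card) • ∏ i ∈ t, (1 + cv i) := by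
      have h (i : ℕ) : (cv i : Poly ℕ) = (1 + cv i) + (-1) := by ring
      rw [cmon, Finset.prod_congr rfl fun i _ => h i, Finset.prod_add]
      refine Finset.sum_congr rfl fun t _ => ?_
      rw [Finset.prod_const, zsmul_eq_mul]
      push_cast
      ring
    rw [e, Finset.mul_sum]
    refine sum_mem fun t ht => ?_
    rw [mul_smul_comm]
    exact Submodule.smul_mem _ _
      (mem_map_of_list hkl hk hl ((Finset.mem_powerset.1 ht).trans hB))

end IntPI

namespace IntPI
open MvPolynomial IntPI.Poly

/-! ### Identities of upper triangular matrices -/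

/-- A subgroup of ℤ consists of the multiples of its least positive element. For the zero subgroup
`sInf ∅ = 0` is the intended convention. -/
lemma sInf_dvd_iff (H : AddSubgroup ℤ) (z : ℤ) :
    ((sInf {k : ℕ | 0 < k ∧ (k : ℤ) ∈ H} : ℕ) : ℤ) ∣ z ↔ z ∈ H := by
  set S := {k : ℕ | 0 < k ∧ (k : ℤ) ∈ H} with hS
  rcases S.eq_empty_or_nonempty with h | h
  · rw [h, Nat.sInf_empty, Nat.cast_zero, zero_dvd_iff]
    constructor
    · rintro rfl; exact zero_mem H
    · intro hz
      by_contra h0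
      have : z.natAbs ∈ S := by
        refine ⟨Int.natAbs_pos.2 h0, ?_⟩
        rcases Int.natAbs_eq z with e | e
        · rwa [← e]
        · rw [← neg_mem_iff, ← e]; exact hz
      rw [h] at this
      exact this
  · obtain ⟨h1, h2⟩ := Nat.sInf_mem h
    constructor
    · rintro ⟨k, rfl⟩
      rw [mul_comm, ← smul_eq_mul]
      exact zsmul_mem h2 k
    · intro hz
      set d := sInf S
      have h3 : z % d ∈ H := by
        rw [Int.emod_def]
        refine sub_mem hz ?_
        rw [mul_comm, ← smul_eq_mul]
        exact zsmul_mem h2 _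
      have h4 : 0 ≤ z % d := Int.emod_nonneg _ (by omega)
      have h5 : z % d < d := Int.emod_lt_of_pos _ (by omega)
      refine Int.dvd_of_emod_eq_zero ?_
      by_contra h6
      have : (z % d).toNat ∈ S := ⟨by omega, by rwa [Int.toNat_of_nonneg h4]⟩
      have := Nat.sInf_le this
      omega

section
variable {R₁ R₂ M : Type*} [CommRing R₁] [CommRing R₂] [AddCommGroup M]

lemma ringExponent_dvd {z : ℤ} :
    (ringExponent R₁ R₂ : ℤ) ∣ z ↔ (∀ a : R₁, z • a = 0) ∧ ∀ a : R₂, z • a = 0 := by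
  let H : AddSubgroup ℤ :=
    { carrier := {z | (∀ a : R₁, z • a = 0) ∧ ∀ a : R₂, z • a = 0}
      add_mem' := fun h h' => ⟨fun a => by rw [add_smul, h.1, h'.1, add_zero],
        fun a => by rw [add_smul, h.2, h'.2, add_zero]⟩
      zero_mem' := ⟨fun a => zero_smul _ a, fun a => zero_smul _ a⟩
      neg_mem' := fun h => ⟨fun a => by rw [neg_smul, h.1, neg_zero],
        fun a => by rw [neg_smul, h.2, neg_zero]⟩ }
  have e : ringExponent R₁ R₂ = sInf {k : ℕ | 0 < k ∧ (k : ℤ) ∈ H} := by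
    rw [ringExponent]
    congr 1
    ext k
    change _ ↔ 0 < k ∧ (∀ a : R₁, (k : ℤ) • a = 0) ∧ ∀ a : R₂, (k : ℤ) • a = 0
    simp only [natCast_zsmul]
    rfl
  rw [e, sInf_dvd_iff]
  rfl

lemma moduleExponent_dvd {z : ℤ} : (moduleExponent M : ℤ) ∣ z ↔ ∀ a : M, z • a = 0 := by
  let H : AddSubgroup ℤ :=
    { carrier := {z | ∀ a : M, z • a = 0}
      add_mem' := fun h h' a => by rw [add_smul, h a, h' a, add_zero]
      zero_mem' := fun a => zero_smul _ a
      neg_mem' := fun h a => by rw [neg_smul, h a, neg_zero] }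
  have e : moduleExponent M = sInf {k : ℕ | 0 < k ∧ (k : ℤ) ∈ H} := by
    rw [moduleExponent]
    congr 1
    ext k
    change _ ↔ 0 < k ∧ ∀ a : M, (k : ℤ) • a = 0
    simp only [natCast_zsmul]
    rfl
  rw [e, sInf_dvd_iff]
  rfl

variable [Module R₁ M] [Module R₂ᵐᵒᵖ M]

namespace UpperTriangular

/-- The upper right entry of a product of matrices. -/
def listU (x : ℕ → UpperTriangular R₁ M R₂) : List ℕ → M
  | [] => 0
  | i :: l => (x i).a • listU x l + MulOpposite.op (l.map fun i => (x i).b).prod • (x i).u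

end UpperTriangular
open UpperTriangular

/-- The contribution of a pair to the upper right entry. -/
def pairValue (n : ℕ) (x : ℕ → UpperTriangular R₁ M R₂) (y : Finset ℕ × ℕ) : M :=
  (∏ i ∈ y.1, (x i).a) •
    MulOpposite.op (∏ i ∈ Finset.range n \ insert y.2 y.1, (x i).b) • (x y.2).u

lemma listU_eq_sum (x : ℕ → UpperTriangular R₁ M R₂) {l : List ℕ} (hl : l.Nodup) :
    listU x l = ((prefixPairs l).map fun y => (∏ i ∈ y.1, (x i).a) •
      MulOpposite.op (∏ i ∈ l.toFinset \ insert y.2 y.1, (x i).b) • (x y.2).u).sum := by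
  induction l with
  | nil => rfl
  | cons i l ih =>
    rw [List.nodup_cons] at hl
    rw [listU, prefixPairs, List.map_cons, List.sum_cons, ih hl.2, List.map_map, List.smul_sum,
      List.map_map, add_comm]
    congr 1
    · have h1 : (i :: l).toFinset \ insert i ∅ = l.toFinset := by
        ext a
        have : a ∈ l → a ≠ i := fun h e => hl.1 (e ▸ h)
        simp
        tauto
      simp only [h1, Finset.prod_empty, one_smul]
      rw [List.prod_toFinset _ hl.2]
    · congr 1
      refine List.map_congr_left fun y hy => ?_
      have hi : i ∉ y.1 := fun h => hl.1 (by simpa using (mem_prefixPairs hl.2 hy).1 h)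
      have h1 : (i :: l).toFinset \ insert y.2 (insert i y.1) = l.toFinset \ insert y.2 y.1 := by
        ext a
        have : a ∈ l → a ≠ i := fun h e => hl.1 (e ▸ h)
        simp
        tauto
      simp only [Function.comp_apply, h1, Finset.prod_insert hi, mul_smul]

variable [SMulCommClass R₁ R₂ᵐᵒᵖ M]

namespace UpperTriangular

/-- The upper right entry as an additive map. -/
def uHom : UpperTriangular R₁ M R₂ →+ M where
  toFun x := x.u
  map_zero' := rfl
  map_add' _ _ := rfl

/-- The diagonal entries as an additive map. -/
def diagHom : UpperTriangular R₁ M R₂ →+ R₁ × R₂ where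
  toFun x := (x.a, x.b)
  map_zero' := rfl
  map_add' _ _ := rfl

end UpperTriangular

/-- The value of `ψ` at the `i`-th variable. -/
def varValue (ψ : FreeRing →ₙ+* UpperTriangular R₁ M R₂) (i : ℕ) : UpperTriangular R₁ M R₂ :=
  ψ (MonoidAlgebra.single (FreeSemigroup.of i) 1)

lemma map_single_word (ψ : FreeRing →ₙ+* UpperTriangular R₁ M R₂) (w : FreeSemigroup ℕ) :
    ψ (MonoidAlgebra.single w 1) =
      ⟨((letters w).map fun i => (varValue ψ i).a).prod, listU (varValue ψ) (letters w),
        ((letters w).map fun i => (varValue ψ i).b).prod⟩ := by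
  induction w using FreeSemigroup.recOnMul with
  | ih1 i =>
    rw [letters_of]
    ext <;> simp [listU, varValue]
  | ih2 i w _ hw =>
    have h : (MonoidAlgebra.single (FreeSemigroup.of i * w) 1 : FreeRing) =
        MonoidAlgebra.single (FreeSemigroup.of i) 1 * MonoidAlgebra.single w 1 := by
      rw [MonoidAlgebra.single_mul_single, one_mul]
    rw [h, map_mul, hw, letters_of_mul]
    ext <;> simp [listU, varValue]

lemma uHom_apply_eq {n : ℕ} (ψ : FreeRing →ₙ+* UpperTriangular R₁ M R₂) {f : FreeRing}
    (hf : f ∈ (multilinear n).toSubmodule) :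
    uHom (ψ f) = Finsupp.linearCombination ℤ (pairValue n (varValue ψ)) (prefixCoeff f) := by
  refine multilinear_induction (p := fun f => uHom (ψ f) =
    Finsupp.linearCombination ℤ (pairValue n (varValue ψ)) (prefixCoeff f))
    (fun w h1 h2 => ?_) ?_ (fun f g hf hg => ?_) (fun z f hf => ?_) hf
  · rw [prefixCoeff_single, linearCombination_list_sum, map_single_word]
    refine (listU_eq_sum _ h1).trans ?_
    rw [h2]; rfl
  · simp
  · rw [map_add, map_add, map_add, map_add, hf, hg]
  · rw [map_zsmul, map_zsmul, map_smul, map_smul, hf]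

lemma diagHom_apply_eq {n : ℕ} (ψ : FreeRing →ₙ+* UpperTriangular R₁ M R₂) {f : FreeRing}
    (hf : f ∈ (multilinear n).toSubmodule) :
    diagHom (ψ f) = augmentation f •
      (∏ i ∈ Finset.range n, (varValue ψ i).a, ∏ i ∈ Finset.range n, (varValue ψ i).b) := by
  refine multilinear_induction (p := fun f => diagHom (ψ f) = augmentation f •
      (∏ i ∈ Finset.range n, (varValue ψ i).a, ∏ i ∈ Finset.range n, (varValue ψ i).b))
    (fun w h1 h2 => ?_) ?_ (fun f g hf hg => ?_) (fun z f hf => ?_) hf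
  · rw [augmentation, wordLift_single, one_smul, one_smul, map_single_word, ← h2,
      List.prod_toFinset _ h1, List.prod_toFinset _ h1]
    rfl
  · simp
  · rw [map_add, map_add, map_add, hf, hg, add_smul]
  · rw [map_zsmul, map_zsmul, map_smul, hf, smul_assoc]

lemma UpperTriangular.eq_zero_iff {x : UpperTriangular R₁ M R₂} :
    x = 0 ↔ diagHom x = 0 ∧ uHom x = 0 := by
  constructor
  · rintro rfl; simp
  · rintro ⟨h1, h2⟩
    ext
    · exact congrArg Prod.fst h1
    · exact h2
    · exact congrArg Prod.snd h1

lemma exists_varValue (x : ℕ → UpperTriangular R₁ M R₂) :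
    ∃ ψ : FreeRing →ₙ+* UpperTriangular R₁ M R₂, varValue ψ = x := by
  let φ := MonoidAlgebra.liftMagma ℤ (FreeSemigroup.lift x)
  refine ⟨(φ : FreeRing →ₙ+* UpperTriangular R₁ M R₂), funext fun i => ?_⟩
  change φ (MonoidAlgebra.single (FreeSemigroup.of i) 1) = x i
  simp [φ]

variable (R₁ R₂ M)

lemma isPolynomialIdentity_of_toPoly_eq_zero {n : ℕ} {f : FreeRing}
    (hf : f ∈ (multilinear n).toSubmodule) (h0 : augmentation f = 0) (h : toPoly f = 0) :
    IsPolynomialIdentity (UpperTriangular R₁ M R₂) f := by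
  intro ψ
  rw [UpperTriangular.eq_zero_iff, diagHom_apply_eq ψ hf, uHom_apply_eq ψ hf, h0,
    prefixCoeff_eq_zero hf h]
  simp

lemma isPolynomialIdentity_smul {n : ℕ} {f : FreeRing} (hf : f ∈ (multilinear n).toSubmodule)
    (h0 : augmentation f = 0) {z : ℤ} (hz : (moduleExponent M : ℤ) ∣ z) :
    IsPolynomialIdentity (UpperTriangular R₁ M R₂) (z • f) := by
  intro ψ
  rw [UpperTriangular.eq_zero_iff, map_zsmul, map_zsmul, map_zsmul, diagHom_apply_eq ψ hf, h0,
    moduleExponent_dvd.1 hz]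
  simp

/-- A substitution adapted to y makes every other pair vanish, and the upper right entry becomes the
coefficient at y times an arbitrary v ∈ M. -/
lemma dvd_prefixCoeff {n : ℕ} {f : FreeRing} (hf : f ∈ (multilinear n).toSubmodule)
    (h : IsPolynomialIdentity (UpperTriangular R₁ M R₂) f) (y : Finset ℕ × ℕ) :
    (moduleExponent M : ℤ) ∣ prefixCoeff f y := by
  have hc := prefixCoeff_mem hf
  by_cases hy : y ∈ (prefixCoeff f).support
  swap
  · rw [Finsupp.notMem_support_iff.1 hy]; exact dvd_zero _
  rw [moduleExponent_dvd]
  intro v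
  -- The letters in y.1 become the first diagonal idempotent, y.2 becomes v in the corner, and all
  -- others become the second idempotent.
  obtain ⟨ψ, hψ⟩ := exists_varValue (R₁ := R₁) (R₂ := R₂) fun i =>
    ⟨if i ∈ y.1 then 1 else 0, if i = y.2 then v else 0, if i ∈ insert y.2 y.1 then 0 else 1⟩
  have h1 := uHom_apply_eq ψ hf
  rw [h ψ, map_zero, Finsupp.linearCombination_apply, Finsupp.sum, Finset.sum_eq_single y] at h1
  · rw [hψ] at h1
    simp only [pairValue] at h1
    rw [Finset.prod_congr rfl fun i hi => if_pos hi, Finset.prod_congr rfl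
      fun i hi => if_neg (Finset.mem_sdiff.1 hi).2] at h1
    simpa using h1.symm
  · intro x hx hxy
    obtain ⟨hx1, hx2, hx3⟩ := hc hx
    obtain ⟨hy1, hy2, hy3⟩ := hc hy
    have : pairValue n (varValue ψ) x = 0 := by
      rw [hψ, pairValue]
      by_cases e1 : x.2 = y.2
      swap
      · simp [e1]
      by_cases e2 : x.1 ⊆ y.1
      swap
      · obtain ⟨i, hi, hiy⟩ := Finset.not_subset.1 e2
        rw [Finset.prod_eq_zero hi (by simp [hiy]), zero_smul]
      obtain ⟨i, hi, hix⟩ := Finset.not_subset.1 fun e3 => hxy (Prod.ext (e2.antisymm e3) e1)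
      have hix' : i ∈ Finset.range n \ insert x.2 x.1 := by
        rw [Finset.mem_sdiff, Finset.mem_insert, not_or]
        exact ⟨hy1 hi, fun e => hy3 (by rwa [← e1, ← e]), hix⟩
      rw [Finset.prod_eq_zero (s := Finset.range n \ insert x.2 x.1) hix' (by simp [hi]),
        MulOpposite.op_zero, zero_smul, smul_zero]
    rw [this, smul_zero]
  · intro h; exact absurd hy h

/-- For m ≠ 0 the pair coefficients of an identity can be divided by m, and the quotient is still
killed by `Eu`, so it comes from some g. For m = 0 they all vanish. Conversely f - m g has zero pair
coefficients, and m g vanishes since m annihilates M. -/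
lemma isPolynomialIdentity_iff {n : ℕ} {f : FreeRing} (hf : f ∈ augmentationKer n) :
    IsPolynomialIdentity (UpperTriangular R₁ M R₂) f ↔
      ∃ g ∈ augmentationKer n, toPoly f = (moduleExponent M : ℤ) • toPoly g := by
  constructor
  · intro h
    by_cases hm : (moduleExponent M : ℤ) = 0
    · refine ⟨0, zero_mem _, ?_⟩
      have : prefixCoeff f = 0 := by
        ext y
        simpa [hm] using dvd_prefixCoeff R₁ R₂ M hf.1 h y
      rw [toPoly_eq hf.1, this]; simp
    · have hdiv (y) : (moduleExponent M : ℤ) * (prefixCoeff f y / (moduleExponent M : ℤ)) =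
          prefixCoeff f y := Int.mul_ediv_cancel' (dvd_prefixCoeff R₁ R₂ M hf.1 h y)
      set c : Finset ℕ × ℕ →₀ ℤ :=
        (prefixCoeff f).mapRange (fun z => z / (moduleExponent M : ℤ)) (by simp) with hc
      have e : prefixCoeff f = (moduleExponent M : ℤ) • c := by
        ext y
        rw [Finsupp.smul_apply, hc, Finsupp.mapRange_apply, smul_eq_mul, hdiv]
      have hcs : c ∈ Finsupp.supported ℤ ℤ (pairSet n) := by
        have := prefixCoeff_mem hf.1
        rw [Finsupp.mem_supported] at this ⊢
        exact (Finset.coe_subset.2 Finsupp.support_mapRange).trans this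
      have h1 : toPoly f =
          (moduleExponent M : ℤ) • Finsupp.linearCombination ℤ pairPoly c := by
        rw [toPoly_eq hf.1, e, map_smul]
      have h2 : Eu (Finsupp.linearCombination ℤ pairPoly c) = 0 := by
        have := ((map_augmentationKer n).1 ⟨f, hf, rfl⟩).2
        rwa [h1, Derivation.map_smul, zsmul_eq_zero_iff hm] at this
      obtain ⟨g, hg, hg'⟩ := (map_augmentationKer n).2 ⟨linearCombination_pairPoly_mem hcs, h2⟩
      exact ⟨g, hg, by rw [h1, hg']⟩
  · rintro ⟨g, hg, h⟩
    have h1 : IsPolynomialIdentity (UpperTriangular R₁ M R₂)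
        (f - (moduleExponent M : ℤ) • g) := by
      refine isPolynomialIdentity_of_toPoly_eq_zero R₁ R₂ M (n := n)
        (sub_mem hf.1 (Submodule.smul_mem _ _ hg.1)) ?_ ?_
      · rw [map_sub, map_smul, LinearMap.mem_ker.1 hf.2, LinearMap.mem_ker.1 hg.2]; simp
      · rw [map_sub, map_smul, h, sub_self]
    have h2 := isPolynomialIdentity_smul R₁ R₂ M hg.1 (LinearMap.mem_ker.1 hg.2)
      (dvd_refl (moduleExponent M : ℤ))
    intro ψ
    have := h1 ψ
    rwa [map_sub, h2 ψ, sub_zero] at this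

lemma dvd_augmentation {n : ℕ} {f : FreeRing} (hf : f ∈ (multilinear n).toSubmodule)
    (h : IsPolynomialIdentity (UpperTriangular R₁ M R₂) f) :
    (ringExponent R₁ R₂ : ℤ) ∣ augmentation f := by
  obtain ⟨ψ, hψ⟩ := exists_varValue (R₁ := R₁) (R₂ := R₂) (M := M) fun _ => 1
  have h1 := diagHom_apply_eq ψ hf
  rw [h ψ, hψ, map_zero] at h1
  have h2 : augmentation f • (1 : R₁) = 0 := by
    simpa using (congrArg Prod.fst h1).symm
  have h3 : augmentation f • (1 : R₂) = 0 := by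
    simpa using (congrArg Prod.snd h1).symm
  rw [ringExponent_dvd]
  constructor
  · intro a
    rw [← one_mul a, ← smul_mul_assoc, h2, zero_mul]
  · intro a
    rw [← one_mul a, ← smul_mul_assoc, h3, zero_mul]

/-- The module M is unital over R₁, so an integer that annihilates R₁ also annihilates the upper
right entries. -/
lemma isPolynomialIdentity_of_dvd {z : ℤ} (hz : (ringExponent R₁ R₂ : ℤ) ∣ z) (f : FreeRing) :
    IsPolynomialIdentity (UpperTriangular R₁ M R₂) (z • f) := by
  intro ψ
  obtain ⟨h1, h2⟩ := ringExponent_dvd.1 hz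
  rw [UpperTriangular.eq_zero_iff, map_zsmul, map_zsmul, map_zsmul]
  constructor
  · exact Prod.ext (h1 _) (h2 _)
  · rw [← one_smul R₁ (uHom (ψ f)), ← smul_assoc, h1, zero_smul]

end

end IntPI

namespace IntPI
open MvPolynomial IntPI.Poly

/-! ### Chains of submodules defined by iterated kernels -/

section Chain

lemma nonempty_equiv_of_ker_eq {S X Y Z : Type*} [Ring S] [AddCommGroup X] [AddCommGroup Y]
    [AddCommGroup Z] [Module S X] [Module S Y] [Module S Z] (p : X →ₗ[S] Y) (q : X →ₗ[S] Z)
    (hp : Function.Surjective p) (hq : Function.Surjective q) (h : ∀ x, p x = 0 ↔ q x = 0) :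
    Nonempty (Y ≃ₗ[S] Z) := by
  have hk : LinearMap.ker p = LinearMap.ker q := by ext x; exact h x
  exact ⟨(p.quotKerEquivOfSurjective hp).symm.trans
    ((Submodule.quotEquivOfEq _ _ hk).trans (q.quotKerEquivOfSurjective hq))⟩

variable {S P A : Type*} [Ring S] [AddCommGroup P] [AddCommGroup A] [Module S P] [Module S A]

/-- The elements of `K` that are annihilated by the first `k` of the maps `T`. -/
def kernelChain (K : Submodule S P) {N : ℕ} (T : Fin N → (P →ₗ[S] A)) (k : Fin (N + 1)) :
    Submodule S P where
  carrier := {f | f ∈ K ∧ ∀ y : Fin N, y.castSucc < k → T y f = 0}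
  add_mem' hf hg := ⟨add_mem hf.1 hg.1, fun y hy => by
    rw [map_add, hf.2 y hy, hg.2 y hy, add_zero]⟩
  zero_mem' := ⟨zero_mem K, fun y _ => map_zero _⟩
  smul_mem' c f hf := ⟨K.smul_mem c hf.1, fun y hy => by rw [map_smul, hf.2 y hy, smul_zero]⟩

variable {K I : Submodule S P} {N : ℕ} {T : Fin N → (P →ₗ[S] A)}

lemma mem_kernelChain {k : Fin (N + 1)} {f : P} :
    f ∈ kernelChain K T k ↔ f ∈ K ∧ ∀ y : Fin N, y.castSucc < k → T y f = 0 := Iff.rfl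

lemma kernelChain_antitone : Antitone (kernelChain K T) := fun _ _ h _ hf =>
  ⟨hf.1, fun y hy => hf.2 y (hy.trans_le h)⟩

lemma kernelChain_zero : kernelChain K T 0 = K := by
  ext f
  exact ⟨fun h => h.1, fun h => ⟨h, fun y hy => absurd hy (Fin.not_lt_zero _)⟩⟩

lemma mem_kernelChain_succ {x : Fin N} {f : P} :
    f ∈ kernelChain K T x.succ ↔ f ∈ kernelChain K T x.castSucc ∧ T x f = 0 := by
  simp only [mem_kernelChain, Fin.castSucc_lt_succ_iff, Fin.castSucc_lt_castSucc_iff]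
  constructor
  · rintro ⟨h1, h2⟩
    exact ⟨⟨h1, fun y hy => h2 y hy.le⟩, h2 x le_rfl⟩
  · rintro ⟨⟨h1, h2⟩, h3⟩
    refine ⟨h1, fun y hy => ?_⟩
    rcases hy.lt_or_eq with h | rfl
    · exact h2 y h
    · exact h3

/-- The images modulo `I` of the terms of a chain of iterated kernels have the factors `Q / m Q`
if `I` is, in `K`, the set of `f` that agree with an `m`-fold multiple as far as the maps `T`
are concerned. -/
lemma nonempty_factor_equiv {m : ℕ} (hA : ∀ a : A, m ≠ 0 → m • a = 0 → a = 0)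
    (hI : ∀ f ∈ K, f ∈ I → ∃ g ∈ K, ∀ y, T y f = m • T y g) (hmI : ∀ f ∈ K, m • f ∈ I)
    (x : Fin N) {Q : Type*} [AddCommGroup Q] [Module S Q]
    (e : (kernelChain K T x.castSucc).map (T x) ≃ₗ[S] Q) :
    Nonempty (((kernelChain K T x.castSucc).map I.mkQ ⧸
      ((kernelChain K T x.succ).map I.mkQ).submoduleOf ((kernelChain K T x.castSucc).map I.mkQ))
        ≃ₗ[S] (Q ⧸ LinearMap.range (m • (LinearMap.id : Q →ₗ[S] Q)))) := by
  refine nonempty_equiv_of_ker_eq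
    (Submodule.mkQ _ ∘ₗ I.mkQ.submoduleMap (kernelChain K T x.castSucc))
    (Submodule.mkQ _ ∘ₗ e.toLinearMap ∘ₗ (T x).submoduleMap (kernelChain K T x.castSucc))
    ((Submodule.mkQ_surjective _).comp (I.mkQ.submoduleMap_surjective _))
    ((Submodule.mkQ_surjective _).comp
      (e.surjective.comp ((T x).submoduleMap_surjective _))) ?_
  rintro ⟨f, hf⟩
  have h1 : (Submodule.mkQ (((kernelChain K T x.succ).map I.mkQ).submoduleOf
      ((kernelChain K T x.castSucc).map I.mkQ)) ∘ₗ
        I.mkQ.submoduleMap (kernelChain K T x.castSucc)) ⟨f, hf⟩ = 0 ↔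
      ∃ f' ∈ kernelChain K T x.succ, f' - f ∈ I := by
    rw [LinearMap.comp_apply, Submodule.mkQ_apply, Submodule.Quotient.mk_eq_zero]
    change I.mkQ f ∈ (kernelChain K T x.succ).map I.mkQ ↔ _
    rw [Submodule.mem_map]
    simp only [Submodule.mkQ_apply, Submodule.Quotient.eq]
  have h2 : (Submodule.mkQ (LinearMap.range (m • (LinearMap.id : Q →ₗ[S] Q))) ∘ₗ e.toLinearMap ∘ₗ
      (T x).submoduleMap (kernelChain K T x.castSucc)) ⟨f, hf⟩ = 0 ↔
      ∃ g ∈ kernelChain K T x.castSucc, T x f = m • T x g := by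
    rw [LinearMap.comp_apply, Submodule.mkQ_apply, Submodule.Quotient.mk_eq_zero]
    constructor
    · rintro ⟨q, hq⟩
      obtain ⟨⟨_, g, hg, rfl⟩, rfl⟩ := e.surjective q
      refine ⟨g, hg, ?_⟩
      have h3 : m • (⟨T x g, g, hg, rfl⟩ : (kernelChain K T x.castSucc).map (T x)) =
          (T x).submoduleMap (kernelChain K T x.castSucc) ⟨f, hf⟩ := by
        apply e.injective
        rw [map_nsmul]
        exact hq
      exact (congrArg Subtype.val h3).symm
    · rintro ⟨g, hg, h⟩
      refine ⟨e ⟨T x g, g, hg, rfl⟩, ?_⟩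
      rw [LinearMap.smul_apply, LinearMap.id_apply, ← map_nsmul]
      exact congrArg e (Subtype.ext h.symm)
  rw [h1, h2]
  constructor
  · rintro ⟨f', hf', h⟩
    rw [mem_kernelChain_succ] at hf'
    obtain ⟨g, hg, hgT⟩ := hI _ (sub_mem hf'.1.1 hf.1) h
    have h3 := hgT x
    rw [map_sub, hf'.2, zero_sub] at h3
    -- For m = 0 torsion-freeness is of no use, but then T x f = 0 and 0 is a witness.
    by_cases hm : m = 0
    · refine ⟨0, zero_mem _, ?_⟩
      rw [hm, zero_smul, neg_eq_zero] at h3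
      rw [h3, map_zero, smul_zero]
    -- For earlier maps m T_y g = T_y (f' - f) = 0, so torsion-freeness places g in the same term of
    -- the chain.
    · refine ⟨-g, ⟨neg_mem hg, fun y hy => ?_⟩, by rw [map_neg, smul_neg, ← h3, neg_neg]⟩
      rw [map_neg, neg_eq_zero]
      refine hA _ hm ?_
      rw [← hgT y, map_sub, hf'.1.2 y hy, hf.2 y hy, sub_zero]
  · rintro ⟨g, hg, h⟩
    refine ⟨f - m • g, mem_kernelChain_succ.2 ⟨sub_mem hf (nsmul_mem hg m), ?_⟩, ?_⟩
    · rw [map_sub, map_nsmul, h, sub_self]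
    · rw [sub_sub_cancel_left]
      exact neg_mem (hmI g hg.1)

end Chain

/-! ### Maps of `ℤ Sₙ`-modules -/

/-- An equivariant linear map as a map of modules over the group ring. -/
def equivariantHom {n : ℕ} {V V' : Type*} [AddCommGroup V] [AddCommGroup V']
    {ρ : Representation ℤ (Perm (Fin n)) V} {ρ' : Representation ℤ (Perm (Fin n)) V'}
    (g : V →ₗ[ℤ] V') (h : ∀ σ v, g (ρ σ v) = ρ' σ (g v)) : ρ.asModule →ₗ[ZS n] ρ'.asModule where
  toFun v := ρ'.asModuleEquiv.symm (g (ρ.asModuleEquiv v))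
  map_add' v w := by simp only [map_add]
  map_smul' y v := by
    induction y using MonoidAlgebra.induction_linear with
    | zero => simp
    | add y z hy hz =>
      rw [RingHom.id_apply] at *
      rw [add_smul, add_smul, map_add, map_add, map_add, hy, hz]
    | single σ z =>
      rw [RingHom.id_apply, Representation.single_smul, Representation.single_smul]
      exact (map_smul g z (ρ σ (ρ.asModuleEquiv v))).trans (congrArg (z • ·) (h σ _))

lemma polyRep_derivation {n : ℕ} {D : Derivation ℤ (Poly ℕ) (Poly ℕ)}
    (hc : ∀ (σ : Perm (Fin n)) i, D (polyRep n σ (cv i)) = polyRep n σ (D (cv i)))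
    (hu : ∀ (σ : Perm (Fin n)) i, D (polyRep n σ (uv i)) = polyRep n σ (D (uv i)))
    (σ : Perm (Fin n)) (F : Poly ℕ) : D (polyRep n σ F) = polyRep n σ (D F) := by
  induction F using MvPolynomial.induction_on with
  | C a =>
    have h1 : polyRep n σ (C a) = C a := rename_C _ a
    have h2 : D (C a) = 0 := Derivation.map_algebraMap D a
    rw [h1, h2, map_zero]
  | add p q hp hq => simp only [map_add, hp, hq]
  | mul_X p i hp =>
    have h : D (polyRep n σ (X i)) = polyRep n σ (D (X i)) := by
      rcases i with i | i
      · exact hc σ i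
      · exact hu σ i
    rw [polyRep_mul, Derivation.leibniz, Derivation.leibniz, hp, h, map_add, smul_eq_mul,
      smul_eq_mul, smul_eq_mul, smul_eq_mul, polyRep_mul, polyRep_mul]

lemma polyRep_Dc {n : ℕ} (σ : Perm (Fin n)) (F : Poly ℕ) :
    Dc (polyRep n σ F) = polyRep n σ (Dc F) :=
  polyRep_derivation (fun σ i => by rw [polyRep_cv, Dc_cv, Dc_cv, polyRep_one])
    (fun σ i => by rw [polyRep_uv, Dc_uv, Dc_uv, map_zero]) σ F

lemma polyRep_Du {n : ℕ} (σ : Perm (Fin n)) (F : Poly ℕ) :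
    Du (polyRep n σ F) = polyRep n σ (Du F) :=
  polyRep_derivation (fun σ i => by rw [polyRep_cv, Du_cv, Du_cv, map_zero])
    (fun σ i => by rw [polyRep_uv, Du_uv, Du_uv, polyRep_one]) σ F

lemma polyRep_homogeneousComponent {n : ℕ} (σ : Perm (Fin n)) (j : ℕ) (F : Poly ℕ) :
    homogeneousComponent j (polyRep n σ F) = polyRep n σ (homogeneousComponent j F) := by
  exact rename_homogeneousComponent (φ := Sum.map (extendPerm n σ) (extendPerm n σ)) j F |>.symm

lemma polyRep_factorMap {n : ℕ} (e i j : ℕ) (σ : Perm (Fin n)) (F : Poly ℕ) :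
    factorMap e i j (polyRep n σ F) = polyRep n σ (factorMap e i j F) := by
  have h (r : ℕ) (G : Poly ℕ) : Dc^[r] (polyRep n σ G) = polyRep n σ (Dc^[r] G) := by
    induction r generalizing G with
    | zero => rfl
    | succ r ih => rw [Function.iterate_succ_apply, polyRep_Dc, ih, Function.iterate_succ_apply]
  simp only [factorMap, LinearMap.comp_apply, Module.End.pow_apply, polyRep_homogeneousComponent]
  refine Eq.trans ?_ (h _ _)
  congr 1
  split_ifs
  · exact polyRep_Du σ _
  · rfl

/-- `toPoly` on the multilinear polynomials. -/
def toPolyHom (n : ℕ) : (multilinear n).asSubmodule →ₗ[ZS n] PolyMod n :=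
  equivariantHom (ρ := permRep n) (ρ' := polyRep n) toPoly toPoly_permRep ∘ₗ Submodule.subtype _

/-- The augmentation modulo `l` on the multilinear polynomials. -/
def augmentationHom (n l : ℕ) : (multilinear n).asSubmodule →ₗ[ZS n] TrivialMod n l :=
  equivariantHom (ρ := permRep n) (ρ' := Representation.trivial ℤ (Perm (Fin n)) (ZMod l))
    ((Int.castAddHom (ZMod l)).toIntLinearMap ∘ₗ augmentation)
    (fun σ f => by
      rw [LinearMap.comp_apply, augmentation_permRep, Representation.trivial_apply]; rfl) ∘ₗ
    Submodule.subtype _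

lemma augmentationHom_eq_zero_iff {n l : ℕ} (f : (multilinear n).asSubmodule) :
    augmentationHom n l f = 0 ↔ (l : ℤ) ∣ augmentation ((permRep n).asModuleEquiv f.1) :=
  ZMod.intCast_zmod_eq_zero_iff_dvd _ l

end IntPI

namespace IntPI
open MvPolynomial IntPI.Poly

/-! ### The labels of the factors -/

/-- The labels that belong to partitions. -/
def ShapeLabel (n : ℕ) : Type := Σ μ : Shape n, Fin (μ.1.rowLen 0 - μ.1.rowLen 1 + 1)

lemma card_eq_add_rowLen {μ : YoungDiagram} (h : μ.rowLen 3 = 0) :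
    μ.card = μ.rowLen 0 + μ.rowLen 1 + μ.rowLen 2 := by
  have h1 : ∀ c ∈ μ.cells, c.1 ∈ Finset.range 3 := by
    rintro ⟨r, a⟩ hc
    rw [Finset.mem_range]
    by_contra hr
    have h2 : (3, 0) ∈ μ :=
      μ.up_left_mem (not_lt.1 hr) (Nat.zero_le _) ((YoungDiagram.mem_cells _).1 hc)
    rw [YoungDiagram.mem_iff_lt_rowLen] at h2
    omega
  have h2 := Finset.card_eq_sum_card_fiberwise h1
  rw [Finset.sum_range_succ, Finset.sum_range_succ, Finset.sum_range_one] at h2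
  rw [YoungDiagram.rowLen_eq_card, YoungDiagram.rowLen_eq_card, YoungDiagram.rowLen_eq_card]
  exact h2

lemma eq_of_rowLen_eq {μ ν : YoungDiagram} (h : ∀ i, μ.rowLen i = ν.rowLen i) : μ = ν := by
  ext ⟨r, a⟩
  rw [YoungDiagram.mem_cells, YoungDiagram.mem_cells, YoungDiagram.mem_iff_lt_rowLen,
    YoungDiagram.mem_iff_lt_rowLen, h]

lemma exists_rowLen_eq {p q r : ℕ} (h1 : q ≤ p) (h2 : r ≤ q) : ∃ μ : YoungDiagram,
    μ.rowLen 0 = p ∧ μ.rowLen 1 = q ∧ μ.rowLen 2 = r ∧ μ.rowLen 3 = 0 := by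
  have h : [p, q, r].SortedGE := by
    rw [List.sortedGE_iff_pairwise]
    simp
    omega
  refine ⟨YoungDiagram.ofRowLens [p, q, r] h, ?_, ?_, ?_, ?_⟩
  · exact YoungDiagram.rowLen_ofRowLens (hw := h) (⟨0, by simp⟩ : Fin [p, q, r].length)
  · exact YoungDiagram.rowLen_ofRowLens (hw := h) (⟨1, by simp⟩ : Fin [p, q, r].length)
  · exact YoungDiagram.rowLen_ofRowLens (hw := h) (⟨2, by simp⟩ : Fin [p, q, r].length)
  · by_contra h3
    have h4 := YoungDiagram.mem_iff_lt_rowLen.2 (Nat.pos_of_ne_zero h3)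
    rw [YoungDiagram.mem_ofRowLens] at h4
    simp at h4

namespace ShapeLabel

variable {n : ℕ}

/-- The degree `j` that belongs to a label. -/
def deg (x : ShapeLabel n) : ℕ := x.1.1.rowLen 1 + x.2

/-- The position of a label in the chain. -/
def key (x : ShapeLabel n) : ℕ ×ₗ ℕ ×ₗ ℕ :=
  toLex (deg x, toLex (x.1.1.rowLen 2, x.1.1.rowLen 1))

lemma card_eq (x : ShapeLabel n) :
    x.1.1.rowLen 0 + x.1.1.rowLen 1 + x.1.1.rowLen 2 = n := by
  rw [← card_eq_add_rowLen x.1.2.2.2.2, x.1.2.1]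

lemma key_bounds (x : ShapeLabel n) : x.1.1.rowLen 2 ≤ 1 ∧ 1 ≤ x.1.1.rowLen 1 ∧
    x.1.1.rowLen 1 ≤ deg x ∧ x.1.1.rowLen 1 + deg x + x.1.1.rowLen 2 ≤ n := by
  have h0 := x.1.1.rowLen_anti 0 1 (by omega)
  have h1 := x.2.2
  have h2 := card_eq x
  refine ⟨x.1.2.2.2.1, x.1.2.2.1, ?_, ?_⟩ <;> unfold deg <;> omega

lemma key_injective : Function.Injective (key (n := n)) := by
  intro x y h
  have hx := card_eq x
  have hy := card_eq y
  have h1 := congrArg (fun z => (ofLex z).1) h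
  have h2 := congrArg (fun z => (ofLex (ofLex z).2).1) h
  have h3 := congrArg (fun z => (ofLex (ofLex z).2).2) h
  change deg x = deg y at h1
  change x.1.1.rowLen 2 = y.1.1.rowLen 2 at h2
  change x.1.1.rowLen 1 = y.1.1.rowLen 1 at h3
  have h4 : x.1 = y.1 := by
    refine Subtype.ext (eq_of_rowLen_eq fun i => ?_)
    rcases i with _ | _ | _ | i
    · omega
    · exact h3
    · exact h2
    · have hx3 := x.1.1.rowLen_anti 3 (i + 3) (by omega)
      have hy3 := y.1.1.rowLen_anti 3 (i + 3) (by omega)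
      have hx0 := x.1.2.2.2.2
      have hy0 := y.1.2.2.2.2
      change x.1.1.rowLen (i + 3) = y.1.1.rowLen (i + 3)
      omega
  obtain ⟨μ, t⟩ := x
  obtain ⟨ν, u⟩ := y
  obtain rfl : μ = ν := h4
  have h5 : (t : ℕ) = u := Nat.add_left_cancel h1
  rw [Fin.ext h5]

/-- The shape is (n - i - e, i, e), and i + j + e ≤ n says that j ≤ λ₁. So labels correspond exactly
to the triples of `eq_zero_of_factorMap_eq_zero`. -/
lemma exists_key_eq {e i j : ℕ} (he : e ≤ 1) (hi : 1 ≤ i) (hij : i ≤ j) (hn : i + j + e ≤ n) :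
    ∃ x : ShapeLabel n, x.1.1.rowLen 2 = e ∧ x.1.1.rowLen 1 = i ∧ deg x = j := by
  obtain ⟨μ, h0, h1, h2, h3⟩ := exists_rowLen_eq (p := n - i - e) (q := i) (r := e)
    (by omega) (by omega)
  refine ⟨⟨⟨μ, ?_, ?_, ?_, h3⟩, ⟨j - i, ?_⟩⟩, h2, h1, ?_⟩
  · rw [card_eq_add_rowLen h3]; omega
  · omega
  · omega
  · change j - i < μ.rowLen 0 - μ.rowLen 1 + 1
    omega
  · change μ.rowLen 1 + (j - i) = j
    omega

instance : LinearOrder (ShapeLabel n) := LinearOrder.lift' key key_injective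

instance : Finite (ShapeLabel n) := by
  let g : ShapeLabel n → Fin (n + 1) × Fin (n + 1) × Fin (n + 1) := fun x =>
    (⟨deg x, by have := key_bounds x; omega⟩, ⟨x.1.1.rowLen 2, by have := key_bounds x; omega⟩,
      ⟨x.1.1.rowLen 1, by have := key_bounds x; omega⟩)
  refine Finite.of_injective g fun x y h => key_injective ?_
  simp only [g, Prod.mk.injEq, Fin.mk.injEq] at h
  rw [key, key, h.1, h.2.1, h.2.2]

lemma lt_iff {x y : ShapeLabel n} : x < y ↔ deg x < deg y ∨ deg x = deg y ∧
    (x.1.1.rowLen 2 < y.1.1.rowLen 2 ∨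
      x.1.1.rowLen 2 = y.1.1.rowLen 2 ∧ x.1.1.rowLen 1 < y.1.1.rowLen 1) := by
  change key x < key y ↔ _
  rw [key, key, Prod.Lex.toLex_lt_toLex, Prod.Lex.toLex_lt_toLex]

/-- The map that detects the factors with a given label. -/
def hom (x : ShapeLabel n) : (multilinear n).asSubmodule →ₗ[ZS n] PolyMod n :=
  equivariantHom (ρ := polyRep n) (ρ' := polyRep n)
    (factorMap (x.1.1.rowLen 2) (x.1.1.rowLen 1) (deg x)) (polyRep_factorMap _ _ _) ∘ₗ toPolyHom n

end ShapeLabel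

/-! ### Images of the detecting maps along the chain -/

/-- The value of `toPoly` on a multilinear polynomial. -/
def polyOf {n : ℕ} (f : (multilinear n).asSubmodule) : Poly ℕ :=
  toPoly ((permRep n).asModuleEquiv f.1)

lemma ShapeLabel.hom_apply {n : ℕ} (x : ShapeLabel n) (f : (multilinear n).asSubmodule) :
    x.hom f = (polyRep n).asModuleEquiv.symm
      (factorMap (x.1.1.rowLen 2) (x.1.1.rowLen 1) (deg x) (polyOf f)) := rfl

lemma ShapeLabel.hom_eq_zero_iff {n : ℕ} (x : ShapeLabel n) (f : (multilinear n).asSubmodule) :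
    x.hom f = 0 ↔ factorMap (x.1.1.rowLen 2) (x.1.1.rowLen 1) (deg x) (polyOf f) = 0 := by
  rw [hom_apply, LinearEquiv.map_eq_zero_iff]

lemma mem_ker_augmentationHom {n : ℕ} (f : (multilinear n).asSubmodule) :
    f ∈ LinearMap.ker (augmentationHom n 0) ↔
      (permRep n).asModuleEquiv f.1 ∈ augmentationKer n := by
  rw [LinearMap.mem_ker, augmentationHom_eq_zero_iff, Nat.cast_zero, zero_dvd_iff]
  exact ⟨fun h => ⟨f.2, h⟩, fun h => h.2⟩

lemma polyOf_mem {n : ℕ} {f : (multilinear n).asSubmodule}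
    (hf : f ∈ LinearMap.ker (augmentationHom n 0)) :
    polyOf f ∈ Wt (Finset.range n) ∧ Eu (polyOf f) = 0 :=
  (map_augmentationKer n).1 ⟨_, (mem_ker_augmentationHom f).1 hf, rfl⟩

lemma exists_polyOf_eq {n : ℕ} {F : Poly ℕ} (h : F ∈ Wt (Finset.range n)) (h' : Eu F = 0) :
    ∃ f ∈ LinearMap.ker (augmentationHom n 0), polyOf f = F := by
  obtain ⟨f, hf, rfl⟩ := (map_augmentationKer n).2 ⟨h, h'⟩
  exact ⟨⟨(permRep n).asModuleEquiv.symm f, hf.1⟩, (mem_ker_augmentationHom _).2 hf, rfl⟩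

/-- The inclusion ≤ is `exists_factorMap_eq` together with transitivity on generators; ≥ lifts one
generator by `exists_preimage_gen`. The factorial is (j - i)!, since the second label component is j
- i. -/
lemma map_hom_eq_span {n N : ℕ} (o : Fin N ≃o ShapeLabel n) (x : Fin N)
    (T : Tableau n (o x).1.1) :
    (kernelChain (LinearMap.ker (augmentationHom n 0)) (fun y => (o y).hom) x.castSucc).map
        (o x).hom =
      Submodule.span (ZS n) {(((o x).2 : ℕ).factorial : ℤ) •
        (Tableau.colSymmetrizer T • Tableau.tabVec T)} := by
  obtain ⟨he, hi, hij, hn⟩ := (o x).key_bounds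
  have h3 := (o x).1.2.2.2.2
  have hd : (o x).deg - (o x).1.1.rowLen 1 = (o x).2 := Nat.add_sub_cancel_left _ _
  obtain ⟨k, hk⟩ : ∃ k, (o x).1.1.rowLen 1 = k + 1 := ⟨_, (Nat.sub_add_cancel hi).symm⟩
  set e := (o x).1.1.rowLen 2 with he'
  set L := (Tableau.longCells e k).map (Tableau.entry T) with hLdef
  have hmem : ∀ c ∈ Tableau.longCells e k, c ∈ (o x).1.1 := fun c hc =>
    Tableau.mem_of_mem_longCells hk hc
  have hL1 : L.Nodup := (Tableau.longCells_nodup e k).map_on fun c hc d hd' h =>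
    Tableau.entry_injOn T (hmem c hc) (hmem d hd') h
  have hL2 : L.length = 2 * (o x).1.1.rowLen 1 + e := by
    rw [hLdef, List.length_map, Tableau.longCells_length he, hk]
  have hL3 : ∀ y ∈ L, y < n := by
    intro y hy
    obtain ⟨c, hc, rfl⟩ := List.mem_map.1 hy
    exact Tableau.entry_lt T (hmem c hc)
  have hgen : Tableau.colSymmetrizer T • Tableau.tabVec T =
      (polyRep n).asModuleEquiv.symm (gen e L) := by
    rw [LinearEquiv.eq_symm_apply]
    exact Tableau.colSymmetrizer_smul_eq_gen T hk he h3
  rw [hgen]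
  apply le_antisymm
  · rintro _ ⟨f, ⟨hf, hfx⟩, rfl⟩
    obtain ⟨h1, h2⟩ := polyOf_mem hf
    -- Every admissible earlier triple with the same j is a label that precedes x, so membership in
    -- the chain makes its map vanish.
    obtain ⟨G, hG, hGf⟩ := exists_factorMap_eq h1 h2 he hi hij
      (by rwa [Finset.card_range]) (fun e' i' he' hi' hij' hn' hlt => by
        rw [Finset.card_range] at hn'
        obtain ⟨y, rfl, rfl, hy⟩ := ShapeLabel.exists_key_eq he' hi' hij' hn'
        have h4 : (o (o.symm y)).hom f = 0 := hfx (o.symm y) (by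
          rw [Fin.castSucc_lt_castSucc_iff, OrderIso.symm_apply_lt, ShapeLabel.lt_iff]
          exact Or.inr ⟨hy, hlt⟩)
        rwa [OrderIso.apply_symm_apply, ShapeLabel.hom_eq_zero_iff, hy] at h4)
    rw [ShapeLabel.hom_apply, hGf, hd, map_zsmul]
    exact zsmul_mem_span_gen hL1 hL2 hL3 _ hG
  · rw [Submodule.span_singleton_le_iff_mem]
    obtain ⟨F, hF, hEF, hFx, hF'⟩ := exists_preimage_gen (s := Finset.range n) he hi hij
      (by rwa [Finset.card_range]) hL1 hL2 (fun y hy => Finset.mem_range.2 (hL3 y hy))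
    obtain ⟨f, hf, rfl⟩ := exists_polyOf_eq hF hEF
    refine ⟨f, ⟨hf, fun y hy => ?_⟩, ?_⟩
    · rw [Fin.castSucc_lt_castSucc_iff, ← o.lt_iff_lt, ShapeLabel.lt_iff] at hy
      rw [ShapeLabel.hom_eq_zero_iff]
      exact hF' _ _ _ (o y).key_bounds.1 (o y).key_bounds.2.2.1 hy
    · rw [ShapeLabel.hom_apply, hFx, hd, map_zsmul]

/-! ### The factors modulo the identities -/

section Main

variable (R₁ R₂ M : Type*) [CommRing R₁] [CommRing R₂] [AddCommGroup M]
  [Module R₁ M] [Module R₂ᵐᵒᵖ M] [SMulCommClass R₁ R₂ᵐᵒᵖ M] (n : ℕ)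

/-- The multilinear identities. -/
abbrev multilinearIdentities : Submodule (ZS n) (multilinear n).asSubmodule :=
  (identities n (UpperTriangular R₁ M R₂)).asSubmodule.submoduleOf (multilinear n).asSubmodule

variable {n}

/-- If all detecting maps vanish then `toPoly f = 0`, so every pair coefficient vanishes as well as
the coefficient sum. Hence the chain ends at 0 in the quotient. -/
lemma mem_multilinearIdentities_of_forall {N : ℕ} (o : Fin N ≃o ShapeLabel n)
    {f : (multilinear n).asSubmodule}
    (hf : f ∈ kernelChain (LinearMap.ker (augmentationHom n 0)) (fun y => (o y).hom)
      (Fin.last N)) : f ∈ multilinearIdentities R₁ R₂ M n := by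
  obtain ⟨hf, h⟩ := hf
  obtain ⟨h1, h2⟩ := polyOf_mem hf
  have h3 := (mem_ker_augmentationHom f).1 hf
  refine isPolynomialIdentity_of_toPoly_eq_zero R₁ R₂ M h3.1 h3.2 ?_
  refine eq_zero_of_factorMap_eq_zero h1 h2 fun e i j he hi hij hn => ?_
  rw [Finset.card_range] at hn
  obtain ⟨y, rfl, rfl, rfl⟩ := ShapeLabel.exists_key_eq he hi hij hn
  have h4 : (o (o.symm y)).hom f = 0 := h (o.symm y) (Fin.castSucc_lt_last _)
  rwa [OrderIso.apply_symm_apply, ShapeLabel.hom_eq_zero_iff] at h4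

lemma nonempty_spechtMod_equiv {N : ℕ} (o : Fin N ≃o ShapeLabel n) (x : Fin N)
    (T : Tableau n (o x).1.1) :
    Nonempty ((((kernelChain (LinearMap.ker (augmentationHom n 0)) (fun y => (o y).hom)
      x.castSucc).map (multilinearIdentities R₁ R₂ M n).mkQ) ⧸
      ((kernelChain (LinearMap.ker (augmentationHom n 0)) (fun y => (o y).hom)
      x.succ).map (multilinearIdentities R₁ R₂ M n).mkQ).submoduleOf
        ((kernelChain (LinearMap.ker (augmentationHom n 0)) (fun y => (o y).hom)
      x.castSucc).map (multilinearIdentities R₁ R₂ M n).mkQ)) ≃ₗ[ZS n]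
        Tableau.SpechtMod T (moduleExponent M)) := by
  obtain ⟨e⟩ := Tableau.nonempty_equiv_specht T (o x).1.2.2.2.2
    (N := (((o x).2 : ℕ).factorial : ℤ)) (by exact_mod_cast Nat.factorial_ne_zero _)
  refine nonempty_factor_equiv (fun a hm ha => ?_) (fun f hf hfI => ?_) (fun f hf => ?_) x
    ((LinearEquiv.ofEq _ _ (map_hom_eq_span o x T)).trans e)
  · rw [← natCast_zsmul] at ha
    exact (smul_eq_zero.1 ha).resolve_left (Int.natCast_ne_zero.2 hm)
  · obtain ⟨g, hg, hfg⟩ :=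
      (isPolynomialIdentity_iff R₁ R₂ M ((mem_ker_augmentationHom f).1 hf)).1 hfI
    refine ⟨⟨(permRep n).asModuleEquiv.symm g, hg.1⟩, (mem_ker_augmentationHom _).2 hg,
      fun y => ?_⟩
    have h : polyOf f = (moduleExponent M : ℤ) •
        polyOf ⟨(permRep n).asModuleEquiv.symm g, hg.1⟩ := hfg
    rw [ShapeLabel.hom_apply, h, map_zsmul, map_zsmul, ← ShapeLabel.hom_apply, natCast_zsmul]
  · have h := (mem_ker_augmentationHom f).1 hf
    rw [← natCast_zsmul]
    exact isPolynomialIdentity_smul R₁ R₂ M h.1 h.2 (dvd_refl _)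

/-- The sum of the augmentation kernel and the identities is { f : ℓ divides the coefficient sum of
f }, and the coefficient sum modulo ℓ is onto since a multilinear word exists for n ≥ 1. -/
lemma nonempty_trivialMod_equiv (hn : 1 ≤ n) :
    Nonempty (((⊤ : Submodule (ZS n) (PolyFunctions n (UpperTriangular R₁ M R₂))) ⧸
      ((LinearMap.ker (augmentationHom n 0)).map
        (multilinearIdentities R₁ R₂ M n).mkQ).submoduleOf ⊤) ≃ₗ[ZS n]
        TrivialMod n (ringExponent R₁ R₂)) := by
  obtain ⟨w, hw, hw1, -⟩ := exists_single_of_list (n := n) (l := List.range n)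
    (by rw [Ne, List.range_eq_nil]; omega) List.nodup_range (by ext; simp)
  let w' : (multilinear n).asSubmodule := ⟨(permRep n).asModuleEquiv.symm w, hw⟩
  refine nonempty_equiv_of_ker_eq
    (Submodule.mkQ _ ∘ₗ (Submodule.topEquiv (R := ZS n)).symm.toLinearMap ∘ₗ
      (multilinearIdentities R₁ R₂ M n).mkQ)
    (augmentationHom n (ringExponent R₁ R₂))
    ((Submodule.mkQ_surjective _).comp (Submodule.topEquiv.symm.surjective.comp
      (Submodule.mkQ_surjective _))) ?_ ?_
  · intro z
    obtain ⟨z', hz⟩ := ZMod.intCast_surjective (z : ZMod (ringExponent R₁ R₂))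
    refine ⟨z' • w', ?_⟩
    have h : augmentation (z' • w) = z' := by rw [map_zsmul, hw1, smul_eq_mul, mul_one]
    exact (congrArg (Int.cast : ℤ → ZMod (ringExponent R₁ R₂)) h).trans hz
  · intro f
    rw [LinearMap.comp_apply, Submodule.mkQ_apply, Submodule.Quotient.mk_eq_zero,
      augmentationHom_eq_zero_iff]
    change (multilinearIdentities R₁ R₂ M n).mkQ f ∈
      (LinearMap.ker (augmentationHom n 0)).map (multilinearIdentities R₁ R₂ M n).mkQ ↔ _
    rw [Submodule.mem_map]
    simp only [Submodule.mkQ_apply, Submodule.Quotient.eq]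
    constructor
    · rintro ⟨k, hk, h⟩
      have h1 := dvd_augmentation R₁ R₂ M (k - f).2 h
      have h2 : augmentation ((permRep n).asModuleEquiv k.1) = 0 :=
        ((mem_ker_augmentationHom k).1 hk).2
      have h3 : augmentation ((permRep n).asModuleEquiv (k - f).1) =
          augmentation ((permRep n).asModuleEquiv k.1) -
            augmentation ((permRep n).asModuleEquiv f.1) := map_sub augmentation _ _
      rw [h2, zero_sub] at h3
      rw [← dvd_neg, ← h3]
      exact h1
    · intro h
      set z := augmentation ((permRep n).asModuleEquiv f.1) with hz
      -- Subtracting z times a word makes the coefficient sum zero, and z • w is an identity because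
      -- ℓ divides z.
      refine ⟨f - z • w', (mem_ker_augmentationHom _).2 ⟨(f - z • w').2, ?_⟩, ?_⟩
      · have h1 : augmentation ((permRep n).asModuleEquiv f.1 - z • w) = 0 := by
          rw [map_sub, map_zsmul, hw1, smul_eq_mul, mul_one, sub_self]
        exact h1
      · rw [sub_sub_cancel_left]
        exact neg_mem (isPolynomialIdentity_of_dvd R₁ R₂ M h w)

end Main

end IntPI

end

/-! ### Assembly of the chain -/

theorem mainTheorem8 {R₁ R₂ M : Type*} [CommRing R₁] [CommRing R₂] [AddCommGroup M]
    [Module R₁ M] [Module R₂ᵐᵒᵖ M] [SMulCommClass R₁ R₂ᵐᵒᵖ M] (n : ℕ) (hn : 1 ≤ n) :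
    ∃ (N : ℕ)
      (C : Fin (N + 1) →
        Submodule (IntPI.ZS n) (IntPI.PolyFunctions n (IntPI.UpperTriangular R₁ M R₂)))
      (e : Fin N ≃ IntPI.FactorLabel n),
      Antitone C ∧ C 0 = ⊤ ∧ C (Fin.last N) = ⊥ ∧
      ∀ i : Fin N,
        (e i = none →
          Nonempty ((C i.castSucc ⧸ (C i.succ).submoduleOf (C i.castSucc)) ≃ₗ[IntPI.ZS n]
            IntPI.TrivialMod n (IntPI.ringExponent R₁ R₂))) ∧
        (∀ μ j, e i = some ⟨μ, j⟩ → ∀ T : IntPI.Tableau n μ.1,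
          Nonempty ((C i.castSucc ⧸ (C i.succ).submoduleOf (C i.castSucc)) ≃ₗ[IntPI.ZS n]
            IntPI.Tableau.SpechtMod T (IntPI.moduleExponent M))) := by
  let _ := Fintype.ofFinite (IntPI.ShapeLabel n)
  obtain ⟨N, ⟨o⟩⟩ : ∃ N, Nonempty (Fin N ≃o IntPI.ShapeLabel n) :=
    ⟨_, ⟨monoEquivOfFin (IntPI.ShapeLabel n) rfl⟩⟩
  let I := IntPI.multilinearIdentities R₁ R₂ M n
  let K := IntPI.kernelChain (LinearMap.ker (IntPI.augmentationHom n 0)) (fun y => (o y).hom)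
  let C : Fin (N + 1 + 1) →
      Submodule (IntPI.ZS n) (IntPI.PolyFunctions n (IntPI.UpperTriangular R₁ M R₂)) :=
    -- The chain of kernels starts at the augmentation kernel; prepending ⊤ adds the trivial factor,
    -- which gets the label `none`.
    Fin.cons ⊤ fun k => (K k).map I.mkQ
  let e : Fin (N + 1) ≃ IntPI.FactorLabel n :=
    (finSuccEquiv N).trans (Equiv.optionCongr o.toEquiv)
  refine ⟨N + 1, C, e, ?_, rfl, ?_, ?_⟩
  · intro k l hkl
    induction k using Fin.cases with
    | zero => exact le_top
    | succ k =>
      induction l using Fin.cases with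
      | zero => exact absurd hkl (not_le.2 (Fin.succ_pos k))
      | succ l => exact Submodule.map_mono (IntPI.kernelChain_antitone (Fin.succ_le_succ_iff.1 hkl))
  · change (K (Fin.last N)).map I.mkQ = ⊥
    rw [eq_bot_iff, Submodule.map_le_iff_le_comap]
    intro f hf
    exact (Submodule.Quotient.mk_eq_zero _).2
      (IntPI.mem_multilinearIdentities_of_forall R₁ R₂ M o hf)
  · intro i
    induction i using Fin.cases with
    | zero =>
      refine ⟨fun _ => ?_, fun μ j h => ?_⟩
      · have h : K 0 = LinearMap.ker (IntPI.augmentationHom n 0) := IntPI.kernelChain_zero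
        have := IntPI.nonempty_trivialMod_equiv R₁ R₂ M hn
        rw [← h] at this
        exact this
      · have h0 : e 0 = none := congrArg (Option.map o) (finSuccEquiv_zero (n := N))
        exact absurd (h0.symm.trans h) (Option.some_ne_none _).symm
    | succ x =>
      have hx : e x.succ = some (o x) := congrArg (Option.map o) (finSuccEquiv_succ x)
      refine ⟨fun h => absurd (hx.symm.trans h) (Option.some_ne_none _), fun μ j h T => ?_⟩
      have h' : o x = ⟨μ, j⟩ := Option.some.inj (hx.symm.trans h)
      obtain rfl : (o x).1 = μ := congrArg Sigma.fst h'
      exact IntPI.nonempty_spechtMod_equiv R₁ R₂ M o x T
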